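/- Let $\mathbb T$ be the unit circle with normalized arc length measure $m$ and let $0<p<1$. Let $H^p(\mathbb T)$ be the closure of the analytic polynomials in $L^p(\mathbb T)=L^p(\mathbb T,m)$. Let $\eta$ be an inner function on the unit disc $\mathbb D$ (analytic, $|\eta|\le 1$ on $\mathbb D$, with unimodular radial limits at almost every point of $\mathbb T$) such that $\eta(0)=0$, and let $\mathbb E(\cdot|\eta)$ denote the conditional expectation on $L^1(\mathbb T)$ with respect to the $\sigma$-algebra generated by the boundary function of $\eta$. For $X=H^p(\mathbb T)$ or $X=L^p(\mathbb T)$, call $\mathbb E(\cdot|\eta)$ bounded on $X$ if there is a bounded linear operator $T:X\to X$ with $Tf=\mathbb E(f|\eta)$ for all $f\in X\cap L^1(\mathbb T)$; such a $T$ is then unique, and $\|\mathbb E(\cdot|\eta)\|_X:=\sup\{\|Tf\|_p : f\in X,\ \|f\|_p=1\}$. Then $\mathbb E(\cdot|\eta)$ is bounded on $H^p(\mathbb T)$ if and only if $\eta$ is a finite Blaschke product, i.e. $\eta(z)=c\prod_{j=1}^n\frac{z-a_j}{1-\overline{a_j}z}$ on $\mathbb D$ with $|c|=1$ and $a_1,\dots,a_n\in\mathbb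 D$. In that case $\mathbb E(\cdot|\eta)$ is also bounded on $L^p(\mathbb T)$, and $$\|\mathbb E(\cdot|\eta)\|_{H^p}=\|\mathbb E(\cdot|\eta)\|_{L^p}=\|\eta'\|_\infty^{\frac1p-1},\qquad \|\eta'\|_\infty=\sup_{w\in\mathbb T}|\eta'(w)|.$$ -/

import Mathlib

open MeasureTheory Filter Topology
open scoped ENNReal

noncomputable section

namespace HardyCondExp

/-- The circle carries its Borel `σ`-algebra. -/
instance : MeasurableSpace Circle := borel Circle

instance : BorelSpace Circle := ⟨rfl⟩

/-- The normalized arc length (Haar) measure on the circle, `dm = dθ / 2π`. -/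
def circleMeasure : Measure Circle :=
  (ENNReal.ofReal (2 * Real.pi))⁻¹ •
    (volume.restrict (Set.Ioc 0 (2 * Real.pi))).map Circle.exp

/-- The Hardy space `H^p(𝕋)`: all functions in `L^p(𝕋)` that can be approximated in the
`L^p` (quasi-)norm by analytic polynomials. -/
def hardy (p : ℝ≥0∞) : Submodule ℂ (Lp ℂ p circleMeasure) where
  carrier := {f | ∀ ε : ℝ≥0∞, 0 < ε → ∃ q : Polynomial ℂ,
    eLpNorm (fun w : Circle => f w - q.eval (w : ℂ)) p circleMeasure < ε}
  zero_mem' := by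
    intro ε hε
    refine ⟨0, ?_⟩
    have h : (fun w : Circle => (0 : Lp ℂ p circleMeasure) w - (0 : Polynomial ℂ).eval (w : ℂ))
        =ᵐ[circleMeasure] (0 : Circle → ℂ) := by
      filter_upwards [Lp.coeFn_zero ℂ p circleMeasure] with w hw
      rw [hw, Polynomial.eval_zero, sub_zero]
    rw [eLpNorm_congr_ae h, eLpNorm_zero]
    exact hε
  add_mem' := by
    intro f g hf hg ε hε
    obtain ⟨δ, hδ, H⟩ := exists_Lp_half ℂ circleMeasure p hε.ne'
    obtain ⟨q, hq⟩ := hf δ hδ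
    obtain ⟨r, hr⟩ := hg δ hδ
    refine ⟨q + r, ?_⟩
    have hm : ∀ (u : Lp ℂ p circleMeasure) (s : Polynomial ℂ),
        AEStronglyMeasurable (fun w : Circle => u w - s.eval (w : ℂ)) circleMeasure := fun u s =>
      (Lp.aestronglyMeasurable u).sub
        (show Continuous (fun w : Circle => s.eval (w : ℂ)) by fun_prop).aestronglyMeasurable
    have h : (fun w : Circle => (f + g) w - (q + r).eval (w : ℂ)) =ᵐ[circleMeasure]
        (fun w : Circle => f w - q.eval (w : ℂ)) + (fun w : Circle => g w - r.eval (w : ℂ)) := by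
      filter_upwards [Lp.coeFn_add f g] with w hw
      simp only [hw, Pi.add_apply, Polynomial.eval_add]
      ring
    rw [eLpNorm_congr_ae h]
    exact H _ _ (hm f q) (hm g r) hq.le hr.le
  smul_mem' := by
    intro c f hf ε hε
    have h : ∀ q : Polynomial ℂ,
        (fun w : Circle => (c • f) w - (c • q).eval (w : ℂ)) =ᵐ[circleMeasure]
        c • (fun w : Circle => f w - q.eval (w : ℂ)) := by
      intro q
      filter_upwards [Lp.coeFn_smul c f] with w hw
      simp only [hw, Pi.smul_apply, Polynomial.eval_smul, smul_sub]
    by_cases hc : c = 0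
    · refine ⟨0, ?_⟩
      have h' := h 0
      rw [smul_zero, hc, zero_smul, zero_smul] at h'
      rw [hc, zero_smul, eLpNorm_congr_ae h', eLpNorm_zero]
      exact hε
    · have hc' : ‖c‖ₑ ≠ 0 := by simpa using hc
      obtain ⟨q, hq⟩ := hf (ε / ‖c‖ₑ) (ENNReal.div_pos hε.ne' enorm_ne_top)
      refine ⟨c • q, ?_⟩
      rw [eLpNorm_congr_ae (h q), eLpNorm_const_smul, mul_comm]
      exact (ENNReal.lt_div_iff_mul_lt (Or.inl hc') (Or.inl enorm_ne_top)).1 hq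

/-- The radial limit `lim_{r → 1⁻} f (r w)` at a point `w` of the circle (a fixed junk value where
the limit does not exist). -/
def radialLimit (f : ℂ → ℂ) (w : Circle) : ℂ :=
  limUnder (𝓝[<] (1 : ℝ)) (fun r : ℝ => f ((r : ℂ) * (w : ℂ)))

/-- Inner functions: analytic on the open unit disc, bounded by `1` there, with unimodular radial
limits almost everywhere. Only the values of `η` on the open disc matter. -/
structure IsInner (η : ℂ → ℂ) : Prop where
  differentiableOn : DifferentiableOn ℂ η (Metric.ball 0 1)
  norm_le_one : ∀ z ∈ Metric.ball (0 : ℂ) 1, ‖η z‖ ≤ 1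
  radial : ∀ᵐ w : Circle ∂circleMeasure, ∃ l : ℂ, ‖l‖ = 1 ∧
    Tendsto (fun r : ℝ => η ((r : ℂ) * (w : ℂ))) (𝓝[<] (1 : ℝ)) (𝓝 l)

/-- Finite Blaschke products `c ∏_j (z - a_j) / (1 - conj a_j z)`, as functions on the disc. -/
def IsFiniteBlaschke (η : ℂ → ℂ) : Prop :=
  ∃ (c : ℂ) (n : ℕ) (a : Fin n → ℂ), ‖c‖ = 1 ∧ (∀ j, ‖a j‖ < 1) ∧
    ∀ z ∈ Metric.ball (0 : ℂ) 1,
      η z = c * ∏ j, (z - a j) / (1 - (starRingEnd ℂ) (a j) * z)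

/-- The boundary function of a function that is continuous on the disc is Borel measurable, so that
it generates a sub-`σ`-algebra of the Borel `σ`-algebra. -/
theorem measurable_radialLimit {f : ℂ → ℂ} (hf : ContinuousOn f (Metric.ball 0 1)) :
    Measurable (radialLimit f) := by
  classical
  let ι := {q : ℚ // 0 < q ∧ q < 1}
  let c : ι → ℝ := fun q => ((q : ℚ) : ℝ)
  let l : Filter ι := comap c (𝓝[<] (1 : ℝ))
  have hdisc : ∀ (w : Circle) (r : ℝ), r ∈ Set.Ioo (0 : ℝ) 1 →
      (r : ℂ) * (w : ℂ) ∈ Metric.ball (0 : ℂ) 1 := by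
    intro w r hr
    rw [mem_ball_zero_iff, norm_mul, Circle.norm_coe, mul_one, Complex.norm_real,
      Real.norm_of_nonneg hr.1.le]
    exact hr.2
  have hmeas : ∀ q : ι, Measurable (fun w : Circle => f ((c q : ℂ) * (w : ℂ))) := by
    intro q
    have hq : c q ∈ Set.Ioo (0 : ℝ) 1 := by
      refine ⟨?_, ?_⟩
      · simpa [c] using q.2.1
      · have := q.2.2
        simp only [c]
        exact_mod_cast this
    exact (hf.comp_continuous (by fun_prop) (fun w => hdisc w _ hq)).measurable
  have hcont : ∀ w : Circle, ContinuousOn (fun r : ℝ => f ((r : ℂ) * (w : ℂ))) (Set.Ioo 0 1) := by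
    intro w
    exact hf.comp (by fun_prop) (fun r hr => hdisc w r hr)
  have hden : ∀ a b : ℝ, 0 ≤ a → a < b → b ≤ 1 → ∃ q : ι, c q ∈ Set.Ioo a b := by
    intro a b ha hab hb
    obtain ⟨q, hq1, hq2⟩ := exists_rat_btwn hab
    have h0 : (0 : ℚ) < q := by exact_mod_cast ha.trans_lt hq1
    have h1 : q < (1 : ℚ) := by exact_mod_cast hq2.trans_le hb
    exact ⟨⟨q, h0, h1⟩, hq1, hq2⟩
  have hl : l.NeBot := by
    refine comap_neBot fun t ht => ?_
    obtain ⟨a, ha, hat⟩ := (mem_nhdsLT_iff_exists_Ioo_subset (a := (1 : ℝ))).1 ht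
    obtain ⟨q, hq⟩ := hden (max a 0) 1 (le_max_right _ _) (max_lt ha one_pos) le_rfl
    exact ⟨q, hat ⟨(le_max_left _ _).trans_lt hq.1, hq.2⟩⟩
  have hiff : ∀ (w : Circle) (x : ℂ),
      Tendsto (fun q : ι => f ((c q : ℂ) * (w : ℂ))) l (𝓝 x) ↔
      Tendsto (fun r : ℝ => f ((r : ℂ) * (w : ℂ))) (𝓝[<] (1 : ℝ)) (𝓝 x) := by
    intro w x
    refine ⟨fun h => ?_, fun h => h.comp tendsto_comap⟩
    rw [Metric.nhds_basis_closedBall.tendsto_right_iff] at h ⊢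
    intro ε hε
    obtain ⟨t, ht, hts⟩ := mem_comap.1 (h ε hε)
    obtain ⟨a, ha, hat⟩ := (mem_nhdsLT_iff_exists_Ioo_subset (a := (1 : ℝ))).1 ht
    have hmem : Set.Ioo (max a 0) 1 ∈ 𝓝[<] (1 : ℝ) :=
      Ioo_mem_nhdsLT (max_lt ha one_pos)
    filter_upwards [hmem] with r hr
    have hr01 : r ∈ Set.Ioo (0 : ℝ) 1 := ⟨(le_max_right _ _).trans_lt hr.1, hr.2⟩
    have hat' : ContinuousAt (fun r : ℝ => f ((r : ℂ) * (w : ℂ))) r :=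
      (hcont w).continuousAt (Ioo_mem_nhds hr01.1 hr01.2)
    by_contra hne
    have hopen : ∀ᶠ s : ℝ in 𝓝 r, f ((s : ℂ) * (w : ℂ)) ∉ Metric.closedBall x ε :=
      hat'.eventually (Metric.isClosed_closedBall.isOpen_compl.mem_nhds hne)
    obtain ⟨δ, hδ, hδs⟩ := Metric.eventually_nhds_iff.1 hopen
    obtain ⟨q, hq⟩ := hden r (min (r + δ) 1) hr01.1.le (lt_min (by linarith) hr.2)
      (min_le_right _ _)
    have hq1 : c q < r + δ := hq.2.trans_le (min_le_left _ _)
    have hq2 : c q < 1 := hq.2.trans_le (min_le_right _ _)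
    refine hδs (y := c q) ?_ (hts (hat ⟨?_, hq2⟩))
    · rw [Real.dist_eq, abs_of_pos (by linarith [hq.1])]
      linarith
    · exact (le_max_left _ _).trans_lt (hr.1.trans hq.1)
  have hset : MeasurableSet {w : Circle | ∃ x, Tendsto
      (fun q : ι => f ((c q : ℂ) * (w : ℂ))) l (𝓝 x)} :=
    measurableSet_exists_tendsto (f := fun (q : ι) (w : Circle) => f ((c q : ℂ) * (w : ℂ))) hmeas
  let S : Set Circle := {w : Circle | ∃ x, Tendsto
      (fun q : ι => f ((c q : ℂ) * (w : ℂ))) l (𝓝 x)}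
  let d : ℂ := Classical.epsilon (fun _ => False)
  have hoff : ∀ w ∉ S, radialLimit f w = d := by
    intro w hw
    have hF : (fun x : ℂ => map (fun r : ℝ => f ((r : ℂ) * (w : ℂ))) (𝓝[<] (1 : ℝ)) ≤ 𝓝 x) =
        fun _ => False := by
      funext x
      exact eq_false fun h => hw ⟨x, (hiff w x).2 h⟩
    change Classical.epsilon
      (fun x : ℂ => map (fun r : ℝ => f ((r : ℂ) * (w : ℂ))) (𝓝[<] (1 : ℝ)) ≤ 𝓝 x) = _
    rw [hF]
  refine measurable_of_tendsto_metrizable' l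
    (f := fun (q : ι) (w : Circle) => if w ∈ S then f ((c q : ℂ) * (w : ℂ)) else d)
    (fun q => Measurable.ite hset (hmeas q) measurable_const) ?_
  rw [tendsto_pi_nhds]
  intro w
  by_cases hw : w ∈ S
  · simp only [hw, if_true]
    obtain ⟨x, hx⟩ := hw
    have hx' := (hiff w x).1 hx
    have : radialLimit f w = x := hx'.limUnder_eq
    rwa [this]
  · simp only [hw, if_false]
    rw [hoff w hw]
    exact tendsto_const_nhds

/-- The `σ`-algebra on the circle generated by the boundary function of `η`. -/
@[reducible]
def sigmaAlgebra (η : ℂ → ℂ) : MeasurableSpace Circle :=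
  MeasurableSpace.comap (radialLimit η) inferInstance

/-- `T` is a bounded operator on the subspace `X` of `L^p(𝕋)` that extends the conditional
expectation `𝔼(· | η)`, which is defined on the integrable functions in `X`. -/
def IsBoundedCondExp {p : ℝ≥0∞} (η : ℂ → ℂ) (X : Submodule ℂ (Lp ℂ p circleMeasure))
    (T : X →ₗ[ℂ] X) : Prop :=
  (∃ C : ℝ, ∀ f : X, ‖(T f : Lp ℂ p circleMeasure)‖ ≤ C * ‖(f : Lp ℂ p circleMeasure)‖) ∧
  ∀ f : X, Integrable (f : Lp ℂ p circleMeasure) circleMeasure →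
    (T f : Lp ℂ p circleMeasure) =ᵐ[circleMeasure]
      circleMeasure[(f : Lp ℂ p circleMeasure) | sigmaAlgebra η]

/-- The operator (quasi-)norm `sup_{‖f‖_p = 1} ‖T f‖_p`. -/
def opNorm {p : ℝ≥0∞} {X : Submodule ℂ (Lp ℂ p circleMeasure)} (T : X →ₗ[ℂ] X) : ℝ :=
  sSup {r : ℝ | ∃ f : X, ‖(f : Lp ℂ p circleMeasure)‖ = 1 ∧ r = ‖(T f : Lp ℂ p circleMeasure)‖}

/-- `sup_{w ∈ 𝕋} |η'(w)|`, with the values of `η'` on the circle taken as radial limits. -/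
def derivSup (η : ℂ → ℂ) : ℝ :=
  ⨆ w : Circle, ‖radialLimit (deriv η) w‖

end HardyCondExp

end

open HardyCondExp

noncomputable section

namespace HardyCondExp

/-! ### The normalized arc length measure -/

/-! Let `b` be the boundary map of `η` and `m` arc length. As `η 0 = 0`, the mean value property
kills every nonzero moment of `b`, so `b` preserves `m`. If `∫ f · (Φ ∘ b) = ∫ G · Φ` for all
continuous `Φ` (`Represents`), then `𝔼(f | η) = G ∘ b`, whose `L^p` size is that of `G`. By density
of trigonometric polynomials it is enough to test `Φ = wⁿ`.

Necessity. The kernel `w / (1 - ā w)²` is the conjugate of the Cauchy kernel for `F ↦ F' a`, so by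
the chain rule it is represented by `conj (η' a)` times the kernel at `η a`
(`IsInner.represents_kernel`). Multiplying by `(1 - conj (η a) η)⁻ᴺ`, which passes through the
expectation, and applying Hölder's inequality turns boundedness into `|η' a|^q K(η a) ≤ C^q K(a)`,
where `K(a) = ∫ |1 - ā w|^(-2q) dm` is comparable to `(1 - |a|)^(1 - 2q)` and `N` is chosen so that
`q = p (1 + N/2)` lies in `(1/2, 1)`. Hence `|η' a| ≤ M ((1 - |η a|) / (1 - |a|))^β` with `β < 1`
(`IsBoundedCondExp.exists_norm_deriv_le`). Integrating this along radii shows that `|η| → 1`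
uniformly at the circle. Then the zeros stay in a smaller disc, only finitely many can be divided
out, and what remains is a unimodular constant.

Sufficiency and the norm. A finite Blaschke product that vanishes at `0` covers the circle with
Jacobian `J = |η'| > 0`. With sections `ζₖ`, the transfer operator `f ↦ ∑ₖ (f / J) ∘ ζₖ` represents
`f`. Subadditivity of `x ↦ x^p` and the change of variables bound its `p`-th power integral by `∫
|f|^p J^(1-p)`, which gives the upper bound. `H^p` is invariant because the expectation of a
polynomial is a polynomial in `η`. For functions living on the image of one section this is an
equality, so polynomials concentrating at a maximum point of `J` show that the bound is sharp, on
`H^p` and on `L^p` at once. -/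

lemma lintegral_circleMeasure (F : Circle → ℝ≥0∞) (hF : Measurable F) (a : ℝ) :
    ∫⁻ w, F w ∂circleMeasure =
      (ENNReal.ofReal (2 * Real.pi))⁻¹ *
        ∫⁻ θ in Set.Ioc a (a + 2 * Real.pi), F (Circle.exp θ) := by
  have hper : ∫⁻ θ in Set.Ioc 0 (0 + 2 * Real.pi), F (Circle.exp θ) =
      ∫⁻ θ in Set.Ioc a (a + 2 * Real.pi), F (Circle.exp θ) := by
    refine (isAddFundamentalDomain_Ioc Real.two_pi_pos 0).setLIntegral_eq
      (isAddFundamentalDomain_Ioc Real.two_pi_pos a) _ ?_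
    rintro ⟨g, hg⟩ x
    obtain ⟨n, rfl⟩ := AddSubgroup.mem_zmultiples_iff.1 hg
    have : (⟨n • (2 * Real.pi), hg⟩ : AddSubgroup.zmultiples (2 * Real.pi)) +ᵥ x
        = x + n * (2 * Real.pi) := by
      rw [AddSubgroup.vadd_def, vadd_eq_add, add_comm, ← zsmul_eq_mul]
    rw [this, Circle.exp_eq_exp.2 ⟨n, rfl⟩]
  rw [← hper, zero_add, circleMeasure, lintegral_smul_measure, smul_eq_mul,
    lintegral_map hF Circle.exp.continuous.measurable]

lemma integral_circleMeasure {F : Circle → ℂ} (hF : Continuous F) :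
    ∫ w, F w ∂circleMeasure =
      (2 * Real.pi : ℝ)⁻¹ • ∫ θ in (0 : ℝ)..(2 * Real.pi), F (Circle.exp θ) := by
  rw [circleMeasure, integral_smul_measure,
    integral_map Circle.exp.continuous.aemeasurable hF.aestronglyMeasurable,
    intervalIntegral.integral_of_le Real.two_pi_pos.le, ENNReal.toReal_inv,
    ENNReal.toReal_ofReal Real.two_pi_pos.le]

instance : IsProbabilityMeasure circleMeasure := by
  constructor
  have h := lintegral_circleMeasure (fun _ => 1) measurable_const 0
  simp only [lintegral_one, MeasurableSet.univ, Measure.restrict_apply, Set.univ_inter,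
    Real.volume_Ioc, zero_add, sub_zero] at h
  rw [h]
  exact ENNReal.inv_mul_cancel (by simp [Real.pi_pos]) ENNReal.ofReal_ne_top

instance : circleMeasure.IsOpenPosMeasure := by
  constructor
  intro U hU hne h0
  have h := lintegral_circleMeasure (U.indicator 1) (measurable_one.indicator hU.measurableSet)
  obtain ⟨w, hw⟩ := hne
  obtain ⟨θ, rfl⟩ := Circle.exp_surjective w
  -- The window of length `2π` is centred at `θ`, so that `θ` is an interior point of it.
  have h2 := h (θ - Real.pi)
  rw [lintegral_indicator_one hU.measurableSet, h0] at h2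
  have h3 : ∫⁻ x in Set.Ioc (θ - Real.pi) (θ - Real.pi + 2 * Real.pi),
      U.indicator 1 (Circle.exp x) = volume (Circle.exp ⁻¹' U ∩
        Set.Ioc (θ - Real.pi) (θ - Real.pi + 2 * Real.pi)) := by
    have hm : MeasurableSet (Circle.exp ⁻¹' U) := (hU.preimage Circle.exp.continuous).measurableSet
    rw [← Measure.restrict_apply hm, ← lintegral_indicator_one hm]
    rfl
  rw [h3] at h2
  have h4 : 0 < volume (Circle.exp ⁻¹' U ∩
      Set.Ioo (θ - Real.pi) (θ - Real.pi + 2 * Real.pi)) := by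
    refine ((hU.preimage Circle.exp.continuous).inter isOpen_Ioo).measure_pos _ ⟨θ, hw, ?_, ?_⟩ <;>
    linarith [Real.pi_pos]
  have h5 := h4.trans_le (measure_mono (Set.inter_subset_inter_right _ Set.Ioo_subset_Ioc_self))
  rcases mul_eq_zero.1 h2.symm with h | h
  · exact ENNReal.inv_ne_zero.2 ENNReal.ofReal_ne_top h
  · exact h5.ne' h

lemma ofReal_mul_circle_mem_ball (w : Circle) {r : ℝ} (h0 : 0 ≤ r) (h1 : r < 1) :
    (r : ℂ) * (w : ℂ) ∈ Metric.ball (0 : ℂ) 1 := by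
  rw [mem_ball_zero_iff, norm_mul, Circle.norm_coe, mul_one, Complex.norm_real,
    Real.norm_of_nonneg h0]
  exact h1

lemma exists_seq_tendsto_one : ∃ r : ℕ → ℝ, (∀ n, r n ∈ Set.Ioo (0 : ℝ) 1) ∧
    Tendsto r atTop (𝓝[<] (1 : ℝ)) := by
  obtain ⟨r, -, hr, ht⟩ := exists_seq_strictMono_tendsto' (one_pos (α := ℝ))
  exact ⟨r, hr, tendsto_nhdsWithin_iff.2 ⟨ht, Eventually.of_forall fun n => (hr n).2⟩⟩

lemma Ioo_mem_nhdsLT_one : Set.Ioo (0 : ℝ) 1 ∈ 𝓝[<] (1 : ℝ) := Ioo_mem_nhdsLT one_pos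

/-! ### Bounded analytic functions and their boundary values -/

/-- `F` is bounded and analytic in the unit disc, with radial limits `f` almost everywhere. -/
structure HasBoundary (F : ℂ → ℂ) (f : Circle → ℂ) : Prop where
  differentiableOn : DifferentiableOn ℂ F (Metric.ball 0 1)
  bounded : ∃ K : ℝ, ∀ z ∈ Metric.ball (0 : ℂ) 1, ‖F z‖ ≤ K
  tendsto : ∀ᵐ w : Circle ∂circleMeasure,
    Tendsto (fun r : ℝ => F ((r : ℂ) * (w : ℂ))) (𝓝[<] (1 : ℝ)) (𝓝 (f w))

lemma HasBoundary.const (c : ℂ) : HasBoundary (fun _ => c) (fun _ => c) :=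
  ⟨differentiableOn_const c, ⟨‖c‖, fun _ _ => le_rfl⟩, ae_of_all _ fun _ => tendsto_const_nhds⟩

lemma HasBoundary.of_continuousOn {F : ℂ → ℂ} (hd : DifferentiableOn ℂ F (Metric.ball 0 1))
    (hc : ContinuousOn F (Metric.closedBall 0 1)) :
    HasBoundary F (fun w => F w) := by
  refine ⟨hd, ?_, ae_of_all _ fun w => ?_⟩
  · obtain ⟨K, hK⟩ := (isCompact_closedBall (0 : ℂ) 1).exists_bound_of_continuousOn hc
    exact ⟨K, fun z hz => hK z (Metric.ball_subset_closedBall hz)⟩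
  · have h1 : ContinuousWithinAt F (Metric.closedBall 0 1) (w : ℂ) :=
      hc _ (by simp [Circle.norm_coe])
    refine h1.tendsto.comp (tendsto_nhdsWithin_iff.2 ⟨?_, ?_⟩)
    · have : Tendsto (fun r : ℝ => (r : ℂ) * (w : ℂ)) (𝓝 1) (𝓝 (((1 : ℝ) : ℂ) * (w : ℂ))) :=
        Continuous.tendsto (by fun_prop) 1
      simp only [Complex.ofReal_one, one_mul] at this
      exact this.mono_left nhdsWithin_le_nhds
    · filter_upwards [Ioo_mem_nhdsLT_one] with r hr
      exact Metric.ball_subset_closedBall (ofReal_mul_circle_mem_ball w hr.1.le hr.2)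

lemma HasBoundary.id : HasBoundary (fun z => z) (fun w => (w : ℂ)) :=
  HasBoundary.of_continuousOn differentiableOn_id continuousOn_id

lemma HasBoundary.mul {F G : ℂ → ℂ} {f g : Circle → ℂ} (hF : HasBoundary F f)
    (hG : HasBoundary G g) : HasBoundary (fun z => F z * G z) (fun w => f w * g w) := by
  refine ⟨hF.1.mul hG.1, ?_, ?_⟩
  · obtain ⟨K, hK⟩ := hF.2
    obtain ⟨L, hL⟩ := hG.2
    refine ⟨K * L, fun z hz => ?_⟩
    rw [norm_mul]
    exact mul_le_mul (hK z hz) (hL z hz) (norm_nonneg _) ((norm_nonneg _).trans (hK z hz))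
  · filter_upwards [hF.3, hG.3] with w h1 h2 using h1.mul h2

lemma HasBoundary.add {F G : ℂ → ℂ} {f g : Circle → ℂ} (hF : HasBoundary F f)
    (hG : HasBoundary G g) : HasBoundary (fun z => F z + G z) (fun w => f w + g w) := by
  refine ⟨hF.1.add hG.1, ?_, ?_⟩
  · obtain ⟨K, hK⟩ := hF.2
    obtain ⟨L, hL⟩ := hG.2
    exact ⟨K + L, fun z hz => (norm_add_le _ _).trans (add_le_add (hK z hz) (hL z hz))⟩
  · filter_upwards [hF.3, hG.3] with w h1 h2 using h1.add h2

lemma HasBoundary.pow {F : ℂ → ℂ} {f : Circle → ℂ} (hF : HasBoundary F f) (n : ℕ) :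
    HasBoundary (fun z => F z ^ n) (fun w => f w ^ n) := by
  induction n with
  | zero => simpa using HasBoundary.const 1
  | succ n ih => simpa only [pow_succ] using ih.mul hF

lemma HasBoundary.polynomial {F : ℂ → ℂ} {f : Circle → ℂ} (hF : HasBoundary F f)
    (q : Polynomial ℂ) : HasBoundary (fun z => q.eval (F z)) (fun w => q.eval (f w)) := by
  induction q using Polynomial.induction_on' with
  | add p q hp hq => simpa only [Polynomial.eval_add] using hp.add hq
  | monomial n a =>
    simpa only [Polynomial.eval_monomial] using (HasBoundary.const a).mul (hF.pow n)

lemma HasBoundary.inv {F : ℂ → ℂ} {f : Circle → ℂ} (hF : HasBoundary F f) {c : ℝ} (hc : 0 < c)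
    (hlow : ∀ z ∈ Metric.ball (0 : ℂ) 1, c ≤ ‖F z‖) :
    HasBoundary (fun z => (F z)⁻¹) (fun w => (f w)⁻¹) := by
  have hne : ∀ z ∈ Metric.ball (0 : ℂ) 1, F z ≠ 0 := fun z hz => by
    have := hc.trans_le (hlow z hz)
    exact norm_pos_iff.1 this
  refine ⟨hF.1.inv hne, ⟨c⁻¹, fun z hz => ?_⟩, ?_⟩
  · rw [norm_inv]
    exact inv_anti₀ hc (hlow z hz)
  · filter_upwards [hF.3] with w h
    refine h.inv₀ ?_
    have : c ≤ ‖f w‖ := ge_of_tendsto h.norm (by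
      filter_upwards [Ioo_mem_nhdsLT_one] with r hr
      exact hlow _ (ofReal_mul_circle_mem_ball w hr.1.le hr.2))
    exact norm_pos_iff.1 (hc.trans_le this)

lemma HasBoundary.continuous_dilate {F : ℂ → ℂ} {f : Circle → ℂ} (hF : HasBoundary F f)
    {r : ℝ} (hr : r ∈ Set.Ioo (0 : ℝ) 1) :
    Continuous (fun w : Circle => F ((r : ℂ) * (w : ℂ))) :=
  hF.1.continuousOn.comp_continuous (by fun_prop)
    (fun w => ofReal_mul_circle_mem_ball w hr.1.le hr.2)

lemma HasBoundary.aestronglyMeasurable {F : ℂ → ℂ} {f : Circle → ℂ} (hF : HasBoundary F f) :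
    AEStronglyMeasurable f circleMeasure := by
  obtain ⟨r, hr, hlim⟩ := exists_seq_tendsto_one
  refine aestronglyMeasurable_of_tendsto_ae atTop
    (fun n => (hF.continuous_dilate (hr n)).aestronglyMeasurable) ?_
  filter_upwards [hF.3] with w hw using hw.comp hlim

lemma HasBoundary.ae_norm_le {F : ℂ → ℂ} {f : Circle → ℂ} (hF : HasBoundary F f) {K : ℝ}
    (hK : ∀ z ∈ Metric.ball (0 : ℂ) 1, ‖F z‖ ≤ K) : ∀ᵐ w ∂circleMeasure, ‖f w‖ ≤ K := by
  filter_upwards [hF.3] with w hw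
  refine le_of_tendsto hw.norm ?_
  filter_upwards [Ioo_mem_nhdsLT_one] with r hr
  exact hK _ (ofReal_mul_circle_mem_ball w hr.1.le hr.2)

lemma HasBoundary.memLp {F : ℂ → ℂ} {f : Circle → ℂ} (hF : HasBoundary F f) (p : ℝ≥0∞) :
    MemLp f p circleMeasure := by
  obtain ⟨K, hK⟩ := hF.2
  exact MemLp.of_bound hF.aestronglyMeasurable K (hF.ae_norm_le hK)

lemma HasBoundary.integrable {F : ℂ → ℂ} {f : Circle → ℂ} (hF : HasBoundary F f) :
    Integrable f circleMeasure := memLp_one_iff_integrable.1 (hF.memLp 1)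

lemma norm_circle_sub_ge (w : Circle) (a : ℂ) : 1 - ‖a‖ ≤ ‖(w : ℂ) - a‖ := by
  have := norm_sub_norm_le (w : ℂ) a
  rwa [Circle.norm_coe] at this

lemma circle_sub_ne_zero (w : Circle) {a : ℂ} (ha : ‖a‖ < 1) : (w : ℂ) - a ≠ 0 :=
  norm_pos_iff.1 ((sub_pos.2 ha).trans_le (norm_circle_sub_ge w a))

/-- Cauchy's formula for the derivative, as an integral over the circle. -/
lemma integral_cauchy_deriv {F : ℂ → ℂ} {U : Set ℂ} (hU : IsOpen U)
    (hsub : Metric.closedBall 0 1 ⊆ U) (hF : DifferentiableOn ℂ F U) {a : ℂ} (ha : ‖a‖ < 1) :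
    ∫ w : Circle, (w : ℂ) / ((w : ℂ) - a) ^ 2 * F w ∂circleMeasure = deriv F a := by
  have hcont : Continuous fun w : Circle => (w : ℂ) / ((w : ℂ) - a) ^ 2 * F w :=
    (Continuous.div (by fun_prop) (by fun_prop)
      fun w => pow_ne_zero 2 (circle_sub_ne_zero w ha)).mul
      (hF.continuousOn.comp_continuous (by fun_prop) fun w => hsub (by simp [Circle.norm_coe]))
  rw [← Complex.two_pi_I_inv_smul_circleIntegral_sub_sq_inv_smul_of_differentiable hU hsub hF
    (mem_ball_zero_iff.2 ha), integral_circleMeasure hcont, circleIntegral]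
  have h : ∀ θ : ℝ, deriv (circleMap 0 1) θ •
      ((circleMap 0 1 θ - a) ^ 2)⁻¹ • F (circleMap 0 1 θ) =
      Complex.I * (((Circle.exp θ : Circle) : ℂ) / (((Circle.exp θ : Circle) : ℂ) - a) ^ 2 *
        F (Circle.exp θ : Circle)) := by
    intro θ
    simp only [deriv_circleMap, circleMap_zero, Complex.ofReal_one, one_mul, smul_eq_mul,
      Circle.coe_exp]
    ring
  simp only [h]
  rw [intervalIntegral.integral_const_mul, Complex.real_smul, smul_eq_mul]
  generalize (∫ θ in (0 : ℝ)..(2 * Real.pi), ((Circle.exp θ : Circle) : ℂ) /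
    (((Circle.exp θ : Circle) : ℂ) - a) ^ 2 * F (Circle.exp θ : Circle)) = J
  push_cast
  have := Complex.I_ne_zero
  field_simp

/-- The dilates `F (r ·)` are analytic across the circle and have derivative `r F'(r a)` at `a`.
Since `F` is bounded, dominated convergence allows `r → 1`. -/
lemma HasBoundary.integral_cauchy_deriv {F : ℂ → ℂ} {f : Circle → ℂ} (hF : HasBoundary F f)
    {a : ℂ} (ha : ‖a‖ < 1) :
    ∫ w : Circle, (w : ℂ) / ((w : ℂ) - a) ^ 2 * f w ∂circleMeasure = deriv F a := by
  obtain ⟨K, hK⟩ := hF.2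
  have hcont : Continuous fun w : Circle => (w : ℂ) / ((w : ℂ) - a) ^ 2 :=
    Continuous.div (by fun_prop) (by fun_prop) fun w => pow_ne_zero 2 (circle_sub_ne_zero w ha)
  obtain ⟨L, hL⟩ := isCompact_univ.exists_bound_of_continuousOn hcont.continuousOn
  have hlim : Tendsto (fun r : ℝ => ∫ w : Circle, (w : ℂ) / ((w : ℂ) - a) ^ 2 * F (r * w)
      ∂circleMeasure) (𝓝[<] (1 : ℝ))
      (𝓝 (∫ w : Circle, (w : ℂ) / ((w : ℂ) - a) ^ 2 * f w ∂circleMeasure)) := by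
    refine tendsto_integral_filter_of_dominated_convergence (fun _ => L * K) ?_ ?_
      (integrable_const _) ?_
    · filter_upwards [Ioo_mem_nhdsLT_one] with r hr
      exact (hcont.mul (hF.continuous_dilate hr)).aestronglyMeasurable
    · filter_upwards [Ioo_mem_nhdsLT_one] with r hr
      refine ae_of_all _ fun w => ?_
      rw [norm_mul]
      exact mul_le_mul (hL w trivial) (hK _ (ofReal_mul_circle_mem_ball w hr.1.le hr.2))
        (norm_nonneg _) ((norm_nonneg _).trans (hL w trivial))
    · filter_upwards [hF.3] with w hw using hw.const_mul _
  have hlim2 : Tendsto (fun r : ℝ => (r : ℂ) * deriv F (r * a)) (𝓝[<] (1 : ℝ))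
      (𝓝 (deriv F a)) := by
    have hd : ContinuousAt (deriv F) a :=
      ((hF.1.deriv Metric.isOpen_ball).continuousOn).continuousAt
        (Metric.isOpen_ball.mem_nhds (mem_ball_zero_iff.2 ha))
    have h1 : ContinuousAt (fun r : ℝ => (r : ℂ) * deriv F (r * a)) 1 := by
      refine Complex.continuous_ofReal.continuousAt.mul
        (ContinuousAt.comp (g := deriv F) (f := fun r : ℝ => (r : ℂ) * a) ?_ (by fun_prop))
      simpa using hd
    have := h1.tendsto
    simp only [Complex.ofReal_one, one_mul] at this
    exact this.mono_left nhdsWithin_le_nhds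
  refine tendsto_nhds_unique (hlim.congr' ?_) hlim2
  filter_upwards [Ioo_mem_nhdsLT_one] with r hr
  have hr0 : (r : ℂ) ≠ 0 := by exact_mod_cast hr.1.ne'
  have hsub : Metric.closedBall (0 : ℂ) 1 ⊆ (fun z : ℂ => (r : ℂ) * z) ⁻¹' Metric.ball 0 1 := by
    intro z hz
    rw [mem_closedBall_zero_iff] at hz
    rw [Set.mem_preimage, mem_ball_zero_iff, norm_mul, Complex.norm_real,
      Real.norm_of_nonneg hr.1.le]
    nlinarith [hr.1, hr.2, norm_nonneg z]
  have hdr : DifferentiableOn ℂ (fun z : ℂ => F (r * z))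
      ((fun z : ℂ => (r : ℂ) * z) ⁻¹' Metric.ball 0 1) :=
    hF.1.comp (by fun_prop) fun z hz => hz
  rw [HardyCondExp.integral_cauchy_deriv
    (Metric.isOpen_ball.preimage (by fun_prop)) hsub hdr ha]
  have := deriv_comp_mul_left (r : ℂ) F a
  rw [this, smul_eq_mul]

/-- The mean value property for boundary functions. -/
lemma HasBoundary.integral_eq {F : ℂ → ℂ} {f : Circle → ℂ} (hF : HasBoundary F f) :
    ∫ w, f w ∂circleMeasure = F 0 := by
  -- The derivative of `z F(z)` at `0` is `F 0`, and the kernel `w / w²` cancels the extra factor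
  -- `w`.
  have h := (HasBoundary.id.mul hF).integral_cauchy_deriv (a := 0) (by simp)
  have hd : DifferentiableAt ℂ F 0 :=
    hF.1.differentiableAt (Metric.isOpen_ball.mem_nhds (by simp))
  rw [deriv_fun_mul differentiableAt_fun_id hd] at h
  simp only [deriv_id'', one_mul, zero_mul, add_zero, sub_zero] at h
  rw [← h]
  refine integral_congr_ae (ae_of_all _ fun w => ?_)
  have := Circle.coe_ne_zero w
  simp only
  field_simp

/-! ### Approximation by polynomials -/

/-- `f` is a limit of analytic polynomials in `L^p`. -/
def PolyApprox (p : ℝ≥0∞) (f : Circle → ℂ) : Prop :=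
  ∀ ε : ℝ≥0∞, 0 < ε → ∃ q : Polynomial ℂ,
    eLpNorm (fun w : Circle => f w - q.eval (w : ℂ)) p circleMeasure < ε

lemma mem_hardy_iff {p : ℝ≥0∞} {f : Lp ℂ p circleMeasure} :
    f ∈ hardy p ↔ PolyApprox p f := Iff.rfl

lemma PolyApprox.congr {p : ℝ≥0∞} {f g : Circle → ℂ} (hf : PolyApprox p f)
    (h : f =ᵐ[circleMeasure] g) : PolyApprox p g := by
  intro ε hε
  obtain ⟨q, hq⟩ := hf ε hε
  refine ⟨q, lt_of_eq_of_lt (eLpNorm_congr_ae ?_) hq⟩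
  filter_upwards [h] with w hw
  rw [hw]

/-- A limit in `L^p` of limits of polynomials is a limit of polynomials. -/
lemma PolyApprox.of_approx {p : ℝ≥0∞} {f : Circle → ℂ} (hf : AEStronglyMeasurable f circleMeasure)
    (h : ∀ ε : ℝ≥0∞, 0 < ε → ∃ g : Circle → ℂ, PolyApprox p g ∧
      AEStronglyMeasurable g circleMeasure ∧
      eLpNorm (fun w : Circle => f w - g w) p circleMeasure ≤ ε) : PolyApprox p f := by
  intro ε hε
  obtain ⟨δ, hδ, H⟩ := exists_Lp_half ℂ circleMeasure p hε.ne'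
  obtain ⟨g, hg, hgm, hfg⟩ := h δ hδ
  obtain ⟨q, hq⟩ := hg δ hδ
  refine ⟨q, ?_⟩
  have := H _ _ (hf.sub hgm) (hgm.sub (g := fun w : Circle => q.eval (w : ℂ))
    (show Continuous (fun w : Circle => q.eval (w : ℂ)) by fun_prop).aestronglyMeasurable) hfg hq.le
  refine lt_of_eq_of_lt (congrArg (fun u => eLpNorm u p circleMeasure) ?_) this
  funext w
  simp

lemma polyApprox_polynomial {p : ℝ≥0∞} (q : Polynomial ℂ) :
    PolyApprox p (fun w : Circle => q.eval (w : ℂ)) := by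
  intro ε hε
  refine ⟨q, ?_⟩
  simpa using hε

/-- The dilate only sees `F` on the circle of radius `r < 1`, where its Taylor polynomials converge
uniformly. -/
lemma HasBoundary.polyApprox_dilate {F : ℂ → ℂ} {f : Circle → ℂ} (hF : HasBoundary F f)
    {r : ℝ} (hr : r ∈ Set.Ioo (0 : ℝ) 1) (p : ℝ≥0∞) :
    PolyApprox p (fun w : Circle => F ((r : ℂ) * (w : ℂ))) := by
  refine PolyApprox.of_approx (hF.continuous_dilate hr).aestronglyMeasurable fun ε hε => ?_
  -- Radii `r < s < t < 1`: the power series comes from the closed ball of radius `t`, and it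
  -- converges uniformly on the ball of radius `s`, which contains the circle of radius `r`.
  obtain ⟨s, hrs, hs1⟩ := exists_between hr.2
  obtain ⟨t, hst, ht1⟩ := exists_between hs1
  lift s to NNReal using (hr.1.trans hrs).le
  lift t to NNReal using (hr.1.trans (hrs.trans hst)).le
  have ht0 : 0 < t := by exact_mod_cast hr.1.trans (hrs.trans hst)
  have hps := (hF.1.mono (Metric.closedBall_subset_ball ht1)).hasFPowerSeriesOnBall ht0
  have hu := hps.tendstoUniformlyOn (r' := s) (by exact_mod_cast hst)
  obtain ⟨δ, hδ0, hδ⟩ : ∃ δ : ℝ, 0 < δ ∧ ENNReal.ofReal δ ≤ ε := by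
    rcases eq_or_ne ε ⊤ with rfl | hne
    · exact ⟨1, one_pos, le_top⟩
    · exact ⟨ε.toReal, ENNReal.toReal_pos hε.ne' hne, ENNReal.ofReal_toReal_le⟩
  obtain ⟨n, hn⟩ := (Metric.tendstoUniformlyOn_iff.1 hu δ hδ0).exists
  set P := cauchyPowerSeries F 0 t
  let q : Polynomial ℂ := ∑ k ∈ Finset.range n, Polynomial.C ((r : ℂ) ^ k * P.coeff k) *
    Polynomial.X ^ k
  refine ⟨fun w => q.eval (w : ℂ), polyApprox_polynomial q,
    (show Continuous (fun w : Circle => q.eval (w : ℂ)) by fun_prop).aestronglyMeasurable, ?_⟩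
  refine (eLpNorm_le_of_ae_bound (C := δ) (ae_of_all _ fun w => ?_)).trans ?_
  · have hmem : (r : ℂ) * (w : ℂ) ∈ Metric.ball (0 : ℂ) s := by
      rw [mem_ball_zero_iff, norm_mul, Circle.norm_coe, mul_one, Complex.norm_real,
        Real.norm_of_nonneg hr.1.le]
      exact hrs
    have := hn _ hmem
    rw [zero_add, dist_eq_norm] at this
    refine le_of_eq_of_le ?_ this.le
    congr 2
    simp only [q, Polynomial.eval_finsetSum, Polynomial.eval_mul, Polynomial.eval_C,
      Polynomial.eval_pow, Polynomial.eval_X, FormalMultilinearSeries.partialSum]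
    refine Finset.sum_congr rfl fun k _ => ?_
    rw [FormalMultilinearSeries.apply_eq_pow_smul_coeff, smul_eq_mul]
    ring
  · simpa using hδ

/-- Bounded pointwise convergence implies convergence in `L^p`. -/
lemma tendsto_eLpNorm_of_bounded {p : ℝ≥0∞} (hp0 : p ≠ 0) (hp : p ≠ ⊤)
    {g : ℕ → Circle → ℂ} {K : ℝ}
    (hm : ∀ n, AEStronglyMeasurable (g n) circleMeasure)
    (hb : ∀ n, ∀ᵐ w ∂circleMeasure, ‖g n w‖ ≤ K)
    (ht : ∀ᵐ w ∂circleMeasure, Tendsto (fun n => g n w) atTop (𝓝 0)) :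
    Tendsto (fun n => eLpNorm (g n) p circleMeasure) atTop (𝓝 0) := by
  have hpos : 0 < p.toReal := ENNReal.toReal_pos hp0 hp
  simp only [eLpNorm_eq_lintegral_rpow_enorm_toReal hp0 hp]
  have h : Tendsto (fun n => ∫⁻ w, ‖g n w‖ₑ ^ p.toReal ∂circleMeasure) atTop
      (𝓝 (∫⁻ w : Circle, 0 ∂circleMeasure)) := by
    refine tendsto_lintegral_of_dominated_convergence'
      (fun _ => ENNReal.ofReal K ^ p.toReal) (fun n => (hm n).enorm.pow_const _) (fun n => ?_) ?_ ?_
    · filter_upwards [hb n] with w hw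
      refine ENNReal.rpow_le_rpow ?_ hpos.le
      rw [← ofReal_norm]
      exact ENNReal.ofReal_le_ofReal hw
    · simp [ENNReal.rpow_eq_top_iff, hpos.le]
    · filter_upwards [ht] with w hw
      have := (ENNReal.continuous_rpow_const (y := p.toReal)).tendsto 0
      rw [ENNReal.zero_rpow_of_pos hpos] at this
      refine this.comp ?_
      simpa using hw.enorm
  have h0 := (ENNReal.continuous_rpow_const (y := 1 / p.toReal)).tendsto 0
  rw [ENNReal.zero_rpow_of_pos (by positivity)] at h0
  rw [lintegral_zero] at h
  exact h0.comp h

/-- The dilates converge boundedly almost everywhere, hence in `L^p` for every finite `p`, including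
`p < 1`. -/
lemma HasBoundary.polyApprox {F : ℂ → ℂ} {f : Circle → ℂ} (hF : HasBoundary F f) {p : ℝ≥0∞}
    (hp0 : p ≠ 0) (hp : p ≠ ⊤) : PolyApprox p f := by
  refine PolyApprox.of_approx hF.aestronglyMeasurable fun ε hε => ?_
  obtain ⟨K, hK⟩ := hF.2
  obtain ⟨r, hr, hr1⟩ := exists_seq_tendsto_one
  have hlim : Tendsto (fun n => eLpNorm (fun w : Circle => f w - F ((r n : ℂ) * (w : ℂ))) p
      circleMeasure) atTop (𝓝 0) := by
    refine tendsto_eLpNorm_of_bounded hp0 hp (K := K + K) (fun n => ?_) (fun n => ?_) ?_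
    · exact hF.aestronglyMeasurable.sub (hF.continuous_dilate (hr n)).aestronglyMeasurable
    · filter_upwards [hF.ae_norm_le hK] with w hw
      exact (norm_sub_le _ _).trans
        (add_le_add hw (hK _ (ofReal_mul_circle_mem_ball w (hr n).1.le (hr n).2)))
    · filter_upwards [hF.3] with w hw
      simpa using (hw.comp hr1).const_sub (f w)
  obtain ⟨n, hn⟩ := (hlim.eventually (gt_mem_nhds hε)).exists
  exact ⟨_, hF.polyApprox_dilate (hr n) p, (hF.continuous_dilate (hr n)).aestronglyMeasurable, hn.le⟩

end HardyCondExp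

end

noncomputable section

namespace HardyCondExp

/-! ### Trigonometric polynomials determine integrals -/

lemma continuous_circle_coe : Continuous (fun w : Circle => (w : ℂ)) := continuous_subtype_val

lemma measurableEmbedding_circle_coe : MeasurableEmbedding (fun w : Circle => (w : ℂ)) :=
  (continuous_circle_coe.isClosedEmbedding Circle.coe_injective).measurableEmbedding

lemma integrable_mul_comp {f : Circle → ℂ} (hf : Integrable f circleMeasure)
    {b : Circle → Circle} (hb : Measurable b) (Φ : C(Circle, ℂ)) :
    Integrable (fun w => f w * Φ (b w)) circleMeasure := by
  refine hf.mul_bdd (c := ‖Φ‖) (Φ.continuous.measurable.comp hb).aestronglyMeasurable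
    (ae_of_all _ fun w => Φ.norm_coe_le_norm _)

/-- The functional `Φ ↦ ∫ f · (Φ ∘ b) dm`. -/
def integralMulComp {f : Circle → ℂ} (hf : Integrable f circleMeasure)
    {b : Circle → Circle} (hb : Measurable b) : C(Circle, ℂ) →L[ℂ] ℂ :=
  LinearMap.mkContinuous
    { toFun := fun Φ => ∫ w, f w * Φ (b w) ∂circleMeasure
      map_add' := fun Φ Ψ => by
        rw [← integral_add (integrable_mul_comp hf hb Φ) (integrable_mul_comp hf hb Ψ)]
        simp only [ContinuousMap.add_apply, mul_add]
      map_smul' := fun c Φ => by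
        simp only [ContinuousMap.smul_apply, smul_eq_mul, RingHom.id_apply]
        rw [← integral_const_mul]
        congr 1
        funext w
        ring }
    (∫ w, ‖f w‖ ∂circleMeasure) (fun Φ => by
      rw [← integral_mul_const]
      refine norm_integral_le_of_norm_le (hf.norm.mul_const _) (ae_of_all _ fun w => ?_)
      rw [norm_mul]
      exact mul_le_mul_of_nonneg_left (Φ.norm_coe_le_norm _) (norm_nonneg _))

/-- The Fourier monomials span a dense subspace of the continuous functions on `AddCircle 1`; this
is carried over to `Circle` by a homeomorphism. -/
lemma continuousLinearMap_ext_of_zpow {L L' : C(Circle, ℂ) →L[ℂ] ℂ}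
    (h : ∀ (n : ℤ) (Φ : C(Circle, ℂ)), (∀ w : Circle, Φ w = (w : ℂ) ^ n) → L Φ = L' Φ) :
    L = L' := by
  let e : C(Circle, AddCircle (1 : ℝ)) := (AddCircle.homeomorphCircle one_ne_zero).symm
  let e' : C(AddCircle (1 : ℝ), Circle) := (AddCircle.homeomorphCircle one_ne_zero)
  have hclos : ∀ Ψ : C(AddCircle (1 : ℝ), ℂ), L (Ψ.comp e) = L' (Ψ.comp e) := by
    intro Ψ
    let R : C(AddCircle (1 : ℝ), ℂ) →L[ℂ] C(Circle, ℂ) :=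
      ⟨e.compRightAlgHom ℂ ℂ |>.toLinearMap, ContinuousMap.continuous_precomp e⟩
    have hker : (((L - L').comp R).ker) = ⊤ := by
      rw [eq_top_iff, ← span_fourier_closure_eq_top (T := (1 : ℝ))]
      refine Submodule.topologicalClosure_minimal _ (Submodule.span_le.2 ?_)
        (ContinuousLinearMap.isClosed_ker _)
      rintro _ ⟨n, rfl⟩
      have := h n (R (fourier n)) fun w => ?_
      · simpa [sub_eq_zero] using this
      · change fourier n (e w) = _
        rw [fourier_apply, AddCircle.toCircle_zsmul, Circle.coe_zpow]
        congr 2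
        rw [← AddCircle.homeomorphCircle_apply one_ne_zero]
        exact (AddCircle.homeomorphCircle one_ne_zero).apply_symm_apply w
    have hm : Ψ ∈ ((L - L').comp R).ker := by
      rw [hker]; trivial
    have h3 : L (R Ψ) = L' (R Ψ) := by
      simpa [sub_eq_zero] using LinearMap.mem_ker.1 hm
    exact h3
  ext Φ
  have := hclos (Φ.comp e')
  have hc : (Φ.comp e').comp e = Φ := by
    ext w
    exact congrArg Φ ((AddCircle.homeomorphCircle one_ne_zero).apply_symm_apply w)
  rwa [hc] at this

lemma integral_mul_comp_eq_of_zpow {f G : Circle → ℂ} (hf : Integrable f circleMeasure)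
    (hG : Integrable G circleMeasure) {b : Circle → Circle} (hb : Measurable b)
    (h : ∀ n : ℤ, ∫ w, f w * (b w : ℂ) ^ n ∂circleMeasure =
      ∫ w, G w * (w : ℂ) ^ n ∂circleMeasure) (Φ : C(Circle, ℂ)) :
    ∫ w, f w * Φ (b w) ∂circleMeasure = ∫ w, G w * Φ w ∂circleMeasure := by
  have : integralMulComp hf hb = integralMulComp hG measurable_id := by
    refine continuousLinearMap_ext_of_zpow fun n Φ hΦ => ?_
    simp only [integralMulComp, LinearMap.mkContinuous_apply, LinearMap.coe_mk, AddHom.coe_mk,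
      hΦ, id]
    exact h n
  exact congrArg (fun L => L Φ) this

/-- Indicators of closed sets are bounded pointwise limits of continuous functions, which settles
closed sets by dominated convergence. Complements and countable disjoint unions then reach all Borel
sets. -/
lemma setIntegral_preimage_eq {f G : Circle → ℂ} (hf : Integrable f circleMeasure)
    (hG : Integrable G circleMeasure) {b : Circle → Circle} (hb : Measurable b)
    (h : ∀ Φ : C(Circle, ℂ),
      ∫ w, f w * Φ (b w) ∂circleMeasure = ∫ w, G w * Φ w ∂circleMeasure)
    {A : Set Circle} (hA : MeasurableSet A) :
    ∫ w in b ⁻¹' A, f w ∂circleMeasure = ∫ w in A, G w ∂circleMeasure := by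
  -- The case `Φ = 1`: equality of the total integrals is what makes complements work.
  have hone : ∫ w, f w ∂circleMeasure = ∫ w, G w ∂circleMeasure := by
    simpa using h (ContinuousMap.const _ 1)
  have hcompl : ∀ s : Set Circle, MeasurableSet s →
      ∫ w in b ⁻¹' s, f w ∂circleMeasure = ∫ w in s, G w ∂circleMeasure →
      ∫ w in b ⁻¹' sᶜ, f w ∂circleMeasure = ∫ w in sᶜ, G w ∂circleMeasure := by
    intro s hs he
    have h1 := integral_add_compl (hb hs) hf
    have h2 := integral_add_compl hs hG
    rw [Set.preimage_compl]
    rw [he, hone, ← h2] at h1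
    exact add_left_cancel h1
  have hclosed : ∀ s : Set Circle, IsClosed s →
      ∫ w in b ⁻¹' s, f w ∂circleMeasure = ∫ w in s, G w ∂circleMeasure := by
    intro s hs
    let Φ : ℕ → C(Circle, ℂ) := fun n =>
      ⟨fun w => (((hs.apprSeq n w : NNReal) : ℝ) : ℂ), by fun_prop⟩
    have hΦ : ∀ w, Tendsto (fun n => Φ n w) atTop (𝓝 (s.indicator 1 w)) := by
      intro w
      have h1 := tendsto_pi_nhds.1 (HasOuterApproxClosed.tendsto_apprSeq hs) w
      have h2 := ((Complex.continuous_ofReal.comp NNReal.continuous_coe).tendsto _).comp h1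
      refine h2.trans_eq ?_
      by_cases hw : w ∈ s <;> simp [hw]
    have hb1 : ∀ n w, ‖Φ n w‖ ≤ 1 := by
      intro n w
      have := HasOuterApproxClosed.apprSeq_apply_le_one hs n w
      simpa [Φ] using this
    have key : ∀ {g : Circle → ℂ} (hg : Integrable g circleMeasure) {c : Circle → Circle}
        (hc : Measurable c), Tendsto (fun n => ∫ w, g w * Φ n (c w) ∂circleMeasure) atTop
          (𝓝 (∫ w in c ⁻¹' s, g w ∂circleMeasure)) := by
      intro g hg c hc
      rw [← integral_indicator (hc hs.measurableSet)]
      refine tendsto_integral_of_dominated_convergence (fun w => ‖g w‖)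
        (fun n => (integrable_mul_comp hg hc (Φ n)).aestronglyMeasurable) hg.norm
        (fun n => ae_of_all _ fun w => ?_) (ae_of_all _ fun w => ?_)
      · rw [norm_mul]
        exact mul_le_of_le_one_right (norm_nonneg _) (hb1 n _)
      · refine ((hΦ (c w)).const_mul (g w)).trans_eq ?_
        by_cases hw : c w ∈ s <;> simp [Set.indicator, hw]
    refine tendsto_nhds_unique (key hf hb) ?_
    simp only [h]
    exact key hG measurable_id
  induction A, hA using MeasurableSet.induction_on_open with
  | isOpen U hU => exact compl_compl U ▸ hcompl _ hU.measurableSet.compl (hclosed _ hU.isClosed_compl)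
  | compl s hs ihs => exact hcompl s hs ihs
  | iUnion g g_disj g_meas hg =>
    rw [Set.preimage_iUnion, integral_iUnion (fun i => hb (g_meas i))
      (fun i j hij => (g_disj hij).preimage b) hf.integrableOn,
      integral_iUnion g_meas g_disj hG.integrableOn]
    simp only [hg]

lemma measurePreserving_of_zpow {b : Circle → Circle} (hb : Measurable b)
    (h : ∀ n : ℤ, ∫ w, (b w : ℂ) ^ n ∂circleMeasure = ∫ w : Circle, (w : ℂ) ^ n ∂circleMeasure) :
    MeasurePreserving b circleMeasure circleMeasure := by
  refine ⟨hb, Measure.ext fun A hA => ?_⟩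
  have h1 := setIntegral_preimage_eq (integrable_const (1 : ℂ)) (integrable_const (1 : ℂ)) hb
    (integral_mul_comp_eq_of_zpow (integrable_const (1 : ℂ)) (integrable_const (1 : ℂ)) hb
      (by simpa using h)) hA
  simp only [setIntegral_const, Complex.real_smul, mul_one, Complex.ofReal_inj] at h1
  rw [Measure.map_apply hb hA]
  exact (measureReal_eq_measureReal_iff).1 h1

lemma integral_coe_zpow (n : ℤ) :
    ∫ w : Circle, (w : ℂ) ^ n ∂circleMeasure = if n = 0 then 1 else 0 := by
  have hpos : ∀ k : ℕ, ∫ w : Circle, (w : ℂ) ^ k ∂circleMeasure = if k = 0 then 1 else 0 := by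
    intro k
    rw [(HasBoundary.id.pow k).integral_eq]
    simp [zero_pow_eq]
  obtain ⟨k, rfl | rfl⟩ := n.eq_nat_or_neg
  · simpa using hpos k
  · have : ∀ w : Circle, (w : ℂ) ^ (-(k : ℤ)) = (starRingEnd ℂ) ((w : ℂ) ^ k) := by
      intro w
      rw [zpow_neg, zpow_natCast, ← inv_pow, map_pow, ← Circle.coe_inv, Circle.coe_inv_eq_conj]
    simp only [this]
    rw [integral_conj, hpos k]
    by_cases hk : k = 0 <;> simp [hk]

/-! ### The boundary map of an inner function -/

/-- Unimodular numbers as points of the circle, with junk value `1`. -/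
def toCircle (z : ℂ) : Circle :=
  if h : ‖z‖ = 1 then ⟨z, mem_sphere_zero_iff_norm.2 h⟩ else 1

lemma coe_toCircle {z : ℂ} (h : ‖z‖ = 1) : (toCircle z : ℂ) = z := by
  simp [toCircle, h]

lemma measurable_toCircle : Measurable toCircle := by
  rw [← measurableEmbedding_circle_coe.measurable_comp_iff]
  have : (fun w : Circle => (w : ℂ)) ∘ toCircle = fun z => if ‖z‖ = 1 then z else 1 := by
    funext z
    by_cases h : ‖z‖ = 1 <;> simp [toCircle, h]
  rw [this]
  exact Measurable.ite (measurableSet_eq_fun measurable_norm measurable_const) measurable_id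
    measurable_const

/-- The boundary function of an inner function, as a self-map of the circle. -/
def boundaryMap (η : ℂ → ℂ) (w : Circle) : Circle := toCircle (radialLimit η w)

variable {η : ℂ → ℂ}

lemma IsInner.measurable_radialLimit (hη : IsInner η) : Measurable (radialLimit η) :=
  HardyCondExp.measurable_radialLimit hη.differentiableOn.continuousOn

lemma IsInner.measurable_boundaryMap (hη : IsInner η) : Measurable (boundaryMap η) :=
  measurable_toCircle.comp hη.measurable_radialLimit

lemma IsInner.ae_tendsto (hη : IsInner η) : ∀ᵐ w ∂circleMeasure,
    (boundaryMap η w : ℂ) = radialLimit η w ∧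
    Tendsto (fun r : ℝ => η ((r : ℂ) * (w : ℂ))) (𝓝[<] (1 : ℝ)) (𝓝 (boundaryMap η w)) := by
  filter_upwards [hη.radial] with w ⟨l, hl, ht⟩
  have h1 : radialLimit η w = l := ht.limUnder_eq
  have h2 : (boundaryMap η w : ℂ) = l := by
    rw [boundaryMap, h1, coe_toCircle hl]
  rw [h2, h1]
  exact ⟨rfl, ht⟩

lemma IsInner.hasBoundary (hη : IsInner η) : HasBoundary η (fun w => (boundaryMap η w : ℂ)) :=
  ⟨hη.differentiableOn, ⟨1, hη.norm_le_one⟩, hη.ae_tendsto.mono fun _ h => h.2⟩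

lemma conj_coe_zpow (w : Circle) (n : ℤ) :
    (starRingEnd ℂ) ((w : ℂ) ^ n) = (w : ℂ) ^ (-n) := by
  rw [map_zpow₀, ← Circle.coe_inv_eq_conj, Circle.coe_inv, inv_zpow, zpow_neg]

lemma IsInner.integral_boundaryMap_zpow (hη : IsInner η) (hη0 : η 0 = 0) (n : ℤ) :
    ∫ w, (boundaryMap η w : ℂ) ^ n ∂circleMeasure = if n = 0 then 1 else 0 := by
  have hpos : ∀ k : ℕ, ∫ w : Circle, (boundaryMap η w : ℂ) ^ k ∂circleMeasure =
      if k = 0 then 1 else 0 := by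
    intro k
    rw [(hη.hasBoundary.pow k).integral_eq, hη0, zero_pow_eq]
  obtain ⟨k, rfl | rfl⟩ := n.eq_nat_or_neg
  · simpa using hpos k
  · simp only [← conj_coe_zpow]
    rw [integral_conj]
    simp only [zpow_natCast]
    rw [hpos k]
    by_cases hk : k = 0 <;> simp [hk]

/-- By the mean value property the `k`-th moment of the boundary map is `(η 0)^k`, which vanishes
for `k > 0`; negative moments are conjugates of these. So the boundary map has the moments of arc
length. -/
lemma IsInner.measurePreserving (hη : IsInner η) (hη0 : η 0 = 0) :
    MeasurePreserving (boundaryMap η) circleMeasure circleMeasure :=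
  measurePreserving_of_zpow hη.measurable_boundaryMap fun n => by
    rw [hη.integral_boundaryMap_zpow hη0, integral_coe_zpow]

/-- `f` and `G` have the same integrals against all functions of the boundary map, which makes
`G ∘ η` the conditional expectation of `f`. -/
structure Represents (η : ℂ → ℂ) (f G : Circle → ℂ) : Prop where
  integrable_left : Integrable f circleMeasure
  integrable_right : Integrable G circleMeasure
  integral_eq : ∀ Φ : C(Circle, ℂ),
    ∫ w, f w * Φ (boundaryMap η w) ∂circleMeasure = ∫ w, G w * Φ w ∂circleMeasure

lemma Represents.condExp_ae_eq (hη : IsInner η) (hη0 : η 0 = 0) {f G : Circle → ℂ}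
    (h : Represents η f G) :
    circleMeasure[f | sigmaAlgebra η] =ᵐ[circleMeasure] fun w => G (boundaryMap η w) := by
  have hmp := hη.measurePreserving hη0
  have hm : sigmaAlgebra η ≤ (inferInstance : MeasurableSpace Circle) :=
    hη.measurable_radialLimit.comap_le
  have hint : Integrable (fun w => G (boundaryMap η w)) circleMeasure :=
    hmp.integrable_comp_of_integrable h.integrable_right
  refine (ae_eq_condExp_of_forall_setIntegral_eq hm h.integrable_left
    (fun s _ _ => hint.integrableOn) ?_ ?_).symm
  · rintro s ⟨A, hA, rfl⟩ -
    -- The `σ`-algebra is generated by the complex-valued radial limit, which agrees with the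
    -- circle-valued `boundaryMap` only almost everywhere; set integrals do not notice the
    -- difference.
    have hset : (radialLimit η ⁻¹' A : Set Circle) =ᵐ[circleMeasure]
        boundaryMap η ⁻¹' ((fun w : Circle => (w : ℂ)) ⁻¹' A) := by
      filter_upwards [hη.ae_tendsto] with w hw
      have : (radialLimit η w ∈ A) = ((boundaryMap η w : ℂ) ∈ A) := by rw [hw.1]
      exact this
    have hA' : MeasurableSet ((fun w : Circle => (w : ℂ)) ⁻¹' A) := continuous_circle_coe.measurable hA
    rw [setIntegral_congr_set hset, setIntegral_congr_set hset,
      setIntegral_preimage_eq h.integrable_left h.integrable_right hmp.measurable h.integral_eq hA']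
    have hA2 := hA'.preimage hmp.measurable
    rw [← integral_indicator hA', ← integral_indicator hA2]
    have h2 := integral_map (μ := circleMeasure) hmp.measurable.aemeasurable
      (f := ((fun w : Circle => (w : ℂ)) ⁻¹' A).indicator G)
      (by rw [hmp.map_eq]; exact h.integrable_right.aestronglyMeasurable.indicator hA')
    rw [hmp.map_eq] at h2
    exact h2.symm
  -- `G` is only almost everywhere strongly measurable. A representative `G0` composed with
  -- `boundaryMap η` is measurable for the small `σ`-algebra, and measure preservation carries null
  -- sets back.
  · obtain ⟨G0, hG0, hGG⟩ := h.integrable_right.aestronglyMeasurable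
    refine ⟨fun w => G0 (boundaryMap η w), ?_, hmp.quasiMeasurePreserving.ae_eq_comp hGG⟩
    refine hG0.comp_measurable ?_
    exact measurable_toCircle.comp (comap_measurable (radialLimit η))

/-- The pull-out property of conditional expectation: functions of `η` pass through. -/
lemma Represents.mul {f G : Circle → ℂ} (hη : IsInner η) (h : Represents η f G)
    (Ψ : C(Circle, ℂ)) :
    Represents η (fun w => f w * Ψ (boundaryMap η w)) (fun w => G w * Ψ w) := by
  refine ⟨integrable_mul_comp h.1 hη.measurable_boundaryMap Ψ,
    integrable_mul_comp h.2 measurable_id Ψ, fun Φ => ?_⟩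
  simpa only [ContinuousMap.mul_apply, mul_assoc] using h.3 (Ψ * Φ)

lemma Represents.add {f G f' G' : Circle → ℂ} (hη : IsInner η) (h : Represents η f G)
    (h' : Represents η f' G') :
    Represents η (fun w => f w + f' w) (fun w => G w + G' w) := by
  refine ⟨h.1.add h'.1, h.2.add h'.2, fun Φ => ?_⟩
  simp only [add_mul]
  rw [integral_add (integrable_mul_comp h.1 hη.measurable_boundaryMap Φ)
    (integrable_mul_comp h'.1 hη.measurable_boundaryMap Φ), h.3, h'.3]
  exact (integral_add (integrable_mul_comp h.2 measurable_id Φ)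
    (integrable_mul_comp h'.2 measurable_id Φ)).symm

lemma represents_of_zpow (hη : IsInner η) {f G : Circle → ℂ} (hf : Integrable f circleMeasure)
    (hG : Integrable G circleMeasure)
    (h : ∀ n : ℤ, ∫ w, f w * (boundaryMap η w : ℂ) ^ n ∂circleMeasure =
      ∫ w, G w * (w : ℂ) ^ n ∂circleMeasure) : Represents η f G :=
  ⟨hf, hG, integral_mul_comp_eq_of_zpow hf hG hη.measurable_boundaryMap h⟩

/-! ### Conditional expectations of polynomials -/

lemma tendsto_ofReal_mul_circle (w : Circle) :
    Tendsto (fun r : ℝ => (r : ℂ) * (w : ℂ)) (𝓝[<] 1) (𝓝 (w : ℂ)) := by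
  have : Tendsto (fun r : ℝ => (r : ℂ) * (w : ℂ)) (𝓝 1) (𝓝 (((1 : ℝ) : ℂ) * (w : ℂ))) :=
    Continuous.tendsto (by fun_prop) 1
  simp only [Complex.ofReal_one, one_mul] at this
  exact this.mono_left nhdsWithin_le_nhds

/-- By the Schwarz lemma `η z / z` is again bounded by `1`. Powers of it control the negative
moments of `η`. -/
lemma IsInner.hasBoundary_div (hη : IsInner η) (hη0 : η 0 = 0) :
    HasBoundary (dslope η 0) (fun w : Circle => (boundaryMap η w : ℂ) / (w : ℂ)) := by
  refine ⟨(Complex.differentiableOn_dslope (Metric.ball_mem_nhds 0 one_pos)).2 hη.1,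
    ⟨1, fun z hz => ?_⟩, ?_⟩
  · have := Complex.norm_dslope_le_div_of_mapsTo_ball (R₂ := 1) hη.1
      (fun z hz => by simpa [hη0] using hη.2 z hz) hz
    simpa using this
  · filter_upwards [hη.hasBoundary.3] with w hw
    refine (hw.div (tendsto_ofReal_mul_circle w) (Circle.coe_ne_zero w)).congr' ?_
    filter_upwards [Ioo_mem_nhdsLT_one] with r hr
    have hne : (r : ℂ) * (w : ℂ) ≠ 0 :=
      mul_ne_zero (by exact_mod_cast hr.1.ne') (Circle.coe_ne_zero w)
    simp only [Pi.div_apply]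
    rw [dslope_of_ne _ hne, slope_def_field, hη0, sub_zero, sub_zero]

/-- The moments of a monomial against powers of `η` vanish outside a finite range. -/
lemma IsInner.integral_pow_mul_zpow (hη : IsInner η) (hη0 : η 0 = 0) (k : ℕ) {n : ℤ}
    (hn : 0 < n ∨ n < -k) :
    ∫ w : Circle, (w : ℂ) ^ k * (boundaryMap η w : ℂ) ^ n ∂circleMeasure = 0 := by
  rcases hn with hn | hn
  · lift n to ℕ using hn.le
    have hn' : n ≠ 0 := by rintro rfl; simp at hn
    have := ((HasBoundary.id.pow k).mul (hη.hasBoundary.pow n)).integral_eq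
    simp only [hη0, zero_pow hn', mul_zero] at this
    simpa using this
  · obtain ⟨m, rfl⟩ : ∃ m : ℕ, n = -((k + m + 1 : ℕ) : ℤ) :=
      ⟨(-n - k - 1).toNat, by push_cast; omega⟩
    -- The conjugate of `wᵏ b^(-(k+m+1))` is `w^(m+1) (b/w)^(k+m+1)`, the boundary function of a
    -- function vanishing at `0`.
    have := ((HasBoundary.id.pow (m + 1)).mul
      ((hη.hasBoundary_div hη0).pow (k + m + 1))).integral_eq
    simp only [zero_pow (Nat.succ_ne_zero m), zero_mul] at this
    have h2 := congrArg (starRingEnd ℂ) this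
    rw [← integral_conj, map_zero] at h2
    rw [← h2]
    refine integral_congr_ae (ae_of_all _ fun w => ?_)
    have hc : ∀ v : Circle, (starRingEnd ℂ) (v : ℂ) = (v : ℂ)⁻¹ := fun v => by
      rw [← Circle.coe_inv_eq_conj, Circle.coe_inv]
    have h0 := Circle.coe_ne_zero w
    have h1 := Circle.coe_ne_zero (boundaryMap η w)
    simp only [map_mul, map_pow, map_div₀, hc]
    rw [zpow_neg, zpow_natCast, inv_div_inv, div_pow, inv_pow]
    field_simp
    ring

lemma integrable_polynomial (q : Polynomial ℂ) :
    Integrable (fun w : Circle => q.eval (w : ℂ)) circleMeasure :=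
  (HasBoundary.id.polynomial q).integrable

/-- The representing function must have Fourier coefficients `∫ wᵏ b⁻ʲ dm`, and these vanish unless
`0 ≤ j ≤ k`. So the expectation of `wᵏ` is a polynomial in `η` of degree at most `k`. -/
lemma IsInner.exists_represents_pow (hη : IsInner η) (hη0 : η 0 = 0) (k : ℕ) :
    ∃ Q : Polynomial ℂ, Represents η (fun w => (w : ℂ) ^ k) (fun w => Q.eval (w : ℂ)) := by
  let c : ℕ → ℂ := fun j =>
    ∫ w : Circle, (w : ℂ) ^ k * (boundaryMap η w : ℂ) ^ (-(j : ℤ)) ∂circleMeasure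
  refine ⟨∑ j ∈ Finset.range (k + 1), Polynomial.C (c j) * Polynomial.X ^ j,
    represents_of_zpow hη ?_ (integrable_polynomial _) fun n => ?_⟩
  · exact (HasBoundary.id.pow k).integrable
  have hR : ∫ w : Circle, (∑ j ∈ Finset.range (k + 1), Polynomial.C (c j) *
      Polynomial.X ^ j).eval (w : ℂ) * (w : ℂ) ^ n ∂circleMeasure =
      ∑ j ∈ Finset.range (k + 1), c j * (if (j : ℤ) + n = 0 then 1 else 0) := by
    simp only [Polynomial.eval_finsetSum, Polynomial.eval_mul, Polynomial.eval_C,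
      Polynomial.eval_pow, Polynomial.eval_X, Finset.sum_mul]
    have hterm : ∀ (j : ℕ) (w : Circle), c j * (w : ℂ) ^ j * (w : ℂ) ^ n =
        c j * (w : ℂ) ^ ((j : ℤ) + n) := by
      intro j w
      rw [zpow_add₀ (Circle.coe_ne_zero w), zpow_natCast, mul_assoc]
    simp only [hterm]
    have hcont : ∀ m : ℤ, Continuous fun w : Circle => (w : ℂ) ^ m := fun m =>
      continuous_circle_coe.zpow₀ m fun w => Or.inl (Circle.coe_ne_zero w)
    rw [integral_finsetSum]
    · simp only [integral_const_mul, integral_coe_zpow]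
    · intro j _
      exact (BoundedContinuousFunction.integrable circleMeasure
        (BoundedContinuousFunction.mkOfCompact ⟨_, hcont _⟩)).const_mul _
  rw [hR]
  by_cases hn : 0 < n ∨ n < -k
  · rw [hη.integral_pow_mul_zpow hη0 k hn]
    refine (Finset.sum_eq_zero fun j hj => ?_).symm
    have := Finset.mem_range.1 hj
    rw [if_neg (by omega), mul_zero]
  · obtain ⟨j, rfl⟩ : ∃ j : ℕ, n = -(j : ℤ) := ⟨(-n).toNat, by omega⟩
    rw [Finset.sum_eq_single j]
    · simp [c]
    · intro i _ hij
      rw [if_neg (by omega), mul_zero]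
    · intro hj
      exact absurd (Finset.mem_range.2 (by omega)) hj

lemma IsInner.exists_represents_polynomial (hη : IsInner η) (hη0 : η 0 = 0) (q : Polynomial ℂ) :
    ∃ Q : Polynomial ℂ, Represents η (fun w => q.eval (w : ℂ)) (fun w => Q.eval (w : ℂ)) := by
  induction q using Polynomial.induction_on' with
  | add p q hp hq =>
    obtain ⟨P, hP⟩ := hp
    obtain ⟨Q, hQ⟩ := hq
    exact ⟨P + Q, by simpa only [Polynomial.eval_add] using hP.add hη hQ⟩
  | monomial n a =>
    obtain ⟨Q, hQ⟩ := hη.exists_represents_pow hη0 n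
    refine ⟨Q * Polynomial.C a, ?_⟩
    simpa [mul_comm] using hQ.mul hη (ContinuousMap.const _ a)

end HardyCondExp

end

noncomputable section

namespace HardyCondExp

/-! ### A characterization of finite Blaschke products -/

lemma one_sub_conj_mul_ne_zero {a z : ℂ} (ha : ‖a‖ < 1) (hz : ‖z‖ ≤ 1) :
    1 - (starRingEnd ℂ) a * z ≠ 0 := by
  intro h
  have h1 : ‖(starRingEnd ℂ) a * z‖ = 1 := by
    rw [← sub_eq_zero.1 h, norm_one]
  rw [norm_mul, RCLike.norm_conj] at h1
  nlinarith [norm_nonneg a, norm_nonneg z]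

lemma normSq_one_sub_conj_mul_sub (a z : ℂ) :
    ‖1 - (starRingEnd ℂ) a * z‖ ^ 2 - ‖z - a‖ ^ 2 = (1 - ‖a‖ ^ 2) * (1 - ‖z‖ ^ 2) := by
  simp only [← Complex.normSq_eq_norm_sq, Complex.normSq_apply, Complex.sub_re, Complex.sub_im,
    Complex.mul_re, Complex.mul_im, Complex.conj_re, Complex.conj_im, Complex.one_re,
    Complex.one_im]
  ring

lemma norm_blaschkeFactor_sq {a z : ℂ} (ha : ‖a‖ < 1) (hz : ‖z‖ ≤ 1) :
    ‖(z - a) / (1 - (starRingEnd ℂ) a * z)‖ ^ 2 =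
      1 - (1 - ‖a‖ ^ 2) * (1 - ‖z‖ ^ 2) / ‖1 - (starRingEnd ℂ) a * z‖ ^ 2 := by
  have h := normSq_one_sub_conj_mul_sub a z
  have hne : ‖1 - (starRingEnd ℂ) a * z‖ ^ 2 ≠ 0 :=
    pow_ne_zero 2 (norm_ne_zero_iff.2 (one_sub_conj_mul_ne_zero ha hz))
  rw [norm_div, div_pow, ← h, sub_div, div_self hne]
  ring

lemma norm_blaschkeFactor_lt_one {a z : ℂ} (ha : ‖a‖ < 1) (hz : ‖z‖ < 1) :
    ‖(z - a) / (1 - (starRingEnd ℂ) a * z)‖ < 1 := by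
  have h := norm_blaschkeFactor_sq ha hz.le
  have hne : 0 < ‖1 - (starRingEnd ℂ) a * z‖ :=
    norm_pos_iff.2 (one_sub_conj_mul_ne_zero ha hz.le)
  have h2 : 0 < (1 - ‖a‖ ^ 2) * (1 - ‖z‖ ^ 2) / ‖1 - (starRingEnd ℂ) a * z‖ ^ 2 := by
    have h3 : 0 < 1 - ‖a‖ ^ 2 := by nlinarith [norm_nonneg a]
    have h4 : 0 < 1 - ‖z‖ ^ 2 := by nlinarith [norm_nonneg z]
    positivity
  exact (sq_lt_one_iff₀ (norm_nonneg _)).1 (by linarith)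

/-- The Schwarz–Pick lemma at a zero. -/
lemma norm_le_norm_blaschkeFactor {η : ℂ → ℂ} (hd : DifferentiableOn ℂ η (Metric.ball 0 1))
    (hb : ∀ z ∈ Metric.ball (0 : ℂ) 1, ‖η z‖ ≤ 1) {a : ℂ} (ha : ‖a‖ < 1) (h0 : η a = 0)
    {z : ℂ} (hz : ‖z‖ < 1) : ‖η z‖ ≤ ‖(z - a) / (1 - (starRingEnd ℂ) a * z)‖ := by
  -- `M` is the inverse of the Blaschke factor and sends `0` to `a`; the ordinary Schwarz lemma
  -- applies to `η ∘ M`.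
  let M : ℂ → ℂ := fun ζ => (ζ - (-a)) / (1 - (starRingEnd ℂ) (-a) * ζ)
  have ha' : ‖-a‖ < 1 := by rwa [norm_neg]
  have hM : Set.MapsTo M (Metric.ball 0 1) (Metric.ball 0 1) := fun ζ hζ =>
    mem_ball_zero_iff.2 (norm_blaschkeFactor_lt_one ha' (mem_ball_zero_iff.1 hζ))
  have hMd : DifferentiableOn ℂ M (Metric.ball 0 1) := by
    refine DifferentiableOn.div (by fun_prop) (by fun_prop) fun ζ hζ => ?_
    exact one_sub_conj_mul_ne_zero ha' (mem_ball_zero_iff.1 hζ).le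
  have hinv : M ((z - a) / (1 - (starRingEnd ℂ) a * z)) = z := by
    have h1 := one_sub_conj_mul_ne_zero ha hz.le
    have h2 := one_sub_conj_mul_ne_zero ha ha.le
    have h3 : 1 + (starRingEnd ℂ) a * ((z - a) / (1 - (starRingEnd ℂ) a * z)) =
        (1 - (starRingEnd ℂ) a * a) / (1 - (starRingEnd ℂ) a * z) := by
      rw [mul_div_assoc', add_div' _ _ _ h1]
      ring_nf
    simp only [M, map_neg, sub_neg_eq_add, neg_mul]
    rw [h3, div_add' _ _ _ h1, div_div_div_cancel_right₀ h1, div_eq_iff h2]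
    ring
  have := Complex.norm_le_norm_of_mapsTo_ball (f := η ∘ M) (R := 1) (hd.comp hMd hM)
    (fun ζ hζ => by simpa using hb _ (hM hζ)) (by simp [M, h0])
    (norm_blaschkeFactor_lt_one ha hz)
  rwa [Function.comp_apply, hinv] at this

/-- `‖η‖` tends to `1` uniformly at the boundary of the disc. -/
def UniformlyUnimodular (η : ℂ → ℂ) : Prop :=
  ∀ ε : ℝ, 0 < ε → ∃ ρ < (1 : ℝ), ∀ z : ℂ, ρ < ‖z‖ → ‖z‖ < 1 → 1 - ε ≤ ‖η z‖

/-- Without zeros, `1/η` is analytic, and it is at most `1/(1 - ε)` on circles close to the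
boundary. The maximum principle gives `|η| ≥ 1 - ε` inside for every `ε`, so `|η| = 1` everywhere
and `η` is constant. -/
lemma UniformlyUnimodular.const_of_ne_zero {η : ℂ → ℂ} (hu : UniformlyUnimodular η)
    (hd : DifferentiableOn ℂ η (Metric.ball 0 1)) (hb : ∀ z ∈ Metric.ball (0 : ℂ) 1, ‖η z‖ ≤ 1)
    (hne : ∀ z ∈ Metric.ball (0 : ℂ) 1, η z ≠ 0) :
    ∃ c : ℂ, ‖c‖ = 1 ∧ ∀ z ∈ Metric.ball (0 : ℂ) 1, η z = c := by
  have hinv : DifferentiableOn ℂ (fun z => (η z)⁻¹) (Metric.ball 0 1) := hd.inv hne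
  have hlow : ∀ z ∈ Metric.ball (0 : ℂ) 1, 1 ≤ ‖η z‖ := by
    intro z hz
    refine le_of_forall_sub_le fun ε hε => ?_
    rcases le_or_gt 1 ε with h1 | h1
    · exact (sub_nonpos.2 h1).trans (norm_nonneg _)
    obtain ⟨ρ, hρ, H⟩ := hu ε hε
    obtain ⟨r, hr, hr1⟩ := exists_between (max_lt (max_lt hρ (mem_ball_zero_iff.1 hz)) one_pos)
    have hr0 : 0 < r := (le_max_right _ _).trans_lt hr
    have hρr : ρ < r := ((le_max_left _ _).trans (le_max_left _ _)).trans_lt hr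
    have hzr : ‖z‖ < r := ((le_max_right _ _).trans (le_max_left _ _)).trans_lt hr
    have hsub : Metric.closedBall (0 : ℂ) r ⊆ Metric.ball 0 1 := Metric.closedBall_subset_ball hr1
    have hmax := Complex.norm_le_of_forall_mem_frontier_norm_le (C := (1 - ε)⁻¹)
      (f := fun z => (η z)⁻¹) (U := Metric.ball (0 : ℂ) r) Metric.isBounded_ball
      (hinv.diffContOnCl_ball hsub) (fun w hw => ?_)
      (subset_closure (mem_ball_zero_iff.2 hzr))
    · rw [norm_inv] at hmax
      exact (inv_le_inv₀ (norm_pos_iff.2 (hne z hz)) (by linarith)).1 hmax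
    · rw [frontier_ball _ hr0.ne', mem_sphere_zero_iff_norm] at hw
      rw [norm_inv]
      exact inv_anti₀ (by linarith) (H w (hw ▸ hρr) (hw ▸ hr1))
  have hone : ∀ z ∈ Metric.ball (0 : ℂ) 1, ‖η z‖ = 1 := fun z hz => le_antisymm (hb z hz) (hlow z hz)
  have h0 : (0 : ℂ) ∈ Metric.ball (0 : ℂ) 1 := by simp
  refine ⟨η 0, hone 0 h0, ?_⟩
  have := Complex.eqOn_of_isPreconnected_of_isMaxOn_norm (convex_ball (0 : ℂ) 1).isPreconnected
    Metric.isOpen_ball hd h0 (fun z hz => by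
      simp only [Set.mem_ofPred_eq, Function.comp_apply, hone z hz, hone 0 h0, le_refl])
  exact fun z hz => this hz

lemma IsFiniteBlaschke.mul_factor {η θ : ℂ → ℂ} (hθ : IsFiniteBlaschke θ) {a : ℂ} (ha : ‖a‖ < 1)
    (h : ∀ z ∈ Metric.ball (0 : ℂ) 1,
      η z = (z - a) / (1 - (starRingEnd ℂ) a * z) * θ z) : IsFiniteBlaschke η := by
  obtain ⟨c, n, b, hc, hb, hθ⟩ := hθ
  refine ⟨c, n + 1, Fin.cons a b, hc, fun j => ?_, fun z hz => ?_⟩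
  · refine Fin.cases ?_ (fun i => ?_) j
    · simpa using ha
    · simpa using hb i
  · rw [h z hz, hθ z hz, Fin.prod_univ_succ]
    simp only [Fin.cons_zero, Fin.cons_succ]
    ring

/-- Dividing out a zero. -/
lemma exists_eq_blaschkeFactor_mul {η : ℂ → ℂ} (hd : DifferentiableOn ℂ η (Metric.ball 0 1))
    (hb : ∀ z ∈ Metric.ball (0 : ℂ) 1, ‖η z‖ ≤ 1) {a : ℂ} (ha : ‖a‖ < 1) (h0 : η a = 0) :
    ∃ θ : ℂ → ℂ, DifferentiableOn ℂ θ (Metric.ball 0 1) ∧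
      (∀ z ∈ Metric.ball (0 : ℂ) 1, ‖θ z‖ ≤ 1) ∧
      ∀ z ∈ Metric.ball (0 : ℂ) 1, η z = (z - a) / (1 - (starRingEnd ℂ) a * z) * θ z := by
  have ha' : a ∈ Metric.ball (0 : ℂ) 1 := mem_ball_zero_iff.2 ha
  -- `dslope` supplies the derivative as value at `a`, so the quotient is analytic across the zero.
  let θ : ℂ → ℂ := fun z => dslope η a z * (1 - (starRingEnd ℂ) a * z)
  have hθd : DifferentiableOn ℂ θ (Metric.ball 0 1) :=
    ((Complex.differentiableOn_dslope (Metric.isOpen_ball.mem_nhds ha')).2 hd).mul (by fun_prop)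
  have heq : ∀ z ∈ Metric.ball (0 : ℂ) 1, η z = (z - a) / (1 - (starRingEnd ℂ) a * z) * θ z := by
    intro z hz
    have h1 := one_sub_conj_mul_ne_zero ha (mem_ball_zero_iff.1 hz).le
    have h2 := sub_smul_dslope η a z
    rw [h0, sub_zero, smul_eq_mul] at h2
    simp only [θ]
    rw [← h2, div_mul_eq_mul_div, eq_div_iff h1]
    ring
  have hle : ∀ z ∈ Metric.ball (0 : ℂ) 1, z ≠ a → ‖θ z‖ ≤ 1 := by
    intro z hz hza
    have h1 := norm_le_norm_blaschkeFactor hd hb ha h0 (mem_ball_zero_iff.1 hz)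
    rw [heq z hz, norm_mul] at h1
    have h2 : 0 < ‖(z - a) / (1 - (starRingEnd ℂ) a * z)‖ :=
      norm_pos_iff.2 (div_ne_zero (sub_ne_zero.2 hza)
        (one_sub_conj_mul_ne_zero ha (mem_ball_zero_iff.1 hz).le))
    exact le_of_mul_le_mul_left (by linarith) h2
  refine ⟨θ, hθd, fun z hz => ?_, heq⟩
  -- At the zero itself Schwarz–Pick says nothing about the quotient; the bound is inherited from
  -- nearby points by continuity.
  by_cases hza : z = a
  · subst hza
    have hc : ContinuousAt θ z := hθd.continuousOn.continuousAt (Metric.isOpen_ball.mem_nhds hz)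
    refine le_of_tendsto (hc.tendsto.mono_left nhdsWithin_le_nhds : Tendsto θ (𝓝[≠] z) _).norm ?_
    filter_upwards [self_mem_nhdsWithin, nhdsWithin_le_nhds (Metric.isOpen_ball.mem_nhds hz)]
      with y hy hy2 using hle y hy2 hy
  · exact hle z hz hza

/-- Induction on a bound for the number of zeros. If `a` and `z₁` lie in `|z| ≤ ρ`, the Blaschke
factor has squared modulus at most `1 - (1 - ρ²)²/4` at `z₁`, because `|1 - ā z₁| ≤ 2`. Dividing out
a zero therefore enlarges `|η z₁|²` by a fixed factor, whereas the quotient remains bounded by `1`;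
for `n = 0` the hypothesis is contradictory. -/
lemma isFiniteBlaschke_of_pow_lt {ρ : ℝ} (hρ : ρ < 1) {z₁ : ℂ} (hz₁ : ‖z₁‖ ≤ ρ) (n : ℕ) :
    ∀ {η : ℂ → ℂ}, DifferentiableOn ℂ η (Metric.ball 0 1) →
      (∀ z ∈ Metric.ball (0 : ℂ) 1, ‖η z‖ ≤ 1) → UniformlyUnimodular η →
      (∀ z ∈ Metric.ball (0 : ℂ) 1, η z = 0 → ‖z‖ ≤ ρ) →
      (1 - (1 - ρ ^ 2) ^ 2 / 4) ^ n < ‖η z₁‖ ^ 2 → IsFiniteBlaschke η := by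
  have hρ0 : 0 ≤ ρ := (norm_nonneg _).trans hz₁
  have hz1 : z₁ ∈ Metric.ball (0 : ℂ) 1 := mem_ball_zero_iff.2 (hz₁.trans_lt hρ)
  induction n with
  | zero =>
    intro η _ hb _ _ h
    have := hb z₁ hz1
    rw [pow_zero] at h
    nlinarith [norm_nonneg (η z₁)]
  | succ n ih =>
    intro η hd hb hu hz h
    by_cases hne : ∀ z ∈ Metric.ball (0 : ℂ) 1, η z ≠ 0
    · obtain ⟨c, hc, hηc⟩ := hu.const_of_ne_zero hd hb hne
      exact ⟨c, 0, Fin.elim0, hc, fun j => j.elim0, fun z hz => by simpa using hηc z hz⟩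
    push Not at hne
    obtain ⟨a, ha1, ha0⟩ := hne
    have haρ := hz a ha1 ha0
    have ha : ‖a‖ < 1 := mem_ball_zero_iff.1 ha1
    obtain ⟨θ, hθd, hθb, hθ⟩ := exists_eq_blaschkeFactor_mul hd hb ha ha0
    have hle : ∀ z ∈ Metric.ball (0 : ℂ) 1, ‖η z‖ ≤ ‖θ z‖ := by
      intro z hz
      rw [hθ z hz, norm_mul]
      exact mul_le_of_le_one_left (norm_nonneg _)
        (norm_blaschkeFactor_lt_one ha (mem_ball_zero_iff.1 hz)).le
    refine IsFiniteBlaschke.mul_factor (ih hθd hθb ?_ ?_ ?_) ha hθ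
    · intro ε hε
      obtain ⟨r, hr, H⟩ := hu ε hε
      exact ⟨r, hr, fun z h1 h2 => (H z h1 h2).trans (hle z (mem_ball_zero_iff.2 h2))⟩
    · intro z hz1 hθz
      refine hz z hz1 ?_
      rw [hθ z hz1, hθz, mul_zero]
    · rw [hθ z₁ hz1, norm_mul, mul_pow, norm_blaschkeFactor_sq ha (hz₁.trans hρ.le), pow_succ] at h
      have hD : ‖1 - (starRingEnd ℂ) a * z₁‖ ≤ 2 := by
        refine (norm_sub_le _ _).trans ?_
        rw [norm_one, norm_mul, RCLike.norm_conj]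
        nlinarith [norm_nonneg a, norm_nonneg z₁]
      have hD0 : 0 < ‖1 - (starRingEnd ℂ) a * z₁‖ :=
        norm_pos_iff.2 (one_sub_conj_mul_ne_zero ha (hz₁.trans hρ.le))
      have h1 : 1 - ρ ^ 2 ≤ 1 - ‖a‖ ^ 2 := by nlinarith [norm_nonneg a]
      have h2 : 1 - ρ ^ 2 ≤ 1 - ‖z₁‖ ^ 2 := by nlinarith [norm_nonneg z₁]
      have h3 : 0 ≤ 1 - ρ ^ 2 := by nlinarith
      have hτ : (1 - ρ ^ 2) ^ 2 / 4 ≤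
          (1 - ‖a‖ ^ 2) * (1 - ‖z₁‖ ^ 2) / ‖1 - (starRingEnd ℂ) a * z₁‖ ^ 2 := by
        refine div_le_div₀ (by nlinarith) (by nlinarith) (by positivity) (by nlinarith)
      have hpos : 0 < 1 - (1 - ρ ^ 2) ^ 2 / 4 := by nlinarith
      have h4 : (1 - (1 - ρ ^ 2) ^ 2 / 4) ^ n * (1 - (1 - ρ ^ 2) ^ 2 / 4) <
          (1 - (1 - ρ ^ 2) ^ 2 / 4) * ‖θ z₁‖ ^ 2 :=
        h.trans_le (mul_le_mul_of_nonneg_right (by linarith) (by positivity))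
      rw [mul_comm] at h4
      exact lt_of_mul_lt_mul_left h4 hpos.le

lemma UniformlyUnimodular.isFiniteBlaschke {η : ℂ → ℂ} (hu : UniformlyUnimodular η)
    (hd : DifferentiableOn ℂ η (Metric.ball 0 1))
    (hb : ∀ z ∈ Metric.ball (0 : ℂ) 1, ‖η z‖ ≤ 1) : IsFiniteBlaschke η := by
  -- Outside radius `ρ` one has `|η| ≥ 1/2`. A positive radius `s` beyond `ρ` thus bounds all zeros,
  -- and the point `s` itself serves as `z₁`.
  obtain ⟨ρ, hρ, H⟩ := hu (1 / 2) (by norm_num)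
  obtain ⟨s, hs, hs1⟩ := exists_between (max_lt hρ one_pos)
  have hs0 : 0 < s := (le_max_right _ _).trans_lt hs
  have hρs : ρ < s := (le_max_left _ _).trans_lt hs
  have hz1 : ‖(s : ℂ)‖ = s := by rw [Complex.norm_real, Real.norm_of_nonneg hs0.le]
  have hne : 0 < ‖η s‖ := by
    have := H s (by rwa [hz1]) (by rwa [hz1])
    linarith
  have hτ1 : 1 - (1 - s ^ 2) ^ 2 / 4 < 1 := by
    have : 0 < 1 - s ^ 2 := by nlinarith
    have : 0 < (1 - s ^ 2) ^ 2 / 4 := by positivity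
    linarith
  obtain ⟨n, hn⟩ := exists_pow_lt_of_lt_one (pow_pos hne 2) hτ1
  refine isFiniteBlaschke_of_pow_lt hs1 hz1.le n hd hb hu (fun z hz h0 => ?_) hn
  by_contra hlt
  have := H z (hρs.trans (not_le.1 hlt)) (mem_ball_zero_iff.1 hz)
  rw [h0, norm_zero] at this
  linarith

end HardyCondExp

end

noncomputable section

namespace HardyCondExp

/-! ### Integral means of the Cauchy kernel -/

/-- The integral mean `∫ ‖1 - ā w‖ ^ (-γ) dm(w)`. -/
def kernelMean (γ : ℝ) (a : ℂ) : ℝ≥0∞ :=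
  ∫⁻ w : Circle, ‖1 - (starRingEnd ℂ) a * (w : ℂ)‖ₑ ^ (-γ) ∂circleMeasure

lemma measurable_kernel (γ : ℝ) (a : ℂ) :
    Measurable fun w : Circle => ‖1 - (starRingEnd ℂ) a * (w : ℂ)‖ₑ ^ (-γ) := by
  have : Continuous fun w : Circle => ‖1 - (starRingEnd ℂ) a * (w : ℂ)‖ₑ := by fun_prop
  exact this.measurable.pow_const _

lemma measurePreserving_rotate (c : Circle) :
    MeasurePreserving (fun w : Circle => c * w) circleMeasure circleMeasure := by
  refine measurePreserving_of_zpow (continuous_const_mul c).measurable fun n => ?_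
  simp only [Circle.coe_mul, mul_zpow]
  rw [integral_const_mul, integral_coe_zpow]
  by_cases hn : n = 0 <;> simp [hn]

lemma kernelMean_eq_norm (γ : ℝ) (a : ℂ) : kernelMean γ a = kernelMean γ (‖a‖ : ℂ) := by
  by_cases ha : a = 0
  · simp [ha]
  have hna : (‖a‖ : ℂ) ≠ 0 := by simpa using ha
  let c : Circle := ⟨a / ‖a‖, mem_sphere_zero_iff_norm.2 (by
    rw [norm_div, Complex.norm_real, norm_norm, div_self (norm_ne_zero_iff.2 ha)])⟩
  have hac : a = ‖a‖ * (c : ℂ) := by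
    change a = ‖a‖ * (a / ‖a‖)
    field_simp
  rw [kernelMean, kernelMean,
    ← (measurePreserving_rotate c⁻¹).lintegral_comp (measurable_kernel γ (‖a‖ : ℂ))]
  refine lintegral_congr fun w => ?_
  have : (starRingEnd ℂ) a * (w : ℂ) = (starRingEnd ℂ) (‖a‖ : ℂ) * ((c⁻¹ * w : Circle) : ℂ) := by
    conv_lhs => rw [hac]
    rw [map_mul, Circle.coe_mul, Circle.coe_inv_eq_conj, mul_assoc]
  rw [this]

lemma enorm_rpow_neg {z : ℂ} (hz : z ≠ 0) (γ : ℝ) :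
    ‖z‖ₑ ^ (-γ) = ENNReal.ofReal (‖z‖ ^ (-γ)) := by
  rw [← ofReal_norm, ENNReal.ofReal_rpow_of_pos (norm_pos_iff.2 hz)]

lemma one_sub_ofReal_mul_exp_ne_zero {r : ℝ} (h0 : 0 ≤ r) (h1 : r < 1) (θ : ℝ) :
    1 - (r : ℂ) * (Circle.exp θ : ℂ) ≠ 0 := by
  have := one_sub_conj_mul_ne_zero (a := (r : ℂ)) (z := (Circle.exp θ : ℂ))
    (by rwa [Complex.norm_real, Real.norm_of_nonneg h0]) (Circle.norm_coe _).le
  rwa [Complex.conj_ofReal] at this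

lemma kernelMean_ofReal (γ : ℝ) {r : ℝ} (h0 : 0 ≤ r) (h1 : r < 1) (a : ℝ) :
    kernelMean γ (r : ℂ) = (ENNReal.ofReal (2 * Real.pi))⁻¹ *
      ∫⁻ θ in Set.Ioc a (a + 2 * Real.pi),
        ENNReal.ofReal (‖1 - (r : ℂ) * (Circle.exp θ : ℂ)‖ ^ (-γ)) := by
  rw [kernelMean, lintegral_circleMeasure _ (measurable_kernel _ _) a]
  congr 1
  refine lintegral_congr fun θ => ?_
  rw [Complex.conj_ofReal, enorm_rpow_neg (one_sub_ofReal_mul_exp_ne_zero h0 h1 θ)]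

lemma norm_one_sub_exp_le (θ : ℝ) : ‖1 - (Circle.exp θ : ℂ)‖ ≤ |θ| := by
  rw [Circle.coe_exp, norm_sub_rev, mul_comm]
  simpa using Real.norm_exp_I_mul_ofReal_sub_one_le (x := θ)

lemma le_norm_one_sub_exp {θ : ℝ} (hθ : |θ| ≤ Real.pi) :
    2 / Real.pi * |θ| ≤ ‖1 - (Circle.exp θ : ℂ)‖ := by
  rw [Circle.coe_exp, norm_sub_rev, mul_comm (θ : ℂ), Complex.norm_exp_I_mul_ofReal_sub_one,
    norm_mul, Real.norm_eq_abs, Real.norm_eq_abs, abs_two]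
  have h := Real.mul_abs_le_abs_sin (x := θ / 2) (by
    rw [abs_div, abs_two]; linarith)
  rw [abs_div, abs_two] at h
  have h2 : 2 / Real.pi * (|θ| / 2) * 2 = 2 / Real.pi * |θ| := by ring
  linarith

/-- On the arc `0 < θ ≤ 1 - r` one has `|1 - r e^{iθ}| ≤ (1 - r) + θ ≤ 2 (1 - r)`; this arc alone
gives the bound. -/
lemma le_kernelMean {γ : ℝ} (hγ : 0 ≤ γ) {a : ℂ} (ha : ‖a‖ < 1) :
    ENNReal.ofReal ((2 * Real.pi)⁻¹ * 2 ^ (-γ) * (1 - ‖a‖) ^ (1 - γ)) ≤ kernelMean γ a := by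
  set r := ‖a‖ with hr
  have hr0 : 0 ≤ r := norm_nonneg a
  have hd : 0 < 1 - r := by linarith
  rw [kernelMean_eq_norm, ← hr, kernelMean_ofReal γ hr0 ha 0]
  have hpi := Real.pi_gt_three
  calc ENNReal.ofReal ((2 * Real.pi)⁻¹ * 2 ^ (-γ) * (1 - r) ^ (1 - γ))
      = (ENNReal.ofReal (2 * Real.pi))⁻¹ * ∫⁻ θ in Set.Ioc 0 (1 - r),
          ENNReal.ofReal ((2 * (1 - r)) ^ (-γ)) := by
        rw [setLIntegral_const, Real.volume_Ioc, sub_zero,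
          ← ENNReal.ofReal_inv_of_pos Real.two_pi_pos, ← ENNReal.ofReal_mul (by positivity),
          ← ENNReal.ofReal_mul (by positivity), Real.mul_rpow (by norm_num) hd.le,
          sub_eq_neg_add 1 γ, Real.rpow_add hd, Real.rpow_one]
        ring_nf
    _ ≤ (ENNReal.ofReal (2 * Real.pi))⁻¹ * ∫⁻ θ in Set.Ioc 0 (1 - r),
        ENNReal.ofReal (‖1 - (r : ℂ) * (Circle.exp θ : ℂ)‖ ^ (-γ)) := by
        refine mul_le_mul' le_rfl ?_
        refine setLIntegral_mono' measurableSet_Ioc fun θ hθ => ENNReal.ofReal_le_ofReal ?_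
        refine Real.rpow_le_rpow_of_nonpos
          (norm_pos_iff.2 (one_sub_ofReal_mul_exp_ne_zero hr0 ha θ)) ?_ (by linarith)
        have h1 : 1 - (r : ℂ) * (Circle.exp θ : ℂ) =
            ((1 - r : ℝ) : ℂ) + (r : ℂ) * (1 - (Circle.exp θ : ℂ)) := by push_cast; ring
        rw [h1]
        refine (norm_add_le _ _).trans ?_
        rw [norm_mul, Complex.norm_real, Complex.norm_real, Real.norm_of_nonneg hr0,
          Real.norm_of_nonneg hd.le]
        have h2 := norm_one_sub_exp_le θ
        rw [abs_of_pos hθ.1] at h2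
        nlinarith [hθ.2, norm_nonneg (1 - (Circle.exp θ : ℂ))]
    _ ≤ _ := by
        refine mul_le_mul' le_rfl ?_
        exact lintegral_mono_set (Set.Ioc_subset_Ioc_right (by linarith : 1 - r ≤ 0 + 2 * Real.pi))

/-- For `γ > 1` the bound is the full tail `∫_d^∞ x^(-γ) dx`. The hypothesis `hi` lets one estimate
serve both half-circles, after the substitutions `x = d + θ` and `x = d - θ`. -/
lemma lintegral_Ioc_rpow_le {γ : ℝ} (hγ : 1 < γ) {d : ℝ} (hd : 0 < d) {g : ℝ → ℝ} {a b : ℝ}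
    (hab : a ≤ b) (hg : ContinuousOn g (Set.Icc a b)) (hg0 : ∀ x ∈ Set.Icc a b, 0 ≤ g x)
    {L : ℝ} (hL : d ≤ L) (hi : ∫ x in a..b, g x = ∫ x in d..L, x ^ (-γ)) :
    ∫⁻ x in Set.Ioc a b, ENNReal.ofReal (g x) ≤ ENNReal.ofReal (d ^ (1 - γ) / (γ - 1)) := by
  rw [← ofReal_integral_eq_lintegral_ofReal
    (hg.integrableOn_Icc.mono_set Set.Ioc_subset_Icc_self)
    ((ae_restrict_iff' measurableSet_Ioc).2
      (ae_of_all _ fun x hx => hg0 x (Set.Ioc_subset_Icc_self hx))),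
    ← intervalIntegral.integral_of_le hab, hi, integral_rpow (Or.inr ⟨by linarith, ?_⟩)]
  · refine ENNReal.ofReal_le_ofReal ?_
    have h1 : -γ + 1 = 1 - γ := by ring
    rw [h1, ← neg_div_neg_eq, neg_sub, neg_sub]
    have h2 : 0 ≤ L ^ (1 - γ) := Real.rpow_nonneg (hd.le.trans hL) _
    gcongr
    linarith
  · rw [Set.uIcc_of_le hL]
    intro h
    linarith [h.1]

/-- For `|θ| ≤ π` both `1 - r` and `|θ| / π` are at most `|1 - r e^{iθ}|`, the latter by Jordan's
inequality. Hence `1 - r + |θ| ≤ 2π |1 - r e^{iθ}|`, and the integral reduces to a power integral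
that stays controlled because `γ > 1`. -/
lemma kernelMean_le {γ : ℝ} (hγ : 1 < γ) {a : ℂ} (ha : ‖a‖ < 1) :
    kernelMean γ a ≤ ENNReal.ofReal
      ((2 * Real.pi)⁻¹ * ((2 * Real.pi) ^ γ * (2 / (γ - 1))) * (1 - ‖a‖) ^ (1 - γ)) := by
  set r := ‖a‖ with hr
  have hr0 : 0 ≤ r := norm_nonneg a
  have hd : 0 < 1 - r := by linarith
  have hpi := Real.pi_pos
  rw [kernelMean_eq_norm, ← hr, kernelMean_ofReal γ hr0 ha (-Real.pi),
    show -Real.pi + 2 * Real.pi = Real.pi by ring]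
  have hlow : ∀ θ ∈ Set.Ioc (-Real.pi) Real.pi,
      ENNReal.ofReal (‖1 - (r : ℂ) * (Circle.exp θ : ℂ)‖ ^ (-γ)) ≤
        ENNReal.ofReal ((2 * Real.pi) ^ γ) * ENNReal.ofReal ((1 - r + |θ|) ^ (-γ)) := by
    intro θ hθ
    have habs : |θ| ≤ Real.pi := abs_le.2 ⟨hθ.1.le, hθ.2⟩
    have h1 := le_norm_one_sub_exp habs
    have h2 : 1 - r ≤ ‖1 - (r : ℂ) * (Circle.exp θ : ℂ)‖ := by
      have := norm_sub_norm_le (1 : ℂ) ((r : ℂ) * (Circle.exp θ : ℂ))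
      rwa [norm_one, norm_mul, Circle.norm_coe, mul_one, Complex.norm_real,
        Real.norm_of_nonneg hr0] at this
    have h3 : ‖1 - (Circle.exp θ : ℂ)‖ ≤ ‖1 - (r : ℂ) * (Circle.exp θ : ℂ)‖ + (1 - r) := by
      have he : 1 - (Circle.exp θ : ℂ) = (1 - (r : ℂ) * (Circle.exp θ : ℂ)) -
        ((1 - r : ℝ) : ℂ) * (Circle.exp θ : ℂ) := by push_cast; ring
      rw [he]
      refine (norm_sub_le _ _).trans ?_
      rw [norm_mul _ (Circle.exp θ : ℂ), Circle.norm_coe, mul_one, Complex.norm_real,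
        Real.norm_of_nonneg hd.le]
    have h4 : |θ| ≤ Real.pi * ‖1 - (r : ℂ) * (Circle.exp θ : ℂ)‖ := by
      rw [div_mul_eq_mul_div, div_le_iff₀ hpi] at h1
      nlinarith
    have h5 : (2 * Real.pi)⁻¹ * (1 - r + |θ|) ≤ ‖1 - (r : ℂ) * (Circle.exp θ : ℂ)‖ := by
      rw [inv_mul_le_iff₀ (by positivity)]
      nlinarith [Real.pi_gt_three]
    rw [← ENNReal.ofReal_mul (by positivity)]
    refine ENNReal.ofReal_le_ofReal ?_
    refine (Real.rpow_le_rpow_of_nonpos (by positivity) h5 (by linarith)).trans_eq ?_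
    rw [Real.mul_rpow (by positivity) (by positivity), Real.inv_rpow (by positivity),
      Real.rpow_neg (by positivity), inv_inv]
  have hA : ∫⁻ θ in Set.Ioc 0 Real.pi, ENNReal.ofReal ((1 - r + |θ|) ^ (-γ)) ≤
      ENNReal.ofReal ((1 - r) ^ (1 - γ) / (γ - 1)) := by
    refine lintegral_Ioc_rpow_le hγ hd hpi.le (L := 1 - r + Real.pi) ?_ (fun x _ => by positivity)
      (by linarith) ?_
    · refine ContinuousOn.rpow_const (by fun_prop) fun x _ => Or.inl ?_
      positivity
    · have := intervalIntegral.integral_comp_add_left (a := 0) (b := Real.pi)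
        (fun x => x ^ (-γ)) (1 - r)
      rw [add_zero] at this
      rw [← this]
      refine intervalIntegral.integral_congr fun x hx => ?_
      rw [Set.uIcc_of_le hpi.le] at hx
      simp only [abs_of_nonneg hx.1]
  have hB : ∫⁻ θ in Set.Ioc (-Real.pi) 0, ENNReal.ofReal ((1 - r + |θ|) ^ (-γ)) ≤
      ENNReal.ofReal ((1 - r) ^ (1 - γ) / (γ - 1)) := by
    refine lintegral_Ioc_rpow_le hγ hd (by linarith) (L := 1 - r + Real.pi) ?_
      (fun x _ => by positivity) (by linarith) ?_
    · refine ContinuousOn.rpow_const (by fun_prop) fun x _ => Or.inl ?_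
      positivity
    · have := intervalIntegral.integral_comp_sub_left (a := -Real.pi) (b := 0)
        (fun x => x ^ (-γ)) (1 - r)
      rw [sub_zero, sub_neg_eq_add] at this
      rw [← this]
      refine intervalIntegral.integral_congr fun x hx => ?_
      rw [Set.uIcc_of_le (by linarith)] at hx
      simp only [abs_of_nonpos hx.2, sub_eq_add_neg]
  calc (ENNReal.ofReal (2 * Real.pi))⁻¹ * ∫⁻ θ in Set.Ioc (-Real.pi) Real.pi,
        ENNReal.ofReal (‖1 - (r : ℂ) * (Circle.exp θ : ℂ)‖ ^ (-γ))
      ≤ (ENNReal.ofReal (2 * Real.pi))⁻¹ * ∫⁻ θ in Set.Ioc (-Real.pi) Real.pi,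
        ENNReal.ofReal ((2 * Real.pi) ^ γ) * ENNReal.ofReal ((1 - r + |θ|) ^ (-γ)) := by
        refine mul_le_mul' le_rfl ?_
        exact setLIntegral_mono' measurableSet_Ioc hlow
    _ = (ENNReal.ofReal (2 * Real.pi))⁻¹ * (ENNReal.ofReal ((2 * Real.pi) ^ γ) *
        ((∫⁻ θ in Set.Ioc (-Real.pi) 0, ENNReal.ofReal ((1 - r + |θ|) ^ (-γ))) +
          ∫⁻ θ in Set.Ioc 0 Real.pi, ENNReal.ofReal ((1 - r + |θ|) ^ (-γ)))) := by
        rw [lintegral_const_mul' _ _ ENNReal.ofReal_ne_top,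
          ← Set.Ioc_union_Ioc_eq_Ioc (b := (0 : ℝ)) (by linarith) hpi.le,
          lintegral_union measurableSet_Ioc (Set.Ioc_disjoint_Ioc_of_le le_rfl)]
    _ ≤ (ENNReal.ofReal (2 * Real.pi))⁻¹ * (ENNReal.ofReal ((2 * Real.pi) ^ γ) *
        (ENNReal.ofReal ((1 - r) ^ (1 - γ) / (γ - 1)) +
          ENNReal.ofReal ((1 - r) ^ (1 - γ) / (γ - 1)))) := by gcongr
    _ = _ := by
        have h1 : 0 ≤ (1 - r) ^ (1 - γ) / (γ - 1) :=
          div_nonneg (Real.rpow_nonneg hd.le _) (by linarith)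
        rw [← ENNReal.ofReal_add h1 h1, ← ENNReal.ofReal_mul (by positivity),
          ← ENNReal.ofReal_inv_of_pos Real.two_pi_pos, ← ENNReal.ofReal_mul (by positivity)]
        congr 1
        ring

end HardyCondExp

end

noncomputable section

namespace HardyCondExp

/-! ### Boundedness forces a derivative estimate -/

variable {η : ℂ → ℂ}

lemma eLpNorm_ofReal_eq {p : ℝ} (hp : 0 < p) (f : Circle → ℂ) :
    eLpNorm f (ENNReal.ofReal p) circleMeasure =
      (∫⁻ w, ‖f w‖ₑ ^ p ∂circleMeasure) ^ (1 / p) := by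
  rw [eLpNorm_eq_lintegral_rpow_enorm_toReal (by simpa using hp) ENNReal.ofReal_ne_top,
    ENNReal.toReal_ofReal hp.le]

lemma eLpNorm_ofReal_rpow {p : ℝ} (hp : 0 < p) (f : Circle → ℂ) :
    eLpNorm f (ENNReal.ofReal p) circleMeasure ^ p = ∫⁻ w, ‖f w‖ₑ ^ p ∂circleMeasure := by
  rw [eLpNorm_ofReal_eq hp, ← ENNReal.rpow_mul, one_div_mul_cancel hp.ne', ENNReal.rpow_one]

lemma IsBoundedCondExp.exists_eLpNorm_le {p : ℝ≥0∞} {X : Submodule ℂ (Lp ℂ p circleMeasure)}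
    {T : X →ₗ[ℂ] X} (hT : IsBoundedCondExp η X T) : ∃ C : ℝ, 0 ≤ C ∧ ∀ f : X,
      eLpNorm (T f : Lp ℂ p circleMeasure) p circleMeasure ≤
        ENNReal.ofReal C * eLpNorm (f : Lp ℂ p circleMeasure) p circleMeasure := by
  obtain ⟨C, hC⟩ := hT.1
  refine ⟨max C 0, le_max_right _ _, fun f => ?_⟩
  have h1 : ‖(T f : Lp ℂ p circleMeasure)‖ ≤ max C 0 * ‖(f : Lp ℂ p circleMeasure)‖ :=
    (hC f).trans (mul_le_mul_of_nonneg_right (le_max_left _ _) ENNReal.toReal_nonneg)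
  rw [Lp.norm_def, Lp.norm_def] at h1
  rw [← ENNReal.ofReal_toReal (Lp.eLpNorm_ne_top (T f : Lp ℂ p circleMeasure)),
    ← ENNReal.ofReal_toReal (Lp.eLpNorm_ne_top (f : Lp ℂ p circleMeasure)),
    ← ENNReal.ofReal_mul (le_max_right _ _)]
  exact ENNReal.ofReal_le_ofReal h1

/-- Boundary functions of bounded analytic functions are integrable and lie in `H^p`, so `T` sends
`f` to `G ∘ b`. Since `b` preserves `m`, boundedness becomes an inequality between `G` and `f`
alone. -/
lemma IsBoundedCondExp.exists_lintegral_le (hη : IsInner η) (hη0 : η 0 = 0) {p : ℝ} (hp : 0 < p)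
    {T : hardy (ENNReal.ofReal p) →ₗ[ℂ] hardy (ENNReal.ofReal p)}
    (hT : IsBoundedCondExp η (hardy (ENNReal.ofReal p)) T) : ∃ C : ℝ, 0 ≤ C ∧
      ∀ (F : ℂ → ℂ) (f G : Circle → ℂ), HasBoundary F f → Represents η f G →
        ∫⁻ w, ‖G w‖ₑ ^ p ∂circleMeasure ≤
          ENNReal.ofReal C ^ p * ∫⁻ w, ‖f w‖ₑ ^ p ∂circleMeasure := by
  obtain ⟨C, hC0, hC⟩ := hT.exists_eLpNorm_le
  refine ⟨C, hC0, fun F f G hF hR => ?_⟩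
  have hp0 : ENNReal.ofReal p ≠ 0 := by simpa using hp
  have hmem := hF.memLp (ENNReal.ofReal p)
  have hcoe := hmem.coeFn_toLp
  let x : hardy (ENNReal.ofReal p) := ⟨hmem.toLp f,
    (mem_hardy_iff.2 ((hF.polyApprox hp0 ENNReal.ofReal_ne_top).congr hcoe.symm))⟩
  have h1 := hC x
  have hx : (x : Lp ℂ (ENNReal.ofReal p) circleMeasure) =ᵐ[circleMeasure] f := hcoe
  have hTx := hT.2 x (hF.integrable.congr hx.symm)
  have h2 : (T x : Lp ℂ (ENNReal.ofReal p) circleMeasure) =ᵐ[circleMeasure]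
      G ∘ boundaryMap η :=
    (hTx.trans (condExp_congr_ae hx)).trans (hR.condExp_ae_eq hη hη0)
  rw [eLpNorm_congr_ae hx, eLpNorm_congr_ae h2, eLpNorm_comp_measurePreserving
    hR.integrable_right.aestronglyMeasurable (hη.measurePreserving hη0)] at h1
  have h3 := ENNReal.rpow_le_rpow h1 hp.le
  rwa [ENNReal.mul_rpow_of_nonneg _ _ hp.le, eLpNorm_ofReal_rpow hp, eLpNorm_ofReal_rpow hp] at h3

lemma hasBoundary_kernel {a : ℂ} (ha : ‖a‖ < 1) :
    HasBoundary (fun z => z / (1 - (starRingEnd ℂ) a * z) ^ 2)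
      (fun w : Circle => (w : ℂ) / (1 - (starRingEnd ℂ) a * w) ^ 2) := by
  have h : DifferentiableOn ℂ (fun z => z / (1 - (starRingEnd ℂ) a * z) ^ 2)
      (Metric.closedBall 0 1) := by
    refine DifferentiableOn.div (by fun_prop) (by fun_prop) fun z hz => ?_
    exact pow_ne_zero 2 (one_sub_conj_mul_ne_zero ha (mem_closedBall_zero_iff.1 hz))
  exact HasBoundary.of_continuousOn (h.mono Metric.ball_subset_closedBall) h.continuousOn

/-- On the circle `conj w = w⁻¹`. Integrating against this kernel thus amounts, up to conjugation,
to evaluating a derivative at `a`. -/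
lemma conj_kernel (a : ℂ) (w : Circle) :
    (w : ℂ) / (1 - (starRingEnd ℂ) a * w) ^ 2 =
      (starRingEnd ℂ) ((w : ℂ) / ((w : ℂ) - a) ^ 2) := by
  have hc : (starRingEnd ℂ) (w : ℂ) = (w : ℂ)⁻¹ := by
    rw [← Circle.coe_inv_eq_conj, Circle.coe_inv]
  have h0 := Circle.coe_ne_zero w
  rw [map_div₀, map_pow, map_sub, hc]
  have h1 : (w : ℂ)⁻¹ - (starRingEnd ℂ) a = (1 - (starRingEnd ℂ) a * w) / w := by
    rw [sub_div, mul_div_cancel_right₀ _ h0, one_div]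
  rw [h1, div_pow, div_div_eq_mul_div]
  congr 1
  field_simp

/-- The moments of the kernel against powers of a boundary function. -/
lemma HasBoundary.integral_kernel_mul_inv_pow {F : ℂ → ℂ} {b : Circle → Circle}
    (hF : HasBoundary F (fun w => (b w : ℂ))) {a : ℂ} (ha : ‖a‖ < 1) (k : ℕ) :
    ∫ w : Circle, (w : ℂ) / (1 - (starRingEnd ℂ) a * w) ^ 2 * (b w : ℂ) ^ (-(k : ℤ))
      ∂circleMeasure = (starRingEnd ℂ) (k * F a ^ (k - 1) * deriv F a) := by
  have h := (hF.pow k).integral_cauchy_deriv ha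
  have hd : DifferentiableAt ℂ F a :=
    hF.1.differentiableAt (Metric.isOpen_ball.mem_nhds (mem_ball_zero_iff.2 ha))
  rw [deriv_fun_pow hd] at h
  rw [← h, ← integral_conj]
  refine integral_congr_ae (ae_of_all _ fun w => ?_)
  simp only
  rw [map_mul, ← conj_kernel, ← conj_coe_zpow, zpow_natCast]

lemma HasBoundary.integral_kernel_mul_pow {F : ℂ → ℂ} {b : Circle → ℂ}
    (hF : HasBoundary F b) {a : ℂ} (ha : ‖a‖ < 1) (k : ℕ) :
    ∫ w : Circle, (w : ℂ) / (1 - (starRingEnd ℂ) a * w) ^ 2 * b w ^ k ∂circleMeasure = 0 := by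
  rw [((hasBoundary_kernel ha).mul (hF.pow k)).integral_eq]
  simp

lemma IsInner.norm_le (hη : IsInner η) (hη0 : η 0 = 0) {a : ℂ} (ha : ‖a‖ < 1) : ‖η a‖ ≤ ‖a‖ :=
  Complex.norm_le_norm_of_mapsTo_ball hη.1 (fun z hz => by simpa using hη.2 z hz) hη0 ha

/-- Both sides have vanishing moments of nonnegative order. For order `-k` the left side gives the
conjugate of `(ηᵏ)'(a) = η'(a) · k η(a)^(k-1)`, which is `η'(a)` times the derivative of `zᵏ` at `η
a`: the chain rule. -/
lemma IsInner.represents_kernel (hη : IsInner η) (hη0 : η 0 = 0) {a : ℂ} (ha : ‖a‖ < 1) :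
    Represents η (fun w => (w : ℂ) / (1 - (starRingEnd ℂ) a * w) ^ 2)
      (fun w => (starRingEnd ℂ) (deriv η a) *
        ((w : ℂ) / (1 - (starRingEnd ℂ) (η a) * w) ^ 2)) := by
  have hb : ‖η a‖ < 1 := (hη.norm_le hη0 ha).trans_lt ha
  refine represents_of_zpow hη (hasBoundary_kernel ha).integrable
    ((hasBoundary_kernel hb).integrable.const_mul _) fun n => ?_
  simp only [mul_assoc]
  rw [integral_const_mul]
  obtain ⟨k, rfl | rfl⟩ := n.eq_nat_or_neg
  · simp only [zpow_natCast]
    rw [hη.hasBoundary.integral_kernel_mul_pow ha, HasBoundary.id.integral_kernel_mul_pow hb,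
      mul_zero]
  · rw [hη.hasBoundary.integral_kernel_mul_inv_pow ha,
      HasBoundary.id.integral_kernel_mul_inv_pow (b := fun w => w) hb, ← map_mul]
    congr 1
    simp
    ring

/-- The values `p (1 + N/2)` increase in steps of `p/2 < 1/2`, so the first one above `1/2` is still
below `1`. Above `1/2` the kernel means obey a power law; below `1` the exponent `β` of the
derivative estimate is below `1`. -/
lemma exists_nat_exponent {p : ℝ} (hp0 : 0 < p) (hp1 : p < 1) :
    ∃ N : ℕ, 1 / 2 < p * (1 + N / 2) ∧ p * (1 + N / 2) < 1 := by
  have hex : ∃ N : ℕ, 1 / 2 < p * (1 + N / 2) := by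
    obtain ⟨N, hN⟩ := exists_nat_gt (1 / p)
    refine ⟨N, ?_⟩
    rw [div_lt_iff₀ hp0] at hN
    nlinarith
  classical
  refine ⟨Nat.find hex, Nat.find_spec hex, ?_⟩
  rcases Nat.eq_zero_or_pos (Nat.find hex) with h | h
  · rw [h]
    simpa using hp1
  · have hm := Nat.find_min hex (Nat.sub_lt h one_pos)
    rw [Nat.cast_pred h] at hm
    push Not at hm
    nlinarith

lemma continuous_inv_one_sub {b : ℂ} (hb : ‖b‖ < 1) :
    Continuous fun w : Circle => (1 - (starRingEnd ℂ) b * (w : ℂ))⁻¹ :=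
  Continuous.inv₀ (by fun_prop) fun w => one_sub_conj_mul_ne_zero hb (Circle.norm_coe w).le

lemma HasBoundary.inv_one_sub {F : ℂ → ℂ} {f : Circle → ℂ} (hF : HasBoundary F f)
    (h1 : ∀ z ∈ Metric.ball (0 : ℂ) 1, ‖F z‖ ≤ 1) {b : ℂ} (hb : ‖b‖ < 1) :
    HasBoundary (fun z => (1 - (starRingEnd ℂ) b * F z)⁻¹)
      (fun w => (1 - (starRingEnd ℂ) b * f w)⁻¹) := by
  have h := (HasBoundary.const 1).add ((HasBoundary.const (-(starRingEnd ℂ) b)).mul hF)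
  simp only [neg_mul, ← sub_eq_add_neg] at h
  refine h.inv (sub_pos.2 hb) fun z hz => ?_
  have := norm_sub_norm_le 1 ((starRingEnd ℂ) b * F z)
  rw [norm_one, norm_mul, RCLike.norm_conj] at this
  nlinarith [h1 z hz, norm_nonneg b]

lemma inv_sq_rpow {x : ℝ≥0∞} (p : ℝ) : ((x ^ 2)⁻¹) ^ p = x ^ (-2 * p) := by
  rw [← ENNReal.rpow_natCast, ← ENNReal.rpow_neg, ← ENNReal.rpow_mul]
  norm_num

lemma inv_pow_rpow {x : ℝ≥0∞} (N : ℕ) (p : ℝ) : ((x⁻¹) ^ N) ^ p = x ^ (-N * p) := by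
  rw [← ENNReal.rpow_neg_one, ← ENNReal.rpow_natCast, ← ENNReal.rpow_mul, ← ENNReal.rpow_mul]
  ring_nf

lemma enorm_kernel {a : ℂ} (ha : ‖a‖ < 1) (w : Circle) :
    ‖(w : ℂ) / (1 - (starRingEnd ℂ) a * w) ^ 2‖ₑ = (‖1 - (starRingEnd ℂ) a * (w : ℂ)‖ₑ ^ 2)⁻¹ := by
  have h := one_sub_conj_mul_ne_zero ha (Circle.norm_coe w).le
  rw [div_eq_mul_inv, enorm_mul, enorm_inv (pow_ne_zero 2 h), enorm_pow, ← ofReal_norm (w : ℂ),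
    Circle.norm_coe, ENNReal.ofReal_one, one_mul]

/-- The basic inequality, obtained from the test function
`w (1 - ā w)⁻² (1 - conj (η a) η)⁻ᴺ` and Hölder's inequality. -/
lemma enorm_deriv_rpow_mul_kernelMean_le (hη : IsInner η) (hη0 : η 0 = 0) {p C : ℝ} (hp : 0 < p)
    (hC : ∀ (F : ℂ → ℂ) (f G : Circle → ℂ), HasBoundary F f → Represents η f G →
        ∫⁻ w, ‖G w‖ₑ ^ p ∂circleMeasure ≤
          ENNReal.ofReal C ^ p * ∫⁻ w, ‖f w‖ₑ ^ p ∂circleMeasure)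
    {N : ℕ} {q : ℝ} (hq : q = p * (1 + N / 2)) {a : ℂ} (ha : ‖a‖ < 1) :
    ‖deriv η a‖ₑ ^ p * kernelMean (2 * q) (η a) ≤ ENNReal.ofReal C ^ p *
      (kernelMean (2 * q) a ^ (p / q) * kernelMean (2 * q) (η a) ^ (1 - p / q)) := by
  have hb : ‖η a‖ < 1 := (hη.norm_le hη0 ha).trans_lt ha
  set b := η a with hbdef
  have hN : (0 : ℝ) ≤ N := Nat.cast_nonneg N
  have hq0 : 0 < q := by rw [hq]; positivity
  have hpq : p ≤ q := by rw [hq]; nlinarith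
  let Ψ : C(Circle, ℂ) := ⟨fun w => ((1 - (starRingEnd ℂ) b * (w : ℂ))⁻¹) ^ N,
    (continuous_inv_one_sub hb).pow N⟩
  have hF := (hasBoundary_kernel ha).mul ((hη.hasBoundary.inv_one_sub hη.2 hb).pow N)
  have hR := (hη.represents_kernel hη0 ha).mul hη Ψ
  have h := hC _ _ _ hF hR
  have hmp := hη.measurePreserving hη0
  have hl : ∫⁻ w : Circle, ‖(starRingEnd ℂ) (deriv η a) *
      ((w : ℂ) / (1 - (starRingEnd ℂ) b * w) ^ 2) * Ψ w‖ₑ ^ p ∂circleMeasure =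
      ‖deriv η a‖ₑ ^ p * kernelMean (2 * q) b := by
    rw [kernelMean, ← lintegral_const_mul _ (measurable_kernel _ _)]
    refine lintegral_congr fun w => ?_
    have hne := one_sub_conj_mul_ne_zero hb (Circle.norm_coe w).le
    rw [enorm_mul, enorm_mul, enorm_kernel hb, RCLike.enorm_conj]
    simp only [Ψ, ContinuousMap.coe_mk]
    rw [enorm_pow, enorm_inv hne, ENNReal.mul_rpow_of_nonneg _ _ hp.le,
      ENNReal.mul_rpow_of_nonneg _ _ hp.le, inv_sq_rpow, inv_pow_rpow, mul_assoc,
      ← ENNReal.rpow_add _ _ (by simpa using hne) enorm_ne_top]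
    congr 2
    rw [hq]
    ring
  -- Hölder with weights `p/q` and `1 - p/q`: the exponents split as `2q · p/q = 2p` and `2q (1 -
  -- p/q) = N p`. The factor depending on `η` has the mean of the kernel at `η a`, because the
  -- boundary map preserves `m`.
  have hr : ∫⁻ w : Circle, ‖(w : ℂ) / (1 - (starRingEnd ℂ) a * w) ^ 2 *
      ((1 - (starRingEnd ℂ) b * (boundaryMap η w : ℂ))⁻¹) ^ N‖ₑ ^ p ∂circleMeasure ≤
      kernelMean (2 * q) a ^ (p / q) * kernelMean (2 * q) b ^ (1 - p / q) := by
    have hkb : kernelMean (2 * q) b = ∫⁻ w : Circle,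
        ‖1 - (starRingEnd ℂ) b * (boundaryMap η w : ℂ)‖ₑ ^ (-(2 * q)) ∂circleMeasure :=
      (hmp.lintegral_comp (measurable_kernel (2 * q) b)).symm
    rw [hkb, kernelMean]
    refine le_of_eq_of_le (lintegral_congr fun w => ?_)
      (ENNReal.lintegral_mul_norm_pow_le (measurable_kernel (2 * q) a).aemeasurable
        ((measurable_kernel (2 * q) b).comp hmp.measurable).aemeasurable
        (by positivity) (sub_nonneg.2 ((div_le_one hq0).2 hpq)) (by ring))
    have hne := one_sub_conj_mul_ne_zero hb (Circle.norm_coe (boundaryMap η w)).le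
    rw [enorm_mul, enorm_kernel ha, enorm_pow, enorm_inv hne,
      ENNReal.mul_rpow_of_nonneg _ _ hp.le, inv_sq_rpow, inv_pow_rpow]
    simp only [Function.comp_apply]
    rw [← ENNReal.rpow_mul, ← ENNReal.rpow_mul]
    congr 2
    · field_simp
    · have : 2 * q * (1 - p / q) = 2 * q - 2 * p := by field_simp
      rw [neg_mul, neg_mul, this, hq]
      ring
  rw [← hl]
  exact h.trans (mul_le_mul' le_rfl hr)

lemma kernelMean_ne_top {γ : ℝ} (hγ : 1 < γ) {a : ℂ} (ha : ‖a‖ < 1) : kernelMean γ a ≠ ⊤ :=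
  ((kernelMean_le hγ ha).trans_lt ENNReal.ofReal_lt_top).ne

lemma kernelMean_ne_zero {γ : ℝ} (hγ : 1 < γ) {a : ℂ} (ha : ‖a‖ < 1) : kernelMean γ a ≠ 0 := by
  refine (lt_of_lt_of_le ?_ (le_kernelMean (by linarith) ha)).ne'
  rw [ENNReal.ofReal_pos]
  have h1 : 0 < 1 - ‖a‖ := by linarith
  have := Real.pi_pos
  positivity

/-- In the basic inequality the common factor `K(η a)^(1 - p/q)` cancels, leaving `|η' a|^q K(η a) ≤
C^q K(a)` after a power is taken. The two-sided estimate `K(a) ≈ (1 - |a|)^(1 - 2q)` then gives `β =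
(2q - 1)/q`, which is below `1` exactly because `q < 1`. -/
lemma IsBoundedCondExp.exists_norm_deriv_le (hη : IsInner η) (hη0 : η 0 = 0) {p : ℝ} (hp : 0 < p)
    (hp1 : p < 1) {T : hardy (ENNReal.ofReal p) →ₗ[ℂ] hardy (ENNReal.ofReal p)}
    (hT : IsBoundedCondExp η (hardy (ENNReal.ofReal p)) T) :
    ∃ M β : ℝ, 0 ≤ M ∧ 0 < β ∧ β < 1 ∧ ∀ a : ℂ, ‖a‖ < 1 →
      ‖deriv η a‖ ≤ M * ((1 - ‖η a‖) / (1 - ‖a‖)) ^ β := by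
  obtain ⟨C, hC0, hC⟩ := hT.exists_lintegral_le hη hη0 hp
  obtain ⟨N, hN1, hN2⟩ := exists_nat_exponent hp hp1
  obtain ⟨q, hq⟩ : ∃ q : ℝ, q = p * (1 + N / 2) := ⟨_, rfl⟩
  rw [← hq] at hN1 hN2
  have hq0 : 0 < q := by linarith
  have hγ : 1 < 2 * q := by linarith
  set c₁ := (2 * Real.pi)⁻¹ * 2 ^ (-(2 * q)) with hc₁
  set c₂ := (2 * Real.pi)⁻¹ * ((2 * Real.pi) ^ (2 * q) * (2 / (2 * q - 1))) with hc₂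
  have hpi := Real.pi_pos
  have hc₁0 : 0 < c₁ := by positivity
  have hc₂0 : 0 < c₂ := by
    have : 0 < 2 * q - 1 := by linarith
    positivity
  refine ⟨C * (c₂ / c₁) ^ (1 / q), (2 * q - 1) / q, by positivity,
    div_pos (by linarith) hq0, (div_lt_one hq0).2 (by linarith), fun a ha => ?_⟩
  have hb : ‖η a‖ < 1 := (hη.norm_le hη0 ha).trans_lt ha
  have h := enorm_deriv_rpow_mul_kernelMean_le hη hη0 hp hC hq ha
  have hK0 := kernelMean_ne_zero hγ hb
  have hKt := kernelMean_ne_top hγ hb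
  have hsplit : kernelMean (2 * q) (η a) =
      kernelMean (2 * q) (η a) ^ (p / q) * kernelMean (2 * q) (η a) ^ (1 - p / q) := by
    rw [← ENNReal.rpow_add _ _ hK0 hKt]
    simp
  have h2 : ‖deriv η a‖ₑ ^ p * kernelMean (2 * q) (η a) ^ (p / q) ≤
      ENNReal.ofReal C ^ p * kernelMean (2 * q) a ^ (p / q) := by
    have hne0 : kernelMean (2 * q) (η a) ^ (1 - p / q) ≠ 0 := by
      simp [ENNReal.rpow_eq_zero_iff, hK0, hKt]
    have hnet : kernelMean (2 * q) (η a) ^ (1 - p / q) ≠ ⊤ := by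
      simp [ENNReal.rpow_eq_top_iff, hK0, hKt]
    refine (ENNReal.mul_le_mul_iff_left hne0 hnet).1 ?_
    rw [mul_assoc, ← hsplit, mul_assoc]
    exact h
  -- Written this way, the inequality `h2` is the `p/q`-th power of `h3`.
  have hpe : p = q * (p / q) := by field_simp
  have h3 : ‖deriv η a‖ₑ ^ q * kernelMean (2 * q) (η a) ≤
      ENNReal.ofReal C ^ q * kernelMean (2 * q) a := by
    have hpq : 0 < p / q := by positivity
    rw [← ENNReal.rpow_le_rpow_iff hpq, ENNReal.mul_rpow_of_nonneg _ _ hpq.le,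
      ENNReal.mul_rpow_of_nonneg _ _ hpq.le, ← ENNReal.rpow_mul, ← ENNReal.rpow_mul, ← hpe]
    exact h2
  have h4 : ‖deriv η a‖ ^ q * (c₁ * (1 - ‖η a‖) ^ (1 - 2 * q)) ≤
      C ^ q * (c₂ * (1 - ‖a‖) ^ (1 - 2 * q)) := by
    have h5 := (mul_le_mul' (le_refl (‖deriv η a‖ₑ ^ q))
      (le_kernelMean (γ := 2 * q) (by linarith) hb)).trans
      (h3.trans (mul_le_mul' le_rfl (kernelMean_le hγ ha)))
    have h6 : 0 < 1 - ‖a‖ := by linarith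
    rw [← ofReal_norm, ENNReal.ofReal_rpow_of_nonneg (norm_nonneg _) hq0.le,
      ENNReal.ofReal_rpow_of_nonneg hC0 hq0.le, ← ENNReal.ofReal_mul (by positivity),
      ← ENNReal.ofReal_mul (by positivity)] at h5
    exact (ENNReal.ofReal_le_ofReal_iff (by positivity)).1 h5
  have h6 : 0 < 1 - ‖a‖ := by linarith
  have h7 : 0 < 1 - ‖η a‖ := by linarith
  rw [← Real.rpow_le_rpow_iff (norm_nonneg _) (by positivity) hq0,
    Real.mul_rpow (by positivity) (by positivity), Real.mul_rpow (by positivity) (by positivity),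
    ← Real.rpow_mul (by positivity), ← Real.rpow_mul (by positivity), one_div_mul_cancel hq0.ne',
    div_mul_cancel₀ _ hq0.ne', Real.rpow_one, Real.div_rpow h7.le h6.le]
  have e1 : (1 - ‖η a‖) ^ (1 - 2 * q) = ((1 - ‖η a‖) ^ (2 * q - 1))⁻¹ := by
    rw [← Real.rpow_neg h7.le, neg_sub]
  have e2 : (1 - ‖a‖) ^ (1 - 2 * q) = ((1 - ‖a‖) ^ (2 * q - 1))⁻¹ := by
    rw [← Real.rpow_neg h6.le, neg_sub]
  rw [e1, e2] at h4
  have p1 : 0 < (1 - ‖η a‖) ^ (2 * q - 1) := Real.rpow_pos_of_pos h7 _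
  have p2 : 0 < (1 - ‖a‖) ^ (2 * q - 1) := Real.rpow_pos_of_pos h6 _
  have h8 : ‖deriv η a‖ ^ q * (c₁ * ((1 - ‖η a‖) ^ (2 * q - 1))⁻¹) =
      ‖deriv η a‖ ^ q * (c₁ / (1 - ‖η a‖) ^ (2 * q - 1)) := by rw [div_eq_mul_inv]
  rw [h8] at h4
  have h9 := (le_div_iff₀ (by positivity)).2 h4
  refine h9.trans_eq ?_
  field_simp

/-! ### From the derivative estimate to finite Blaschke products -/

/-- Put `u(t) = 1 - |η(tw)|²`. The derivative estimate gives `u' ≥ -2M u^β (1 - t)^(-β)`, so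
`u^(1-β) - 2M (1 - t)^(1-β)` is nondecreasing in `t`. It tends to `0` as `t → 1`, hence is
nonpositive. The condition `β < 1` makes the singularity at `t = 1` integrable. -/
lemma IsInner.rpow_one_sub_normSq_le (hη : IsInner η) (hη0 : η 0 = 0) {M β : ℝ} (hM : 0 ≤ M)
    (hβ0 : 0 < β) (hβ1 : β < 1)
    (h : ∀ a : ℂ, ‖a‖ < 1 → ‖deriv η a‖ ≤ M * ((1 - ‖η a‖) / (1 - ‖a‖)) ^ β) {w : Circle}
    {l : ℂ} (hl : ‖l‖ = 1)
    (hw : Tendsto (fun r : ℝ => η ((r : ℂ) * (w : ℂ))) (𝓝[<] (1 : ℝ)) (𝓝 l))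
    {r : ℝ} (hr : r ∈ Set.Ioo (0 : ℝ) 1) :
    (1 - ‖η (r * w)‖ ^ 2) ^ (1 - β) ≤ 2 * M * (1 - r) ^ (1 - β) := by
  let u : ℝ → ℝ := fun t => 1 - ‖η (t * w)‖ ^ 2
  let g : ℝ → ℝ := fun t => u t ^ (1 - β) - 2 * M * (1 - t) ^ (1 - β)
  have hnorm : ∀ t ∈ Set.Ioo (0 : ℝ) 1, ‖(t : ℂ) * (w : ℂ)‖ = t := fun t ht => by
    rw [norm_mul, Circle.norm_coe, mul_one, Complex.norm_real, Real.norm_of_nonneg ht.1.le]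
  have hlt : ∀ t ∈ Set.Ioo (0 : ℝ) 1, ‖η (t * w)‖ < 1 := fun t ht =>
    (hη.norm_le hη0 ((hnorm t ht).trans_lt ht.2)).trans_lt ((hnorm t ht).trans_lt ht.2)
  have hu0 : ∀ t ∈ Set.Ioo (0 : ℝ) 1, 0 < u t := fun t ht => by
    have := hlt t ht
    simp only [u]
    nlinarith [norm_nonneg (η (t * w))]
  have hderiv : ∀ t ∈ Set.Ioo (0 : ℝ) 1, ∃ g', HasDerivAt g g' t ∧ 0 ≤ g' := by
    intro t ht
    have hz := ofReal_mul_circle_mem_ball w ht.1.le ht.2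
    have hd : HasDerivAt η (deriv η (t * w)) (t * w) :=
      (hη.1.differentiableAt (Metric.isOpen_ball.mem_nhds hz)).hasDerivAt
    have hin : HasDerivAt (fun s : ℝ => (s : ℂ) * (w : ℂ)) (w : ℂ) t := by
      simpa using (Complex.ofRealCLM.hasDerivAt (x := t)).mul_const (w : ℂ)
    have hη' : HasDerivAt (fun s : ℝ => η (s * w)) (deriv η (t * w) * w) t :=
      HasDerivAt.comp_of_eq t hd hin rfl
    have hu' : HasDerivAt u (-(2 * inner ℝ (η (t * w)) (deriv η (t * w) * w))) t :=
      hη'.norm_sq.const_sub 1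
    have h1 := hu'.rpow_const (p := 1 - β) (Or.inl (hu0 t ht).ne')
    have ht1 : 0 < 1 - t := by linarith [ht.2]
    have h2 : HasDerivAt (fun s : ℝ => (1 - s) ^ (1 - β)) (-1 * (1 - β) * (1 - t) ^ (1 - β - 1)) t :=
      ((hasDerivAt_id t).const_sub 1).rpow_const (Or.inl ht1.ne')
    refine ⟨_, h1.sub (h2.const_mul (2 * M)), ?_⟩
    have hexp : 1 - β - 1 = -β := by ring
    rw [hexp]
    have hcs : inner ℝ (η (t * w)) (deriv η (t * w) * w) ≤ ‖deriv η (t * w)‖ := by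
      refine (real_inner_le_norm _ _).trans ?_
      rw [norm_mul, Circle.norm_coe, mul_one]
      exact mul_le_of_le_one_left (norm_nonneg _) (hlt t ht).le
    have hest := h (t * w) (mem_ball_zero_iff.1 hz)
    rw [hnorm t ht] at hest
    have hu1 : 1 - ‖η (t * w)‖ ≤ u t := by
      simp only [u]
      nlinarith [norm_nonneg (η (t * w)), hlt t ht]
    have hest2 : ‖deriv η (t * w)‖ ≤ M * (u t ^ β * (1 - t) ^ (-β)) := by
      refine hest.trans (mul_le_mul_of_nonneg_left ?_ hM)
      rw [Real.rpow_neg ht1.le, ← div_eq_mul_inv, ← Real.div_rpow (hu0 t ht).le ht1.le]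
      refine Real.rpow_le_rpow (div_nonneg (by linarith [hlt t ht]) ht1.le) ?_ hβ0.le
      gcongr
    have hcancel : u t ^ β * u t ^ (-β) = 1 := by
      rw [← Real.rpow_add (hu0 t ht)]
      simp
    have hup : 0 < u t ^ (-β) := Real.rpow_pos_of_pos (hu0 t ht) _
    have h5 : inner ℝ (η (t * w)) (deriv η (t * w) * w) * u t ^ (-β) ≤ M * (1 - t) ^ (-β) := by
      calc _ ≤ M * (u t ^ β * (1 - t) ^ (-β)) * u t ^ (-β) :=
            mul_le_mul_of_nonneg_right (hcs.trans hest2) hup.le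
        _ = M * (1 - t) ^ (-β) * (u t ^ β * u t ^ (-β)) := by ring
        _ = _ := by rw [hcancel, mul_one]
    have h6 : 0 < 1 - β := by linarith
    nlinarith
  have hmono : MonotoneOn g (Set.Ioo 0 1) := by
    choose! g' hg' using hderiv
    refine monotoneOn_of_hasDerivWithinAt_nonneg (convex_Ioo 0 1)
      (fun t ht => (hg' t ht).1.continuousAt.continuousWithinAt) (f' := g') ?_ ?_
    · intro t ht
      rw [interior_Ioo] at ht
      exact (hg' t ht).1.hasDerivWithinAt
    · intro t ht
      rw [interior_Ioo] at ht
      exact (hg' t ht).2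
  have hlim : Tendsto g (𝓝[<] (1 : ℝ)) (𝓝 0) := by
    have h6 : 0 < 1 - β := by linarith
    have hu : Tendsto u (𝓝[<] (1 : ℝ)) (𝓝 0) := by
      have := (hw.norm.pow 2).const_sub 1
      rw [hl] at this
      simpa using this
    have h1 : Tendsto (fun t => u t ^ (1 - β)) (𝓝[<] (1 : ℝ)) (𝓝 0) := by
      have := hu.rpow_const (p := 1 - β) (Or.inr h6.le)
      rwa [Real.zero_rpow h6.ne'] at this
    have h2 : Tendsto (fun t : ℝ => (1 - t) ^ (1 - β)) (𝓝[<] (1 : ℝ)) (𝓝 0) := by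
      have h3 : Tendsto (fun t : ℝ => 1 - t) (𝓝[<] (1 : ℝ)) (𝓝 0) := by
        have : Tendsto (fun t : ℝ => 1 - t) (𝓝 1) (𝓝 (1 - 1)) :=
          Continuous.tendsto (by fun_prop) 1
        rw [sub_self] at this
        exact this.mono_left nhdsWithin_le_nhds
      have := h3.rpow_const (p := 1 - β) (Or.inr h6.le)
      rwa [Real.zero_rpow h6.ne'] at this
    simpa using h1.sub (h2.const_mul (2 * M))
  have hle : g r ≤ 0 := by
    refine ge_of_tendsto hlim ?_
    filter_upwards [Ioo_mem_nhdsLT hr.2] with t ht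
    exact hmono hr ⟨hr.1.trans ht.1, ht.2⟩ ht.1.le
  simp only [g, u, sub_nonpos] at hle
  exact hle

/-- The radial bound holds for almost every `w` with a right side independent of `w`. At a fixed
radius it extends to every `w`, since its failure is an open condition and arc length charges
nonempty open sets. -/
lemma IsInner.uniformlyUnimodular (hη : IsInner η) (hη0 : η 0 = 0) {M β : ℝ} (hM : 0 ≤ M)
    (hβ0 : 0 < β) (hβ1 : β < 1)
    (h : ∀ a : ℂ, ‖a‖ < 1 → ‖deriv η a‖ ≤ M * ((1 - ‖η a‖) / (1 - ‖a‖)) ^ β) :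
    UniformlyUnimodular η := by
  have h6 : 0 < 1 - β := by linarith
  have hall : ∀ r ∈ Set.Ioo (0 : ℝ) 1, ∀ w : Circle,
      (1 - ‖η (r * w)‖ ^ 2) ^ (1 - β) ≤ 2 * M * (1 - r) ^ (1 - β) := by
    intro r hr
    have hae : ∀ᵐ w : Circle ∂circleMeasure,
        (1 - ‖η (r * w)‖ ^ 2) ^ (1 - β) ≤ 2 * M * (1 - r) ^ (1 - β) := by
      filter_upwards [hη.radial] with w ⟨l, hl, hw⟩
      exact hη.rpow_one_sub_normSq_le hη0 hM hβ0 hβ1 h hl hw hr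
    have hcont : Continuous fun w : Circle => (1 - ‖η (r * w)‖ ^ 2) ^ (1 - β) := by
      have := hη.hasBoundary.continuous_dilate hr
      exact (continuous_const.sub (this.norm.pow 2)).rpow_const fun w => Or.inr h6.le
    intro w
    by_contra hcon
    have hopen : IsOpen {w : Circle |
        ¬ (1 - ‖η (r * w)‖ ^ 2) ^ (1 - β) ≤ 2 * M * (1 - r) ^ (1 - β)} := by
      simp only [not_le]
      exact isOpen_lt continuous_const hcont
    exact (hopen.measure_pos circleMeasure ⟨w, hcon⟩).ne' (ae_iff.1 hae)
  intro ε hε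
  have hlim : Tendsto (fun t : ℝ => 2 * M * (1 - t) ^ (1 - β)) (𝓝 1) (𝓝 0) := by
    have : Tendsto (fun t : ℝ => 2 * M * (1 - t) ^ (1 - β)) (𝓝 1)
        (𝓝 (2 * M * (1 - 1) ^ (1 - β))) :=
      Continuous.tendsto (continuous_const.mul
        (Continuous.rpow_const (by fun_prop) fun w => Or.inr h6.le)) 1
    simpa [Real.zero_rpow h6.ne'] using this
  have hev := (hlim.mono_left nhdsWithin_le_nhds : Tendsto _ (𝓝[<] (1 : ℝ)) _).eventually
    (gt_mem_nhds (Real.rpow_pos_of_pos hε (1 - β)))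
  obtain ⟨ρ, hρ, hρs⟩ := (mem_nhdsLT_iff_exists_Ioo_subset (a := (1 : ℝ))).1 hev
  -- The maximum with `0` keeps `z` away from the origin, so that `z / ‖z‖` is a point of the
  -- circle.
  refine ⟨max ρ 0, max_lt hρ one_pos, fun z hz hz1 => ?_⟩
  have hz0 : 0 < ‖z‖ := (le_max_right _ _).trans_lt hz
  let w : Circle := ⟨z / ‖z‖, mem_sphere_zero_iff_norm.2 (by
    rw [norm_div, Complex.norm_real, norm_norm, div_self hz0.ne'])⟩
  have hzw : ((‖z‖ : ℝ) : ℂ) * (w : ℂ) = z := by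
    change (‖z‖ : ℂ) * (z / ‖z‖) = z
    have : (‖z‖ : ℂ) ≠ 0 := by exact_mod_cast hz0.ne'
    field_simp
  have h1 := hall ‖z‖ ⟨hz0, hz1⟩ w
  rw [hzw] at h1
  have h2 : 2 * M * (1 - ‖z‖) ^ (1 - β) < ε ^ (1 - β) :=
    hρs ⟨(le_max_left _ _).trans_lt hz, hz1⟩
  have hle1 : ‖η z‖ ≤ 1 := hη.2 z (mem_ball_zero_iff.2 hz1)
  have h3 : 1 - ‖η z‖ ^ 2 < ε := by
    rw [← Real.rpow_lt_rpow_iff (by nlinarith [norm_nonneg (η z)]) hε.le h6]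
    exact h1.trans_lt h2
  nlinarith [norm_nonneg (η z)]

theorem IsBoundedCondExp.isFiniteBlaschke (hη : IsInner η) (hη0 : η 0 = 0) {p : ℝ} (hp : 0 < p)
    (hp1 : p < 1) {T : hardy (ENNReal.ofReal p) →ₗ[ℂ] hardy (ENNReal.ofReal p)}
    (hT : IsBoundedCondExp η (hardy (ENNReal.ofReal p)) T) : IsFiniteBlaschke η := by
  obtain ⟨M, β, hM, hβ0, hβ1, h⟩ := hT.exists_norm_deriv_le hη hη0 hp hp1
  exact (hη.uniformlyUnimodular hη0 hM hβ0 hβ1 h).isFiniteBlaschke hη.1 hη.2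

end HardyCondExp

end

noncomputable section

namespace HardyCondExp

/-! ### Covering maps of the circle and their sections -/

/-- Measurable sections of a self-map `b` of the circle with Jacobian `J`, through which arc length
is the sum of its images with densities `1 / J`. -/
structure Sections (b : Circle → Circle) (J : Circle → ℝ) where
  /-- The number of sections. -/
  card : ℕ
  /-- The sections. -/
  sec : Fin card → Circle → Circle
  measurable_sec : ∀ k, Measurable (sec k)
  map_sec : ∀ k w, b (sec k w) = w
  lintegral_eq : ∀ F : Circle → ℝ≥0∞, Measurable F → ∫⁻ w, F w ∂circleMeasure =
    ∫⁻ w, ∑ k, F (sec k w) / ENNReal.ofReal (J (sec k w)) ∂circleMeasure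

lemma lintegral_Ioc_eq_sum (g : ℝ → ℝ≥0∞) (s : ℝ) (N : ℕ) :
    ∫⁻ t in Set.Ioc s (s + N * (2 * Real.pi)), g t =
      ∑ k : Fin N, ∫⁻ t in Set.Ioc s (s + 2 * Real.pi), g (t + k * (2 * Real.pi)) := by
  induction N with
  | zero => simp
  | succ N ih =>
    have hpi := Real.two_pi_pos
    have hN : (0 : ℝ) ≤ N * (2 * Real.pi) := by positivity
    rw [Fin.sum_univ_castSucc]
    simp only [Fin.val_castSucc, Fin.val_last]
    rw [← ih, ← Set.Ioc_union_Ioc_eq_Ioc (b := s + N * (2 * Real.pi)) (by linarith)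
      (by push_cast; linarith), lintegral_union measurableSet_Ioc
        (Set.Ioc_disjoint_Ioc_of_le le_rfl)]
    congr 1
    rw [← (measurePreserving_add_right volume (N * (2 * Real.pi))).setLIntegral_comp_preimage_emb
      (measurableEmbedding_addRight _)]
    congr 2
    rw [Set.preimage_add_const_Ioc]
    congr 1 <;> push_cast <;> ring

variable {b : Circle → Circle} {J : Circle → ℝ} {φ : ℝ → ℝ}

lemma lift_strictMono (hJ0 : ∀ w, 0 < J w)
    (hφ : ∀ θ, HasDerivAt φ (J (Circle.exp θ)) θ) : StrictMono φ :=
  strictMono_of_deriv_pos fun θ => by rw [(hφ θ).deriv]; exact hJ0 _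

lemma lift_eq_integral (hJ : Continuous J) (hφ : ∀ θ, HasDerivAt φ (J (Circle.exp θ)) θ) (θ : ℝ) :
    φ θ = φ 0 + ∫ s in (0 : ℝ)..θ, J (Circle.exp s) := by
  rw [intervalIntegral.integral_eq_sub_of_hasDerivAt (fun x _ => hφ x)
    ((hJ.comp Circle.exp.continuous).intervalIntegrable _ _)]
  ring

lemma lift_surjective (hJ : Continuous J) (hJ0 : ∀ w, 0 < J w)
    (hφ : ∀ θ, HasDerivAt φ (J (Circle.exp θ)) θ) : Function.Surjective φ := by
  have hper : Function.Periodic (fun s => J (Circle.exp s)) (2 * Real.pi) := fun s => by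
    simp only [Circle.exp_add_two_pi]
  have hc := hJ.comp Circle.exp.continuous
  have hφe : φ = fun θ => φ 0 + ∫ s in (0 : ℝ)..θ, J (Circle.exp s) :=
    funext fun θ => lift_eq_integral hJ hφ θ
  refine Continuous.surjective (continuous_iff_continuousAt.2 fun θ => (hφ θ).continuousAt) ?_ ?_
  · rw [hφe]
    exact tendsto_atTop_add_const_left _ _ (hper.tendsto_atTop_intervalIntegral_of_pos'
      (hc.intervalIntegrable _ _) (fun x => hJ0 _) Real.two_pi_pos)
  · rw [hφe]
    exact tendsto_atBot_add_const_left _ _ (hper.tendsto_atBot_intervalIntegral_of_pos'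
      (hc.intervalIntegrable _ _) (fun x => hJ0 _) Real.two_pi_pos)

/-- The increment over a period is constant because `J ∘ exp` is periodic, a multiple of `2π`
because `exp ∘ φ` closes up, and positive because `φ` increases. `N` is the degree of the covering.
-/
lemma lift_add_two_pi (hJ : Continuous J) (hJ0 : ∀ w, 0 < J w)
    (hφ : ∀ θ, HasDerivAt φ (J (Circle.exp θ)) θ)
    (hb : ∀ θ, b (Circle.exp θ) = Circle.exp (φ θ)) :
    ∃ N : ℕ, 0 < N ∧ ∀ θ, φ (θ + 2 * Real.pi) = φ θ + N * (2 * Real.pi) := by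
  have hper : Function.Periodic (fun s => J (Circle.exp s)) (2 * Real.pi) := fun s => by
    simp only [Circle.exp_add_two_pi]
  have hdiff : ∀ θ, φ (θ + 2 * Real.pi) - φ θ = φ (2 * Real.pi) - φ 0 := by
    intro θ
    have h1 : ∀ x y, φ y - φ x = ∫ s in x..y, J (Circle.exp s) := fun x y =>
      (intervalIntegral.integral_eq_sub_of_hasDerivAt (fun x _ => hφ x)
        ((hJ.comp Circle.exp.continuous).intervalIntegrable _ _)).symm
    rw [h1, h1, hper.intervalIntegral_add_eq θ 0, zero_add]
  have hexp : Circle.exp (φ (2 * Real.pi)) = Circle.exp (φ 0) := by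
    rw [← hb, ← hb, Circle.exp_two_pi, Circle.exp_zero]
  obtain ⟨m, hm⟩ := Circle.exp_eq_exp.1 hexp
  have hlt : φ 0 < φ (2 * Real.pi) := lift_strictMono hJ0 hφ Real.two_pi_pos
  have hm0 : 0 < m := by
    have : (0 : ℝ) < m * (2 * Real.pi) := by linarith
    exact_mod_cast (pos_iff_pos_of_mul_pos this).2 Real.two_pi_pos
  lift m to ℕ using hm0.le
  refine ⟨m, by exact_mod_cast hm0, fun θ => ?_⟩
  have := hdiff θ
  rw [hm] at this
  push_cast at this
  linarith

/-- The representative of the argument of `w` in `(t - π, t + π]`. -/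
def argAt (t : ℝ) (w : Circle) : ℝ := t + Complex.arg ((w * (Circle.exp t)⁻¹ : Circle) : ℂ)

lemma measurable_argAt (t : ℝ) : Measurable (argAt t) := by
  have : Measurable fun w : Circle => ((w * (Circle.exp t)⁻¹ : Circle) : ℂ) :=
    (continuous_circle_coe.comp (continuous_mul_const _)).measurable
  exact (Complex.measurable_arg.comp this).const_add t

lemma exp_argAt (t : ℝ) (w : Circle) : Circle.exp (argAt t w) = w := by
  rw [argAt, Circle.exp_add, Circle.exp_arg, mul_left_comm, mul_inv_cancel, mul_one]

lemma argAt_mem (t : ℝ) (w : Circle) : argAt t w ∈ Set.Ioc (t - Real.pi) (t + Real.pi) := by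
  have h := Complex.arg_mem_Ioc ((w * (Circle.exp t)⁻¹ : Circle) : ℂ)
  exact ⟨by rw [argAt]; linarith [h.1], by rw [argAt]; linarith [h.2]⟩

lemma argAt_exp {t s : ℝ} (hs : s ∈ Set.Ioc (t - Real.pi) (t + Real.pi)) :
    argAt t (Circle.exp s) = s := by
  have : Circle.exp s * (Circle.exp t)⁻¹ = Circle.exp (s - t) := by
    rw [Circle.exp_sub, div_eq_mul_inv]
  rw [argAt, this, Circle.arg_exp (by linarith [hs.1]) (by linarith [hs.2])]
  ring

/-- A map with a smooth increasing lift has sections, only one of which meets a neighborhood of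
a given point. -/
lemma exists_sections (hJ : Continuous J) (hJ0 : ∀ w, 0 < J w)
    (hφ : ∀ θ, HasDerivAt φ (J (Circle.exp θ)) θ)
    (hb : ∀ θ, b (Circle.exp θ) = Circle.exp (φ θ)) (w₀ : Circle) :
    ∃ (S : Sections b J) (k₀ : Fin S.card), ∃ U ∈ 𝓝 w₀, ∀ k, k ≠ k₀ → ∀ w, S.sec k w ∉ U := by
  have hmono := lift_strictMono hJ0 hφ
  obtain ⟨N, hN0, hN⟩ := lift_add_two_pi hJ hJ0 hφ hb
  let e : ℝ ≃o ℝ := hmono.orderIsoOfSurjective φ (lift_surjective hJ hJ0 hφ)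
  have he : ∀ x, e x = φ x := fun x => rfl
  obtain ⟨θ₀, rfl⟩ := Circle.exp_surjective w₀
  set t₀ := φ θ₀ with ht₀
  -- With this base point, `φ` maps `(c, c + 2π]` onto `N` consecutive windows of length `2π`, the
  -- first one centred at `t₀`. The `k`-th section inverts `φ` on the `k`-th window.
  set c := e.symm (t₀ - Real.pi) with hc
  have hφc : φ c = t₀ - Real.pi := by rw [← he, hc, e.apply_symm_apply]
  have hφc2 : φ (c + 2 * Real.pi) = t₀ - Real.pi + N * (2 * Real.pi) := by rw [hN, hφc]
  have hec2 : e.symm (t₀ - Real.pi + N * (2 * Real.pi)) = c + 2 * Real.pi := by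
    rw [← hφc2, ← he, e.symm_apply_apply]
  let sec : Fin N → Circle → Circle := fun k w =>
    Circle.exp (e.symm (argAt t₀ w + k * (2 * Real.pi)))
  have hsec : ∀ k, Measurable (sec k) := fun k =>
    Circle.exp.continuous.measurable.comp
      (e.symm.continuous.measurable.comp ((measurable_argAt t₀).add_const _))
  have hmap : ∀ k w, b (sec k w) = w := by
    intro k w
    simp only [sec]
    rw [hb, ← he, e.apply_symm_apply]
    have : Circle.exp (argAt t₀ w + (k : ℕ) * (2 * Real.pi)) = Circle.exp (argAt t₀ w) :=
      Circle.exp_eq_exp.2 ⟨(k : ℕ), by push_cast; ring⟩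
    rw [this, exp_argAt]
  have hlint : ∀ F : Circle → ℝ≥0∞, Measurable F → ∫⁻ w, F w ∂circleMeasure =
      ∫⁻ w, ∑ k, F (sec k w) / ENNReal.ofReal (J (sec k w)) ∂circleMeasure := by
    intro F hF
    have hmeas : ∀ k, Measurable fun w => F (sec k w) / ENNReal.ofReal (J (sec k w)) := fun k =>
      (hF.comp (hsec k)).div (ENNReal.measurable_ofReal.comp (hJ.measurable.comp (hsec k)))
    let g : ℝ → ℝ≥0∞ := fun t => F (Circle.exp (e.symm t)) /
      ENNReal.ofReal (J (Circle.exp (e.symm t)))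
    have hcov := lintegral_image_eq_lintegral_abs_deriv_mul (s := Set.Ioc c (c + 2 * Real.pi))
      measurableSet_Ioc (fun x _ => (hφ x).hasDerivWithinAt) hmono.injective.injOn g
    have himg : φ '' Set.Ioc c (c + 2 * Real.pi) =
        Set.Ioc (t₀ - Real.pi) (t₀ - Real.pi + N * (2 * Real.pi)) := by
      have := e.image_Ioc c (c + 2 * Real.pi)
      rwa [he, he, hφc, hφc2] at this
    rw [himg, lintegral_Ioc_eq_sum] at hcov
    rw [lintegral_circleMeasure F hF c,
      lintegral_circleMeasure _ (Finset.measurable_fun_sum _ fun k _ => hmeas k) (t₀ - Real.pi)]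
    congr 1
    have h1 : ∫⁻ θ in Set.Ioc c (c + 2 * Real.pi), F (Circle.exp θ) =
        ∫⁻ x in Set.Ioc c (c + 2 * Real.pi), ENNReal.ofReal |J (Circle.exp x)| * g (φ x) := by
      refine lintegral_congr fun x => ?_
      simp only [g]
      rw [← he, e.symm_apply_apply, abs_of_pos (hJ0 _)]
      exact (ENNReal.mul_div_cancel (by simpa using hJ0 _) ENNReal.ofReal_ne_top).symm
    rw [h1, ← hcov, lintegral_finsetSum (f := fun (k : Fin N) (θ : ℝ) =>
      F (sec k (Circle.exp θ)) / ENNReal.ofReal (J (sec k (Circle.exp θ)))) _ fun k _ =>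
      (hmeas k).comp Circle.exp.continuous.measurable]
    refine Finset.sum_congr rfl fun k _ => setLIntegral_congr_fun measurableSet_Ioc fun t ht => ?_
    have ht' : t ∈ Set.Ioc (t₀ - Real.pi) (t₀ + Real.pi) := ⟨ht.1, by linarith [ht.2]⟩
    simp only [g, sec, argAt_exp ht']
  refine ⟨⟨N, sec, hsec, hmap, hlint⟩, ⟨0, hN0⟩, ?_⟩
  -- The arc over `(c, d)` is the interior of the image of section `0` and contains `w₀`. The other
  -- sections have arguments in `(d, c + 2π]`, and `exp` is injective on `(c, c + 2π]`.
  set d := e.symm (t₀ + Real.pi) with hd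
  have hpi := Real.pi_pos
  have hθ₀ : e.symm t₀ = θ₀ := e.symm_apply_apply θ₀
  have hcθ : c < θ₀ := by rw [hc, ← hθ₀]; exact e.symm.strictMono (by linarith)
  have hθd : θ₀ < d := by rw [hd, ← hθ₀]; exact e.symm.strictMono (by linarith)
  have hdc : d ≤ c + 2 * Real.pi := by
    rw [hd, ← hec2]
    refine e.symm.monotone ?_
    have : (1 : ℝ) ≤ N := by exact_mod_cast hN0
    nlinarith
  refine ⟨Circle.exp '' Set.Ioo c d, (isLocalHomeomorph_circleExp.isOpenMap _ isOpen_Ioo).mem_nhds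
    ⟨θ₀, ⟨hcθ, hθd⟩, rfl⟩, ?_⟩
  rintro k hk w ⟨x, hx, hxw⟩
  have hk1 : (1 : ℝ) ≤ (k : ℕ) := by
    have : (k : ℕ) ≠ 0 := fun h => hk (Fin.ext h)
    exact_mod_cast Nat.one_le_iff_ne_zero.2 this
  have hkN : ((k : ℕ) : ℝ) + 1 ≤ N := by exact_mod_cast k.2
  have ha := argAt_mem t₀ w
  set y := e.symm (argAt t₀ w + (k : ℕ) * (2 * Real.pi)) with hy
  have hdy : d < y := e.symm.strictMono (by nlinarith [ha.1])
  have hyc : y ≤ c + 2 * Real.pi := by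
    rw [← hec2]
    exact e.symm.monotone (by nlinarith [ha.2])
  have hxy : x = y := Circle.exp_injOn_Ioc (a := c) (b := c + 2 * Real.pi) (by simp)
    ⟨hx.1, hx.2.le.trans hdc⟩ ⟨hcθ.trans (hθd.trans hdy), hyc⟩ hxw
  linarith [hx.2]

/-! ### The boundary behavior of finite Blaschke products -/

/-- The modulus of the derivative of a Blaschke product with zeros `a` on the circle. -/
def blaschkeJacobian {n : ℕ} (a : Fin n → ℂ) (w : Circle) : ℝ :=
  ∑ j, (1 - ‖a j‖ ^ 2) / ‖(w : ℂ) - a j‖ ^ 2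

variable {n : ℕ} {a : Fin n → ℂ} {c : ℂ}

lemma continuous_blaschkeJacobian (ha : ∀ j, ‖a j‖ < 1) : Continuous (blaschkeJacobian a) := by
  refine continuous_finsetSum _ fun j _ => Continuous.div (by fun_prop) (by fun_prop) fun w => ?_
  exact pow_ne_zero 2 (norm_ne_zero_iff.2 (circle_sub_ne_zero w (ha j)))

lemma blaschkeJacobian_pos (hn : n ≠ 0) (ha : ∀ j, ‖a j‖ < 1) (w : Circle) :
    0 < blaschkeJacobian a w := by
  have : Nonempty (Fin n) := ⟨⟨0, Nat.pos_of_ne_zero hn⟩⟩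
  refine Finset.sum_pos (fun j _ => div_pos ?_ ?_) Finset.univ_nonempty
  · nlinarith [ha j, norm_nonneg (a j)]
  · exact pow_pos (norm_pos_iff.2 (circle_sub_ne_zero w (ha j))) 2

/-- The finite Blaschke product with zeros `a`, as a rational function. -/
def blaschke (c : ℂ) (a : Fin n → ℂ) (z : ℂ) : ℂ :=
  c * ∏ j, (z - a j) / (1 - (starRingEnd ℂ) (a j) * z)

lemma one_sub_conj_mul_circle (a : ℂ) (w : Circle) :
    1 - (starRingEnd ℂ) a * (w : ℂ) = w * (starRingEnd ℂ) ((w : ℂ) - a) := by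
  rw [map_sub, mul_sub, Complex.mul_conj, Complex.normSq_eq_norm_sq, Circle.norm_coe]
  push_cast
  ring

lemma norm_blaschke_circle (hc : ‖c‖ = 1) (ha : ∀ j, ‖a j‖ < 1) (w : Circle) :
    ‖blaschke c a w‖ = 1 := by
  rw [blaschke, norm_mul, hc, one_mul, norm_prod]
  refine Finset.prod_eq_one fun j _ => ?_
  rw [norm_div, one_sub_conj_mul_circle, norm_mul, Circle.norm_coe, one_mul, RCLike.norm_conj,
    div_self (norm_ne_zero_iff.2 (circle_sub_ne_zero w (ha j)))]

lemma differentiableAt_blaschke (ha : ∀ j, ‖a j‖ < 1) {z : ℂ} (hz : ‖z‖ ≤ 1) :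
    DifferentiableAt ℂ (blaschke c a) z := by
  refine DifferentiableAt.const_mul (DifferentiableAt.fun_finsetProd fun j _ => ?_) c
  exact DifferentiableAt.div (by fun_prop) (by fun_prop) (one_sub_conj_mul_ne_zero (ha j) hz)

lemma isOpen_blaschkeDomain (a : Fin n → ℂ) :
    IsOpen {z : ℂ | ∀ j, 1 - (starRingEnd ℂ) (a j) * z ≠ 0} := by
  simp only [Set.ofPred_forall]
  exact isOpen_iInter_of_finite fun j => isOpen_ne_fun (by fun_prop) (by fun_prop)

lemma continuousAt_deriv_blaschke (ha : ∀ j, ‖a j‖ < 1) {z : ℂ} (hz : ‖z‖ ≤ 1) :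
    ContinuousAt (deriv (blaschke c a)) z := by
  have hd : DifferentiableOn ℂ (blaschke c a) {z : ℂ | ∀ j, 1 - (starRingEnd ℂ) (a j) * z ≠ 0} := by
    intro z hz
    refine (DifferentiableAt.const_mul
      (DifferentiableAt.fun_finsetProd fun j _ => ?_) c).differentiableWithinAt
    exact DifferentiableAt.div (by fun_prop) (by fun_prop) (hz j)
  exact (hd.deriv (isOpen_blaschkeDomain a)).continuousOn.continuousAt
    ((isOpen_blaschkeDomain a).mem_nhds fun j => one_sub_conj_mul_ne_zero (ha j) hz)

/-- Logarithmic differentiation: a factor contributes `(1 - |a|²) / ((w - a)(1 - ā w))`, and `1 - ā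
w = w · conj (w - a)` on the circle, so `w η'/η` is a sum of positive terms. -/
lemma mul_deriv_blaschke (hc : ‖c‖ = 1) (ha : ∀ j, ‖a j‖ < 1) (w : Circle) :
    (w : ℂ) * deriv (blaschke c a) w = blaschkeJacobian a w * blaschke c a w := by
  have hc0 : c ≠ 0 := norm_ne_zero_iff.1 (by rw [hc]; exact one_ne_zero)
  have hne : blaschke c a w ≠ 0 :=
    norm_ne_zero_iff.1 (by rw [norm_blaschke_circle hc ha]; exact one_ne_zero)
  have hw := Circle.coe_ne_zero w
  have hden : ∀ j, 1 - (starRingEnd ℂ) (a j) * (w : ℂ) ≠ 0 := fun j =>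
    one_sub_conj_mul_ne_zero (ha j) (Circle.norm_coe w).le
  have hnum : ∀ j, (w : ℂ) - a j ≠ 0 := fun j => circle_sub_ne_zero w (ha j)
  have hfac : ∀ j, DifferentiableAt ℂ
      (fun z : ℂ => (z - a j) / (1 - (starRingEnd ℂ) (a j) * z)) w := fun j =>
    DifferentiableAt.div (by fun_prop) (by fun_prop) (hden j)
  have hlog : logDeriv (blaschke c a) w = ∑ j, (1 - ‖a j‖ ^ 2 : ℝ) /
      (((w : ℂ) - a j) * (1 - (starRingEnd ℂ) (a j) * w)) := by
    have h1 : logDeriv (blaschke c a) w =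
        logDeriv (fun z => ∏ j, (z - a j) / (1 - (starRingEnd ℂ) (a j) * z)) w :=
      logDeriv_const_mul _ _ hc0
    rw [h1, logDeriv_prod (f := fun j (z : ℂ) => (z - a j) / (1 - (starRingEnd ℂ) (a j) * z))
      (fun j _ => div_ne_zero (hnum j) (hden j)) (fun j _ => hfac j)]
    refine Finset.sum_congr rfl fun j _ => ?_
    rw [logDeriv_div (f := fun z : ℂ => z - a j)
      (g := fun z : ℂ => 1 - (starRingEnd ℂ) (a j) * z) (w : ℂ) (hnum j) (hden j) (by fun_prop) (by fun_prop), logDeriv_apply,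
      logDeriv_apply]
    have d1 : deriv (fun z : ℂ => z - a j) w = 1 := by simp
    have d2 : deriv (fun z : ℂ => 1 - (starRingEnd ℂ) (a j) * z) w = -(starRingEnd ℂ) (a j) := by
      rw [deriv_const_sub, deriv_const_mul _ differentiableAt_fun_id, deriv_id'', mul_one]
    rw [d1, d2, div_sub_div _ _ (hnum j) (hden j)]
    congr 1
    have := Complex.mul_conj (a j)
    rw [Complex.normSq_eq_norm_sq] at this
    push_cast at this ⊢
    rw [← this]
    ring
  have h2 : (w : ℂ) * logDeriv (blaschke c a) w = blaschkeJacobian a w := by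
    rw [hlog, Finset.mul_sum, blaschkeJacobian]
    push_cast
    refine Finset.sum_congr rfl fun j _ => ?_
    rw [one_sub_conj_mul_circle, ← Complex.conj_mul' ((w : ℂ) - a j), mul_div_assoc']
    have h3 : (starRingEnd ℂ) ((w : ℂ) - a j) ≠ 0 := (map_ne_zero _).2 (hnum j)
    have h4 := hnum j
    rw [div_eq_div_iff (mul_ne_zero h4 (mul_ne_zero hw h3)) (mul_ne_zero h3 h4)]
    ring
  rw [← h2, logDeriv_apply]
  field_simp

/-- The argument of a Blaschke product along the circle. -/
lemma exists_lift_blaschke (hc : ‖c‖ = 1) (ha : ∀ j, ‖a j‖ < 1) : ∃ φ : ℝ → ℝ,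
    (∀ θ, HasDerivAt φ (blaschkeJacobian a (Circle.exp θ)) θ) ∧
    ∀ θ, blaschke c a (Circle.exp θ) = Circle.exp (φ θ) := by
  have hJ := (continuous_blaschkeJacobian ha).comp Circle.exp.continuous
  let α := Complex.arg (blaschke c a 1)
  let φ : ℝ → ℝ := fun θ => α + ∫ s in (0 : ℝ)..θ, blaschkeJacobian a (Circle.exp s)
  have hφ : ∀ θ, HasDerivAt φ (blaschkeJacobian a (Circle.exp θ)) θ := fun θ =>
    (hJ.integral_hasStrictDerivAt 0 θ).hasDerivAt.const_add α
  refine ⟨φ, hφ, ?_⟩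
  -- The quotient of the Blaschke product by `exp (i φ)` has derivative zero, and it equals `1` at
  -- `θ = 0` by the choice of `α`.
  let h : ℝ → ℂ := fun θ => blaschke c a (Complex.exp (θ * Complex.I)) *
    Complex.exp (-(φ θ * Complex.I))
  have hexp : ∀ θ : ℝ, HasDerivAt (fun s : ℝ => Complex.exp (s * Complex.I))
      (Complex.exp (θ * Complex.I) * Complex.I) θ := fun θ => by
    have h1 : HasDerivAt (fun s : ℝ => (s : ℂ) * Complex.I) Complex.I θ := by
      simpa using (Complex.ofRealCLM.hasDerivAt (x := θ)).mul_const Complex.I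
    exact h1.cexp
  have hder : ∀ θ, HasDerivAt h 0 θ := by
    intro θ
    have hB : HasDerivAt (blaschke c a) (deriv (blaschke c a) (Circle.exp θ : ℂ))
        (Complex.exp (θ * Complex.I)) :=
      (differentiableAt_blaschke ha (z := (Circle.exp θ : ℂ)) (Circle.norm_coe _).le).hasDerivAt
    have h1 := HasDerivAt.comp_of_eq θ hB (hexp θ) rfl
    have h2 : HasDerivAt (fun s : ℝ => Complex.exp (-(φ s * Complex.I)))
        (Complex.exp (-(φ θ * Complex.I)) *
          -(blaschkeJacobian a (Circle.exp θ) * Complex.I)) θ :=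
      (((hφ θ).ofReal_comp.mul_const Complex.I).neg).cexp
    have h3 := h1.mul h2
    refine h3.congr_deriv ?_
    have hm := mul_deriv_blaschke hc ha (Circle.exp θ)
    rw [← Circle.coe_exp]
    simp only [Function.comp_apply]
    rw [← Circle.coe_exp]
    linear_combination (Complex.I * Complex.exp (-(φ θ * Complex.I))) * hm
  have hconst : ∀ θ, h θ = h 0 := fun θ =>
    is_const_of_deriv_eq_zero (fun x => (hder x).differentiableAt) (fun x => (hder x).deriv) θ 0
  have hn1 : ‖blaschke c a 1‖ = 1 := by
    have := norm_blaschke_circle hc ha 1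
    rwa [Circle.coe_one] at this
  have h0 : h 0 = 1 := by
    have : blaschke c a 1 = Complex.exp (α * Complex.I) := by
      have := Complex.norm_mul_exp_arg_mul_I (blaschke c a 1)
      rw [hn1, Complex.ofReal_one, one_mul] at this
      exact this.symm
    simp only [h, φ, intervalIntegral.integral_same, add_zero, Complex.ofReal_zero, zero_mul,
      Complex.exp_zero]
    rw [this, ← Complex.exp_add, add_neg_cancel, Complex.exp_zero]
  intro θ
  have h1 := hconst θ
  rw [h0] at h1
  simp only [h] at h1
  rw [Complex.exp_neg, ← div_eq_mul_inv, div_eq_one_iff_eq (Complex.exp_ne_zero _)] at h1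
  rw [Circle.coe_exp, Circle.coe_exp]
  exact h1

variable {η : ℂ → ℂ}

lemma radialLimit_eq_of_eqOn {F G : ℂ → ℂ} (h : Set.EqOn F G (Metric.ball 0 1)) {w : Circle}
    (hG : ContinuousAt G w) : radialLimit F w = G w := by
  refine Tendsto.limUnder_eq ((hG.tendsto.comp (tendsto_ofReal_mul_circle w)).congr' ?_)
  filter_upwards [Ioo_mem_nhdsLT_one] with r hr
  exact (h (ofReal_mul_circle_mem_ball w hr.1.le hr.2)).symm

/-- The Jacobian, the sections and the derivative of a finite Blaschke product on the circle. -/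
lemma IsFiniteBlaschke.exists_jacobian (hB : IsFiniteBlaschke η) (hη0 : η 0 = 0) :
    ∃ J : Circle → ℝ, Continuous J ∧ (∀ w, 0 < J w) ∧
      (∀ w, ‖radialLimit (deriv η) w‖ = J w) ∧
      ∀ w₀, ∃ (S : Sections (boundaryMap η) J) (k₀ : Fin S.card), ∃ U ∈ 𝓝 w₀,
        ∀ k, k ≠ k₀ → ∀ w, S.sec k w ∉ U := by
  obtain ⟨c, n, a, hc, ha, hη⟩ := hB
  have heq : Set.EqOn η (blaschke c a) (Metric.ball 0 1) := hη
  -- `η 0 = 0` excludes the empty product; without this `J` would vanish identically.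
  have hn : n ≠ 0 := by
    rintro rfl
    have := hη 0 (by simp)
    rw [hη0] at this
    simp only [Finset.univ_eq_empty, Finset.prod_empty, mul_one] at this
    rw [← this] at hc
    simp at hc
  have hbd : ∀ w : Circle, radialLimit η w = blaschke c a w := fun w =>
    radialLimit_eq_of_eqOn heq (differentiableAt_blaschke ha (Circle.norm_coe w).le).continuousAt
  have hder : Set.EqOn (deriv η) (deriv (blaschke c a)) (Metric.ball 0 1) := fun z hz =>
    (heq.eventuallyEq_of_mem (Metric.isOpen_ball.mem_nhds hz)).deriv_eq
  obtain ⟨φ, hφ, hφb⟩ := exists_lift_blaschke (a := a) hc ha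
  refine ⟨blaschkeJacobian a, continuous_blaschkeJacobian ha, blaschkeJacobian_pos hn ha,
    fun w => ?_, fun w₀ => exists_sections (continuous_blaschkeJacobian ha)
      (blaschkeJacobian_pos hn ha) hφ (fun θ => ?_) w₀⟩
  · rw [radialLimit_eq_of_eqOn hder (continuousAt_deriv_blaschke ha (Circle.norm_coe w).le)]
    have h1 := congrArg norm (mul_deriv_blaschke hc ha w)
    rwa [norm_mul, norm_mul, Circle.norm_coe, one_mul, norm_blaschke_circle hc ha, mul_one,
      Complex.norm_real, Real.norm_of_nonneg (blaschkeJacobian_pos hn ha w).le] at h1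
  · refine Circle.ext ?_
    rw [boundaryMap, hbd, coe_toCircle (norm_blaschke_circle hc ha _), hφb]

end HardyCondExp

end

noncomputable section

namespace HardyCondExp

/-! ### The transfer operator -/

lemma enorm_sum_rpow_le {ι : Type*} (s : Finset ι) (x : ι → ℂ) {p : ℝ} (hp0 : 0 < p)
    (hp1 : p ≤ 1) : ‖∑ i ∈ s, x i‖ₑ ^ p ≤ ∑ i ∈ s, ‖x i‖ₑ ^ p := by
  classical
  induction s using Finset.induction_on with
  | empty => simp [hp0]
  | insert i s hi ih =>
    rw [Finset.sum_insert hi, Finset.sum_insert hi]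
    refine (ENNReal.rpow_le_rpow (enorm_add_le _ _) hp0.le).trans ?_
    exact (ENNReal.rpow_add_le_add_rpow _ _ hp0.le hp1).trans (add_le_add le_rfl ih)

namespace Sections

variable {b : Circle → Circle} {J : Circle → ℝ} (S : Sections b J)

/-- Applied to the indicator of a null set, the change of variables gives a sum of integral zero
whose weights `1 / J` never vanish. Hence composition with a section respects almost everywhere
equality. -/
lemma quasiMeasurePreserving (hJ : Measurable J) (k : Fin S.card) :
    Measure.QuasiMeasurePreserving (S.sec k) circleMeasure circleMeasure := by
  refine ⟨S.measurable_sec k, Measure.AbsolutelyContinuous.mk fun A hA h0 => ?_⟩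
  rw [Measure.map_apply (S.measurable_sec k) hA]
  have h := S.lintegral_eq (A.indicator 1) (measurable_one.indicator hA)
  rw [lintegral_indicator_one hA, h0] at h
  have hm : ∀ k, Measurable fun w => A.indicator (1 : Circle → ℝ≥0∞) (S.sec k w) /
      ENNReal.ofReal (J (S.sec k w)) := fun k =>
    ((measurable_one.indicator hA).comp (S.measurable_sec k)).div
      (ENNReal.measurable_ofReal.comp (hJ.comp (S.measurable_sec k)))
  have h2 := (lintegral_eq_zero_iff (Finset.measurable_fun_sum _ fun k _ => hm k)).1 h.symm
  rw [← nonpos_iff_eq_zero]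
  refine (measure_mono_ae (t := ∅) ?_).trans (by simp)
  filter_upwards [h2] with w hw hwA
  have h3 := (Finset.sum_eq_zero_iff.1 hw) k (Finset.mem_univ k)
  rw [Set.indicator_of_mem hwA, Pi.one_apply, ENNReal.div_eq_zero_iff] at h3
  rcases h3 with h3 | h3
  · exact one_ne_zero h3
  · exact ENNReal.ofReal_ne_top h3

/-- The transfer operator `f ↦ ∑ₖ (f / J) ∘ ζₖ`. -/
def transfer (f : Circle → ℂ) (w : Circle) : ℂ := ∑ k, f (S.sec k w) / (J (S.sec k w) : ℂ)

lemma transfer_add (f g : Circle → ℂ) : S.transfer (f + g) = S.transfer f + S.transfer g := by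
  funext w
  simp [transfer, add_div, Finset.sum_add_distrib]

lemma transfer_sub (f g : Circle → ℂ) : S.transfer (f - g) = S.transfer f - S.transfer g := by
  funext w
  simp [transfer, sub_div, Finset.sum_sub_distrib]

lemma transfer_smul (c : ℂ) (f : Circle → ℂ) : S.transfer (c • f) = c • S.transfer f := by
  funext w
  simp [transfer, Finset.mul_sum, mul_div_assoc]

lemma transfer_congr (hJ : Measurable J) {f g : Circle → ℂ} (h : f =ᵐ[circleMeasure] g) :
    S.transfer f =ᵐ[circleMeasure] S.transfer g := by
  have : ∀ᵐ w ∂circleMeasure, ∀ k, f (S.sec k w) = g (S.sec k w) :=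
    ae_all_iff.2 fun k => (S.quasiMeasurePreserving hJ k).ae_eq_comp h
  filter_upwards [this] with w hw
  simp [transfer, hw]

lemma aestronglyMeasurable_transfer (hJ : Measurable J) {f : Circle → ℂ}
    (hf : AEStronglyMeasurable f circleMeasure) :
    AEStronglyMeasurable (S.transfer f) circleMeasure := by
  refine Finset.aestronglyMeasurable_fun_sum _ fun k _ => ?_
  simp only [div_eq_mul_inv]
  exact (hf.comp_quasiMeasurePreserving (S.quasiMeasurePreserving hJ k)).mul
    (Complex.measurable_ofReal.comp (hJ.comp (S.measurable_sec k))).inv.aestronglyMeasurable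

lemma lintegral_eq_of_aemeasurable (hJ : Measurable J) {F : Circle → ℝ≥0∞}
    (hF : AEMeasurable F circleMeasure) : ∫⁻ w, F w ∂circleMeasure =
    ∫⁻ w, ∑ k, F (S.sec k w) / ENNReal.ofReal (J (S.sec k w)) ∂circleMeasure := by
  obtain ⟨G, hG, hFG⟩ := hF
  rw [lintegral_congr_ae hFG, S.lintegral_eq G hG]
  have : ∀ᵐ w ∂circleMeasure, ∀ k, F (S.sec k w) = G (S.sec k w) :=
    ae_all_iff.2 fun k => (S.quasiMeasurePreserving hJ k).ae_eq_comp hFG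
  refine lintegral_congr_ae ?_
  filter_upwards [this] with w hw
  simp [hw]

/-- One factor `1 / J` is split off for the change of variables; the weight `J^(1-p)` is what
remains. -/
lemma enorm_div_rpow (hJ0 : ∀ w, 0 < J w) (x : ℂ) (w : Circle) {p : ℝ} (hp0 : 0 < p) :
    ‖x / (J w : ℂ)‖ₑ ^ p =
      ‖x‖ₑ ^ p * ENNReal.ofReal (J w) ^ (1 - p) / ENNReal.ofReal (J w) := by
  have h0 : ENNReal.ofReal (J w) ≠ 0 := by simpa using hJ0 w
  have hne : (J w : ℂ) ≠ 0 := by exact_mod_cast (hJ0 w).ne'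
  have hn : ‖(J w : ℂ)‖ₑ = ENNReal.ofReal (J w) := by
    rw [← ofReal_norm, Complex.norm_real, Real.norm_of_nonneg (hJ0 w).le]
  rw [div_eq_mul_inv, enorm_mul, enorm_inv hne, hn, ENNReal.mul_rpow_of_nonneg _ _ hp0.le,
    mul_div_assoc]
  congr 1
  rw [ENNReal.inv_rpow, ← ENNReal.rpow_neg, ENNReal.div_eq_inv_mul, ← ENNReal.rpow_neg_one,
    ← ENNReal.rpow_add _ _ h0 ENNReal.ofReal_ne_top]
  ring_nf

lemma aemeasurable_weight (hJ : Measurable J) {f : Circle → ℂ}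
    (hf : AEStronglyMeasurable f circleMeasure) (p : ℝ) :
    AEMeasurable (fun w => ‖f w‖ₑ ^ p * ENNReal.ofReal (J w) ^ (1 - p)) circleMeasure :=
  (hf.enorm.pow_const p).mul
    ((ENNReal.measurable_ofReal.comp hJ).pow_const (1 - p)).aemeasurable

lemma lintegral_transfer_le (hJ : Measurable J) (hJ0 : ∀ w, 0 < J w) {f : Circle → ℂ}
    (hf : AEStronglyMeasurable f circleMeasure) {p : ℝ} (hp0 : 0 < p) (hp1 : p ≤ 1) :
    ∫⁻ w, ‖S.transfer f w‖ₑ ^ p ∂circleMeasure ≤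
      ∫⁻ w, ‖f w‖ₑ ^ p * ENNReal.ofReal (J w) ^ (1 - p) ∂circleMeasure := by
  rw [S.lintegral_eq_of_aemeasurable hJ (aemeasurable_weight hJ hf p)]
  refine lintegral_mono fun w => ?_
  refine (enorm_sum_rpow_le _ _ hp0 hp1).trans_eq (Finset.sum_congr rfl fun k _ => ?_)
  exact enorm_div_rpow hJ0 _ _ hp0

/-- Equality holds for functions that live on the image of a single section. -/
lemma lintegral_transfer_eq (hJ : Measurable J) (hJ0 : ∀ w, 0 < J w) {f : Circle → ℂ}
    (hf : AEStronglyMeasurable f circleMeasure) {k₀ : Fin S.card}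
    (hk : ∀ k, k ≠ k₀ → ∀ w, f (S.sec k w) = 0) {p : ℝ} (hp0 : 0 < p) :
    ∫⁻ w, ‖S.transfer f w‖ₑ ^ p ∂circleMeasure =
      ∫⁻ w, ‖f w‖ₑ ^ p * ENNReal.ofReal (J w) ^ (1 - p) ∂circleMeasure := by
  rw [S.lintegral_eq_of_aemeasurable hJ (aemeasurable_weight hJ hf p)]
  refine lintegral_congr fun w => ?_
  rw [transfer, Finset.sum_eq_single k₀ (fun k _ h => by simp [hk k h w]) (by simp),
    Finset.sum_eq_single k₀ (fun k _ h => by simp [hk k h w, hp0]) (by simp)]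
  exact enorm_div_rpow hJ0 _ _ hp0

lemma lintegral_weight_le (hJ0 : ∀ w, 0 < J w) {M : ℝ} (hM : ∀ w, J w ≤ M) (f : Circle → ℂ)
    {p : ℝ} (hp1 : p ≤ 1) :
    ∫⁻ w, ‖f w‖ₑ ^ p * ENNReal.ofReal (J w) ^ (1 - p) ∂circleMeasure ≤
      ENNReal.ofReal (M ^ (1 - p)) * ∫⁻ w, ‖f w‖ₑ ^ p ∂circleMeasure := by
  rw [← lintegral_const_mul' _ _ ENNReal.ofReal_ne_top]
  refine lintegral_mono fun w => ?_
  rw [mul_comm]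
  refine mul_le_mul' ?_ le_rfl
  rw [← ENNReal.ofReal_rpow_of_nonneg ((hJ0 w).le.trans (hM w)) (by linarith)]
  exact ENNReal.rpow_le_rpow (ENNReal.ofReal_le_ofReal (hM w)) (by linarith)

lemma integrable_transfer (hJ : Measurable J) (hJ0 : ∀ w, 0 < J w) {f : Circle → ℂ}
    (hf : Integrable f circleMeasure) : Integrable (S.transfer f) circleMeasure := by
  refine ⟨S.aestronglyMeasurable_transfer hJ hf.aestronglyMeasurable, ?_⟩
  have := S.lintegral_transfer_le hJ hJ0 hf.aestronglyMeasurable one_pos le_rfl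
  simp only [ENNReal.rpow_one, sub_self, ENNReal.rpow_zero, mul_one] at this
  exact this.trans_lt hf.2

/-- The change of variables as an identity of measures, so that it also applies to complex
integrands. -/
lemma measure_eq_sum (hJ : Measurable J) : circleMeasure = ∑ k, (circleMeasure.withDensity
    fun w => (ENNReal.ofReal (J (S.sec k w)))⁻¹).map (S.sec k) := by
  ext A hA
  rw [← lintegral_indicator_one hA, S.lintegral_eq _ (measurable_one.indicator hA),
    lintegral_finsetSum (f := fun k w => A.indicator (1 : Circle → ℝ≥0∞) (S.sec k w) /
      ENNReal.ofReal (J (S.sec k w))) _ fun k _ =>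
      ((measurable_one.indicator hA).comp (S.measurable_sec k)).div
        (ENNReal.measurable_ofReal.comp (hJ.comp (S.measurable_sec k))),
    Measure.finsetSum_apply]
  refine Finset.sum_congr rfl fun k _ => ?_
  rw [Measure.map_apply (S.measurable_sec k) hA,
    withDensity_apply _ (S.measurable_sec k hA), ← lintegral_indicator (S.measurable_sec k hA)]
  refine lintegral_congr fun w => ?_
  by_cases hw : S.sec k w ∈ A <;> simp [hw, Set.indicator]

lemma integral_transfer (hJ : Measurable J) (hJ0 : ∀ w, 0 < J w) {f : Circle → ℂ}
    (hf : Integrable f circleMeasure) :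
    ∫ w, S.transfer f w ∂circleMeasure = ∫ w, f w ∂circleMeasure := by
  have hsum := S.measure_eq_sum hJ
  set μ : Fin S.card → Measure Circle := fun k => (circleMeasure.withDensity
    fun w => (ENNReal.ofReal (J (S.sec k w)))⁻¹).map (S.sec k) with hμ
  have hle : ∀ k, μ k ≤ circleMeasure := fun k => by
    conv_rhs => rw [hsum]
    exact Finset.single_le_sum (f := μ) (fun _ _ => Measure.zero_le _) (Finset.mem_univ k)
  have hint : ∀ k, Integrable f (μ k) := fun k => hf.mono_measure (hle k)
  have hmd : ∀ k, Measurable fun w => (ENNReal.ofReal (J (S.sec k w)))⁻¹ := fun k =>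
    (ENNReal.measurable_ofReal.comp (hJ.comp (S.measurable_sec k))).inv
  have hlt : ∀ k, ∀ᵐ w ∂circleMeasure, (ENNReal.ofReal (J (S.sec k w)))⁻¹ < ⊤ := fun k =>
    ae_of_all _ fun w => by simpa using hJ0 _
  have hval : ∀ k w, (((ENNReal.ofReal (J (S.sec k w)))⁻¹).toReal • f (S.sec k w) : ℂ) =
      f (S.sec k w) / (J (S.sec k w) : ℂ) := fun k w => by
    rw [ENNReal.toReal_inv, ENNReal.toReal_ofReal (hJ0 _).le, Complex.real_smul]
    push_cast
    rw [div_eq_mul_inv, mul_comm]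
  have hterm : ∀ k, Integrable (fun w => f (S.sec k w) / (J (S.sec k w) : ℂ)) circleMeasure := by
    intro k
    have h1 := (hint k).comp_measurable (S.measurable_sec k)
    rw [integrable_withDensity_iff_integrable_smul' (hmd k) (hlt k)] at h1
    simpa only [Function.comp_apply, hval] using h1
  have h2 : ∫ w, f w ∂circleMeasure = ∑ k, ∫ w, f w ∂(μ k) := by
    conv_lhs => rw [hsum]
    exact integral_finsetSum_measure fun k _ => hint k
  rw [h2]
  simp only [transfer]
  rw [integral_finsetSum _ fun k _ => hterm k]
  refine Finset.sum_congr rfl fun k _ => ?_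
  rw [hμ, integral_map (S.measurable_sec k).aemeasurable (hint k).aestronglyMeasurable,
    integral_withDensity_eq_integral_toReal_smul (hmd k) (hlt k)]
  simp only [hval]

end Sections

variable {η : ℂ → ℂ} {J : Circle → ℝ}

/-- Since `b ∘ ζₖ = id`, transferring `f · (Φ ∘ b)` gives `Φ` times the transfer of `f`, and
transferring preserves integrals. -/
lemma Sections.represents (S : Sections (boundaryMap η) J) (hη : IsInner η) (hJ : Measurable J)
    (hJ0 : ∀ w, 0 < J w) {f : Circle → ℂ} (hf : Integrable f circleMeasure) :
    Represents η f (S.transfer f) := by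
  refine ⟨hf, S.integrable_transfer hJ hJ0 hf, fun Φ => ?_⟩
  rw [← S.integral_transfer hJ hJ0 (integrable_mul_comp hf hη.measurable_boundaryMap Φ)]
  refine integral_congr_ae (ae_of_all _ fun w => ?_)
  simp only [Sections.transfer, S.map_sec, Finset.sum_mul]
  exact Finset.sum_congr rfl fun k _ => by ring

/-! ### The conditional expectation operator -/

section Operator

variable (S : Sections (boundaryMap η) J) (hη : IsInner η) (hη0 : η 0 = 0) (hJ : Continuous J)
  (hJ0 : ∀ w, 0 < J w) {M : ℝ} (hM : ∀ w, J w ≤ M) {p : ℝ} (hp0 : 0 < p) (hp1 : p < 1)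

include hη hη0 hJ hJ0 hM hp0 hp1

lemma eLpNorm_transfer_comp_le {f : Circle → ℂ} (hf : AEStronglyMeasurable f circleMeasure) :
    eLpNorm (fun w => S.transfer f (boundaryMap η w)) (ENNReal.ofReal p) circleMeasure ≤
      ENNReal.ofReal (M ^ (1 / p - 1)) * eLpNorm f (ENNReal.ofReal p) circleMeasure := by
  have hM0 : 0 ≤ M := (hJ0 1).le.trans (hM 1)
  have h1 := eLpNorm_comp_measurePreserving (p := ENNReal.ofReal p)
    (S.aestronglyMeasurable_transfer hJ.measurable hf) (hη.measurePreserving hη0)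
  have h2 : eLpNorm (fun w => S.transfer f (boundaryMap η w)) (ENNReal.ofReal p) circleMeasure =
      eLpNorm (S.transfer f) (ENNReal.ofReal p) circleMeasure := h1
  rw [h2, ← ENNReal.rpow_le_rpow_iff hp0, ENNReal.mul_rpow_of_nonneg _ _ hp0.le,
    eLpNorm_ofReal_rpow hp0, eLpNorm_ofReal_rpow hp0,
    ENNReal.ofReal_rpow_of_nonneg (Real.rpow_nonneg hM0 _) hp0.le, ← Real.rpow_mul hM0]
  have hexp : (1 / p - 1) * p = 1 - p := by field_simp
  rw [hexp]
  exact (S.lintegral_transfer_le hJ.measurable hJ0 hf hp0 hp1.le).trans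
    (Sections.lintegral_weight_le hJ0 hM f hp1.le)

lemma memLp_transfer_comp {f : Circle → ℂ} (hf : MemLp f (ENNReal.ofReal p) circleMeasure) :
    MemLp (fun w => S.transfer f (boundaryMap η w)) (ENNReal.ofReal p) circleMeasure :=
  ⟨(S.aestronglyMeasurable_transfer hJ.measurable hf.1).comp_quasiMeasurePreserving
    (hη.measurePreserving hη0).quasiMeasurePreserving,
    (eLpNorm_transfer_comp_le S hη hη0 hJ hJ0 hM hp0 hp1 hf.1).trans_lt
      (ENNReal.mul_lt_top ENNReal.ofReal_lt_top hf.2)⟩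

omit hJ0 hM hp0 hp1 in
lemma transfer_comp_congr {f g : Circle → ℂ} (h : f =ᵐ[circleMeasure] g) :
    (fun w => S.transfer f (boundaryMap η w)) =ᵐ[circleMeasure]
      fun w => S.transfer g (boundaryMap η w) :=
  (hη.measurePreserving hη0).quasiMeasurePreserving.ae_eq_comp
    (S.transfer_congr hJ.measurable h)

/-- The extension of the conditional expectation to `L^p`. -/
def condOp : Lp ℂ (ENNReal.ofReal p) circleMeasure →ₗ[ℂ] Lp ℂ (ENNReal.ofReal p) circleMeasure where
  toFun f := (memLp_transfer_comp S hη hη0 hJ hJ0 hM hp0 hp1 (Lp.memLp f)).toLp _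
  map_add' f g := by
    rw [← MemLp.toLp_add]
    refine MemLp.toLp_congr _ _ ((transfer_comp_congr S hη hη0 hJ (Lp.coeFn_add f g)).trans ?_)
    rw [S.transfer_add]
    rfl
  map_smul' c f := by
    rw [RingHom.id_apply, ← MemLp.toLp_const_smul]
    refine MemLp.toLp_congr _ _ ((transfer_comp_congr S hη hη0 hJ (Lp.coeFn_smul c f)).trans ?_)
    rw [S.transfer_smul]
    rfl

lemma coeFn_condOp (f : Lp ℂ (ENNReal.ofReal p) circleMeasure) :
    condOp S hη hη0 hJ hJ0 hM hp0 hp1 f =ᵐ[circleMeasure]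
      fun w => S.transfer f (boundaryMap η w) :=
  MemLp.coeFn_toLp (memLp_transfer_comp S hη hη0 hJ hJ0 hM hp0 hp1 (Lp.memLp f))

lemma norm_condOp_le (f : Lp ℂ (ENNReal.ofReal p) circleMeasure) :
    ‖condOp S hη hη0 hJ hJ0 hM hp0 hp1 f‖ ≤ M ^ (1 / p - 1) * ‖f‖ := by
  have hM0 : 0 ≤ M := (hJ0 1).le.trans (hM 1)
  rw [Lp.norm_def, Lp.norm_def, eLpNorm_congr_ae (coeFn_condOp S hη hη0 hJ hJ0 hM hp0 hp1 f)]
  have h := eLpNorm_transfer_comp_le S hη hη0 hJ hJ0 hM hp0 hp1 (Lp.memLp f).1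
  have h2 := ENNReal.toReal_mono (ENNReal.mul_ne_top ENNReal.ofReal_ne_top (Lp.eLpNorm_ne_top f)) h
  rwa [ENNReal.toReal_mul, ENNReal.toReal_ofReal (Real.rpow_nonneg hM0 _)] at h2

/-- The operator sends a polynomial to a polynomial in `η`, which is a bounded boundary function and
so lies in `H^p`; the norm bound carries this over to limits of polynomials. -/
lemma condOp_mem_hardy (f : Lp ℂ (ENNReal.ofReal p) circleMeasure)
    (hf : f ∈ hardy (ENNReal.ofReal p)) :
    condOp S hη hη0 hJ hJ0 hM hp0 hp1 f ∈ hardy (ENNReal.ofReal p) := by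
  rw [mem_hardy_iff] at hf ⊢
  have hM0 : 0 < M := (hJ0 1).trans_le (hM 1)
  have hP0 : ENNReal.ofReal p ≠ 0 := by simpa using hp0
  refine PolyApprox.of_approx (Lp.aestronglyMeasurable _) fun ε hε => ?_
  have hC0 : ENNReal.ofReal (M ^ (1 / p - 1)) ≠ 0 := by
    simpa using Real.rpow_pos_of_pos hM0 _
  obtain ⟨q, hq⟩ := hf (ε / ENNReal.ofReal (M ^ (1 / p - 1)))
    (ENNReal.div_pos hε.ne' ENNReal.ofReal_ne_top)
  obtain ⟨Q, hQ⟩ := hη.exists_represents_polynomial hη0 q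
  have hbd := hη.hasBoundary.polynomial Q
  refine ⟨fun w => Q.eval (boundaryMap η w : ℂ), hbd.polyApprox hP0 ENNReal.ofReal_ne_top,
    hbd.aestronglyMeasurable, ?_⟩
  -- `Q ∘ b` and the transfer of `q` composed with `b` are versions of the same conditional
  -- expectation.
  have hae := (hQ.condExp_ae_eq hη hη0).symm.trans
    ((S.represents hη hJ.measurable hJ0 (integrable_polynomial q)).condExp_ae_eq hη hη0)
  have hcont : Continuous fun w : Circle => q.eval (w : ℂ) := by fun_prop
  have hbound := eLpNorm_transfer_comp_le S hη hη0 hJ hJ0 hM hp0 hp1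
    ((Lp.aestronglyMeasurable f).sub hcont.aestronglyMeasurable)
  rw [S.transfer_sub] at hbound
  have heq : (fun w => condOp S hη hη0 hJ hJ0 hM hp0 hp1 f w - Q.eval (boundaryMap η w : ℂ))
      =ᵐ[circleMeasure] fun w => (S.transfer f - S.transfer fun w => q.eval (w : ℂ))
        (boundaryMap η w) := by
    filter_upwards [coeFn_condOp S hη hη0 hJ hJ0 hM hp0 hp1 f, hae] with w h1 h2
    simp only [Pi.sub_apply]
    rw [h1, h2]
  rw [eLpNorm_congr_ae heq]
  refine hbound.trans ((mul_le_mul' le_rfl hq.le).trans_eq ?_)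
  exact ENNReal.mul_div_cancel hC0 ENNReal.ofReal_ne_top

lemma isBoundedCondExp_condOp {X : Submodule ℂ (Lp ℂ (ENNReal.ofReal p) circleMeasure)}
    (hX : ∀ f ∈ X, condOp S hη hη0 hJ hJ0 hM hp0 hp1 f ∈ X) :
    IsBoundedCondExp η X ((condOp S hη hη0 hJ hJ0 hM hp0 hp1).restrict hX) := by
  refine ⟨⟨M ^ (1 / p - 1), fun f => norm_condOp_le S hη hη0 hJ hJ0 hM hp0 hp1 f⟩, fun f hf => ?_⟩
  exact (coeFn_condOp S hη hη0 hJ hJ0 hM hp0 hp1 f).trans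
    ((S.represents hη hJ.measurable hJ0 hf).condExp_ae_eq hη hη0).symm

end Operator

end HardyCondExp

end

noncomputable section

namespace HardyCondExp

/-! ### Polynomials that concentrate at a point -/

lemma norm_one_add_div_two_lt {u : ℂ} (hu : ‖u‖ = 1) (h : u ≠ 1) : ‖(1 + u) / 2‖ < 1 := by
  have h1 := parallelogram_law_with_norm ℝ (1 : ℂ) u
  have h2 : 0 < ‖1 - u‖ := norm_pos_iff.2 (sub_ne_zero.2 h.symm)
  rw [hu, norm_one] at h1
  rw [norm_div, Complex.norm_two]
  nlinarith [norm_nonneg (1 + u)]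

/-- There are polynomials whose mass near `w₀` dominates their mass elsewhere. -/
lemma exists_polynomial_concentrated {w₀ : Circle} {V : Set Circle} (hV : IsOpen V) (hw : w₀ ∈ V)
    {p τ : ℝ} (hp : 0 < p) (hτ : 0 < τ) : ∃ q : Polynomial ℂ,
      ∫⁻ w in Vᶜ, ‖q.eval (w : ℂ)‖ₑ ^ p ∂circleMeasure ≤
        ENNReal.ofReal τ * ∫⁻ w in V, ‖q.eval (w : ℂ)‖ₑ ^ p ∂circleMeasure ∧
      ∫⁻ w in V, ‖q.eval (w : ℂ)‖ₑ ^ p ∂circleMeasure ≠ 0 := by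
  -- The modulus of `(1 + conj w₀ · w) / 2` equals `1` at `w₀` only. High powers of this polynomial
  -- concentrate there.
  let x : Circle → ℝ := fun w => ‖(1 + ((w₀⁻¹ * w : Circle) : ℂ)) / 2‖
  have hx : Continuous x := by fun_prop
  have hx0 : x w₀ = 1 := by simp only [x, inv_mul_cancel, Circle.coe_one]; norm_num
  have hx1 : ∀ w, w ≠ w₀ → x w < 1 := fun w hne =>
    norm_one_add_div_two_lt (Circle.norm_coe _) fun h => hne <| by
      have h2 : w₀⁻¹ * w = 1 := Circle.ext (by simpa using h)
      exact (inv_mul_eq_one.1 h2).symm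
  -- `ρ` bounds `x` off `V`, by compactness; the value `1/2` handles an empty complement and keeps
  -- `ρ` positive.
  obtain ⟨ρ, hρ0, hρ1, hρ⟩ : ∃ ρ, 0 < ρ ∧ ρ < 1 ∧ ∀ w ∈ Vᶜ, x w ≤ ρ := by
    rcases (Vᶜ).eq_empty_or_nonempty with he | hne
    · exact ⟨1 / 2, by norm_num, by norm_num, by simp [he]⟩
    · obtain ⟨w₁, hw₁, hmax⟩ := hV.isClosed_compl.isCompact.exists_isMaxOn hne hx.continuousOn
      refine ⟨max (x w₁) (1 / 2), by positivity, max_lt (hx1 _ ?_) (by norm_num),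
        fun w h => (hmax h).trans (le_max_left _ _)⟩
      rintro rfl
      exact hw₁ hw
  obtain ⟨σ, hρσ, hσ1⟩ := exists_between hρ1
  have hσ0 : 0 < σ := hρ0.trans hρσ
  let W : Set Circle := V ∩ {w | σ < x w}
  have hW : IsOpen W := hV.inter (isOpen_lt continuous_const hx)
  have hWpos : circleMeasure W ≠ 0 := (hW.measure_pos _ ⟨w₀, hw, by simpa [hx0] using hσ1⟩).ne'
  have hc : 0 < (circleMeasure W).toReal := ENNReal.toReal_pos hWpos (measure_ne_top _ _)
  -- The mass off `V` is at most `ρ^(pn)`, the mass on `V` at least `σ^(pn) m(W)`, so this `n` gives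
  -- the ratio `τ`.
  obtain ⟨n, hn⟩ := exists_pow_lt_of_lt_one (mul_pos hτ hc)
    (Real.rpow_lt_one (div_nonneg hρ0.le hσ0.le) ((div_lt_one hσ0).2 hρσ) hp)
  let q : Polynomial ℂ := (Polynomial.C (1 / 2) *
    (1 + Polynomial.C ((w₀⁻¹ : Circle) : ℂ) * Polynomial.X)) ^ n
  have hq : ∀ w : Circle, ‖q.eval (w : ℂ)‖ₑ ^ p = ENNReal.ofReal ((x w ^ p) ^ n) := fun w => by
    have : q.eval (w : ℂ) = ((1 + ((w₀⁻¹ * w : Circle) : ℂ)) / 2) ^ n := by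
      simp only [q, Polynomial.eval_pow, Polynomial.eval_mul, Polynomial.eval_C,
        Polynomial.eval_add, Polynomial.eval_one, Polynomial.eval_X, Circle.coe_mul]
      ring
    rw [this, ← ofReal_norm, norm_pow,
      ENNReal.ofReal_rpow_of_nonneg (pow_nonneg (norm_nonneg _) _) hp.le,
      ← Real.rpow_natCast, ← Real.rpow_mul (norm_nonneg _), mul_comm (n : ℝ),
      Real.rpow_mul (norm_nonneg _), Real.rpow_natCast]
  have hupper : ∫⁻ w in Vᶜ, ‖q.eval (w : ℂ)‖ₑ ^ p ∂circleMeasure ≤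
      ENNReal.ofReal ((ρ ^ p) ^ n) := by
    calc ∫⁻ w in Vᶜ, ‖q.eval (w : ℂ)‖ₑ ^ p ∂circleMeasure
        ≤ ∫⁻ w in Vᶜ, ENNReal.ofReal ((ρ ^ p) ^ n) ∂circleMeasure := by
          refine setLIntegral_mono measurable_const fun w h => ?_
          rw [hq]
          have : 0 ≤ x w := norm_nonneg _
          have := hρ w h
          gcongr
      _ ≤ ENNReal.ofReal ((ρ ^ p) ^ n) := by
          rw [setLIntegral_const]
          exact mul_le_of_le_one_right' prob_le_one
  have hlower : ENNReal.ofReal ((σ ^ p) ^ n * (circleMeasure W).toReal) ≤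
      ∫⁻ w in V, ‖q.eval (w : ℂ)‖ₑ ^ p ∂circleMeasure := by
    calc ENNReal.ofReal ((σ ^ p) ^ n * (circleMeasure W).toReal)
        = ∫⁻ w in W, ENNReal.ofReal ((σ ^ p) ^ n) ∂circleMeasure := by
          rw [setLIntegral_const, ENNReal.ofReal_mul (by positivity),
            ENNReal.ofReal_toReal (measure_ne_top _ _)]
      _ ≤ ∫⁻ w in W, ‖q.eval (w : ℂ)‖ₑ ^ p ∂circleMeasure := by
          refine setLIntegral_mono' hW.measurableSet fun w h => ?_
          rw [hq]
          have : σ ≤ x w := le_of_lt h.2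
          gcongr
      _ ≤ ∫⁻ w in V, ‖q.eval (w : ℂ)‖ₑ ^ p ∂circleMeasure :=
          lintegral_mono_set Set.inter_subset_left
  refine ⟨q, hupper.trans (le_trans ?_ (mul_le_mul' le_rfl hlower)), ?_⟩
  · rw [← ENNReal.ofReal_mul hτ.le]
    refine ENNReal.ofReal_le_ofReal ?_
    rw [Real.div_rpow hρ0.le hσ0.le, div_pow, div_lt_iff₀ (by positivity)] at hn
    linarith
  · refine (lt_of_lt_of_le ?_ hlower).ne'
    rw [ENNReal.ofReal_pos]
    positivity

/-! ### The lower bound for the operator norm -/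

/-- Suppose `K < t < J(w₀)^(1-p)`. On a small neighborhood `V` of `w₀` only one section contributes
and the weight exceeds `t`, so the transfer of the part of `q` on `V` has `p`-th power integral at
least `t` times that of `q` on `V`. If `q` concentrates on `V`, the rest is negligible, which
contradicts the bound by `K`. -/
lemma Sections.rpow_le_of_polynomial_bound {b : Circle → Circle} {J : Circle → ℝ}
    (S : Sections b J) (hJ : Continuous J) (hJ0 : ∀ w, 0 < J w) {w₀ : Circle}
    (hM : ∀ w, J w ≤ J w₀) {k₀ : Fin S.card} {U : Set Circle} (hU : U ∈ 𝓝 w₀)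
    (hk : ∀ k, k ≠ k₀ → ∀ w, S.sec k w ∉ U) {p K : ℝ} (hp0 : 0 < p) (hp1 : p < 1) (hK0 : 0 ≤ K)
    (hK : ∀ q : Polynomial ℂ, ∫⁻ w, ‖S.transfer (fun w => q.eval (w : ℂ)) w‖ₑ ^ p ∂circleMeasure ≤
      ENNReal.ofReal K * ∫⁻ w : Circle, ‖q.eval (w : ℂ)‖ₑ ^ p ∂circleMeasure) :
    J w₀ ^ (1 - p) ≤ K := by
  by_contra! hlt
  obtain ⟨t, hKt, htM⟩ := exists_between hlt
  set N := J w₀ ^ (1 - p) with hN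
  have hN0 : 0 < N := Real.rpow_pos_of_pos (hJ0 _) _
  have hJp : Continuous fun w => J w ^ (1 - p) := hJ.rpow_const fun w => Or.inl (hJ0 w).ne'
  let V : Set Circle := interior U ∩ {w | t < J w ^ (1 - p)}
  have hV : IsOpen V := isOpen_interior.inter (isOpen_lt continuous_const hJp)
  have hwV : w₀ ∈ V := ⟨mem_interior_iff_mem_nhds.2 hU, htM⟩
  -- Chosen so that the total error `(K + N) τ` is half of the gap `t - K`.
  let τ : ℝ := (t - K) / (2 * (K + N))
  have hτ : 0 < τ := div_pos (by linarith) (by linarith)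
  have hτ' : K + (K + N) * τ < t := by
    have : (K + N) * τ = (t - K) / 2 := by
      simp only [τ]
      field_simp
    linarith
  obtain ⟨q, hq1, hq2⟩ := exists_polynomial_concentrated hV hwV hp0 hτ
  let f : Circle → ℂ := fun w => q.eval (w : ℂ)
  have hf : Continuous f := by fun_prop
  have hVm : MeasurableSet V := hV.measurableSet
  set A := ∫⁻ w in V, ‖q.eval (w : ℂ)‖ₑ ^ p ∂circleMeasure with hA
  set B := ∫⁻ w in Vᶜ, ‖q.eval (w : ℂ)‖ₑ ^ p ∂circleMeasure with hB
  have hAB : ∫⁻ w : Circle, ‖q.eval (w : ℂ)‖ₑ ^ p ∂circleMeasure = A + B :=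
    (lintegral_add_compl _ hVm).symm
  have hAtop : A ≠ ⊤ := by
    refine ne_top_of_le_ne_top ?_ (setLIntegral_le_lintegral V _)
    have h := ((HasBoundary.id.polynomial q).memLp (ENNReal.ofReal p)).2
    rw [← eLpNorm_ofReal_rpow hp0]
    exact ENNReal.rpow_ne_top_of_nonneg hp0.le h.ne
  have hind : ∀ (E : Set Circle), MeasurableSet E →
      ∫⁻ w, ‖E.indicator f w‖ₑ ^ p ∂circleMeasure = ∫⁻ w in E, ‖f w‖ₑ ^ p ∂circleMeasure := by
    intro E hE
    rw [← lintegral_indicator hE]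
    refine lintegral_congr fun w => ?_
    by_cases h : w ∈ E <;> simp [h, hp0]
  have hmeas : ∀ E : Set Circle, MeasurableSet E →
      AEStronglyMeasurable (E.indicator f) circleMeasure := fun E hE =>
    hf.aestronglyMeasurable.indicator hE
  have hlow : ENNReal.ofReal t * A ≤ ∫⁻ w, ‖S.transfer (V.indicator f) w‖ₑ ^ p ∂circleMeasure := by
    rw [S.lintegral_transfer_eq hJ.measurable hJ0 (hmeas V hVm) (k₀ := k₀) (fun k hne w =>
      Set.indicator_of_notMem (fun h => hk k hne w (interior_subset h.1)) _) hp0, hA,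
      ← lintegral_const_mul' _ _ ENNReal.ofReal_ne_top, ← lintegral_indicator hVm]
    refine lintegral_mono fun w => ?_
    by_cases h : w ∈ V
    · rw [Set.indicator_of_mem h, Set.indicator_of_mem h, mul_comm]
      refine mul_le_mul' le_rfl ?_
      rw [ENNReal.ofReal_rpow_of_pos (hJ0 w)]
      exact ENNReal.ofReal_le_ofReal h.2.le
    · simp [h]
  have hcompl : ∫⁻ w, ‖S.transfer (Vᶜ.indicator f) w‖ₑ ^ p ∂circleMeasure ≤
      ENNReal.ofReal N * B := by
    refine (S.lintegral_transfer_le hJ.measurable hJ0 (hmeas _ hVm.compl) hp0 hp1.le).trans ?_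
    refine (Sections.lintegral_weight_le hJ0 hM _ hp1.le).trans_eq ?_
    rw [hind _ hVm.compl]
  have htri : ∫⁻ w, ‖S.transfer (V.indicator f) w‖ₑ ^ p ∂circleMeasure ≤
      ∫⁻ w, ‖S.transfer f w‖ₑ ^ p ∂circleMeasure +
        ∫⁻ w, ‖S.transfer (Vᶜ.indicator f) w‖ₑ ^ p ∂circleMeasure := by
    have hsplit : V.indicator f = f - Vᶜ.indicator f := by
      rw [eq_sub_iff_add_eq, Set.indicator_self_add_compl]
    rw [hsplit, S.transfer_sub, ← lintegral_add_left'
      ((S.aestronglyMeasurable_transfer hJ.measurable hf.aestronglyMeasurable).enorm.pow_const p)]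
    refine lintegral_mono fun w => ?_
    exact (ENNReal.rpow_le_rpow enorm_sub_le hp0.le).trans
      (ENNReal.rpow_add_le_add_rpow _ _ hp0.le hp1.le)
  have hfin : ENNReal.ofReal t * A ≤ ENNReal.ofReal (K + (K + N) * τ) * A := by
    calc ENNReal.ofReal t * A ≤ ENNReal.ofReal K * (A + B) + ENNReal.ofReal N * B :=
          hlow.trans (htri.trans (add_le_add ((hK q).trans_eq (by rw [hAB])) hcompl))
      _ = ENNReal.ofReal K * A + (ENNReal.ofReal K + ENNReal.ofReal N) * B := by ring
      _ ≤ ENNReal.ofReal K * A + (ENNReal.ofReal K + ENNReal.ofReal N) *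
          (ENNReal.ofReal τ * A) := by gcongr
      _ = ENNReal.ofReal (K + (K + N) * τ) * A := by
          rw [ENNReal.ofReal_add hK0 (by positivity), ENNReal.ofReal_mul (by positivity),
            ENNReal.ofReal_add hK0 hN0.le]
          ring
  rw [ENNReal.mul_le_mul_iff_left hq2 hAtop, ENNReal.ofReal_le_ofReal_iff (by positivity)] at hfin
  linarith

/-! ### The operator norm -/

section OpNorm

variable {p : ℝ≥0∞} {X : Submodule ℂ (Lp ℂ p circleMeasure)} {T : X →ₗ[ℂ] X}

lemma opNorm_nonneg (T : X →ₗ[ℂ] X) : 0 ≤ opNorm T := by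
  refine Real.sSup_nonneg ?_
  rintro r ⟨f, -, rfl⟩
  exact ENNReal.toReal_nonneg

lemma opNorm_le {C : ℝ} (hC0 : 0 ≤ C) (hC : ∀ f : X, ‖(T f : Lp ℂ p circleMeasure)‖ ≤
    C * ‖(f : Lp ℂ p circleMeasure)‖) : opNorm T ≤ C := by
  refine Real.sSup_le ?_ hC0
  rintro r ⟨f, hf, rfl⟩
  simpa [hf] using hC f

lemma norm_const_smul_Lp (c : ℂ) (f : Lp ℂ p circleMeasure) : ‖c • f‖ = ‖c‖ * ‖f‖ := by
  rw [Lp.norm_def, Lp.norm_def, eLpNorm_congr_ae (Lp.coeFn_smul c f), eLpNorm_const_smul,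
    ENNReal.toReal_mul, toReal_enorm]

/-- Homogeneity suffices, so no triangle inequality is needed. Boundedness enters because the real
supremum of an unbounded set is the default value `0`. -/
lemma IsBoundedCondExp.norm_le_opNorm {η : ℂ → ℂ} (hT : IsBoundedCondExp η X T) (f : X) :
    ‖(T f : Lp ℂ p circleMeasure)‖ ≤ opNorm T * ‖(f : Lp ℂ p circleMeasure)‖ := by
  obtain ⟨C, hC⟩ := hT.1
  by_cases h0 : ‖(f : Lp ℂ p circleMeasure)‖ = 0
  · have := hC f
    rwa [h0, mul_zero] at this ⊢
  have hpos : 0 < ‖(f : Lp ℂ p circleMeasure)‖ :=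
    lt_of_le_of_ne ENNReal.toReal_nonneg (Ne.symm h0)
  have hn : ‖((‖(f : Lp ℂ p circleMeasure)‖⁻¹ : ℝ) : ℂ)‖ = ‖(f : Lp ℂ p circleMeasure)‖⁻¹ := by
    rw [Complex.norm_real, Real.norm_of_nonneg (inv_nonneg.2 hpos.le)]
  have hle : ‖(T (((‖(f : Lp ℂ p circleMeasure)‖⁻¹ : ℝ) : ℂ) • f) : Lp ℂ p circleMeasure)‖ ≤
      opNorm T := by
    refine le_csSup ⟨C, ?_⟩ ⟨_, ?_, rfl⟩
    · rintro r ⟨g, hg, rfl⟩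
      simpa [hg] using hC g
    · rw [Submodule.coe_smul, norm_const_smul_Lp, hn, inv_mul_cancel₀ h0]
  rw [map_smul, Submodule.coe_smul, norm_const_smul_Lp, hn, inv_mul_le_iff₀ hpos] at hle
  rwa [mul_comm]

/-- A bounded extension of the conditional expectation is unique if the integrable functions in
`X` are dense. -/
lemma IsBoundedCondExp.unique {η : ℂ → ℂ} {T' : X →ₗ[ℂ] X} (hT' : IsBoundedCondExp η X T')
    (hT : IsBoundedCondExp η X T) (hp : 0 < p)
    (hd : ∀ f : X, ∀ ε : ℝ≥0∞, 0 < ε → ∃ g : X,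
      Integrable (g : Lp ℂ p circleMeasure) circleMeasure ∧
      eLpNorm ((f - g : X) : Lp ℂ p circleMeasure) p circleMeasure ≤ ε) : T' = T := by
  obtain ⟨C, -, hC⟩ := hT.exists_eLpNorm_le
  obtain ⟨C', -, hC'⟩ := hT'.exists_eLpNorm_le
  ext1 f
  rw [← sub_eq_zero]
  refine Subtype.ext ((Lp.norm_eq_zero_iff hp).1 ?_)
  rw [Lp.norm_def, ENNReal.toReal_eq_zero_iff]
  refine Or.inl ?_
  by_contra hne
  -- This replaces the triangle inequality: two functions of size at most `δ` have a sum smaller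
  -- than the supposedly nonzero size of `T' f - T f`.
  obtain ⟨δ, hδ, H⟩ := exists_Lp_half ℂ circleMeasure p hne
  obtain ⟨g, hg, hfg⟩ := hd f (δ / (ENNReal.ofReal C + ENNReal.ofReal C' + 1))
    (ENNReal.div_pos hδ.ne' (by finiteness))
  have hTg : T g = T' g :=
    Subtype.ext (Lp.ext ((hT.2 g hg).trans (hT'.2 g hg).symm))
  have hsmall : (ENNReal.ofReal C + ENNReal.ofReal C' + 1) *
      eLpNorm ((f - g : X) : Lp ℂ p circleMeasure) p circleMeasure ≤ δ := by
    refine (mul_le_mul' le_rfl hfg).trans ENNReal.mul_div_le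
  have h1 : eLpNorm (T' (f - g) : Lp ℂ p circleMeasure) p circleMeasure ≤ δ := by
    refine (hC' _).trans (le_trans (mul_le_mul' ?_ le_rfl) hsmall)
    exact le_add_right le_add_self
  have h2 : eLpNorm (-(T (f - g) : Lp ℂ p circleMeasure) : Lp ℂ p circleMeasure) p
      circleMeasure ≤ δ := by
    rw [eLpNorm_congr_ae (Lp.coeFn_neg _), eLpNorm_neg]
    refine (hC _).trans (le_trans (mul_le_mul' ?_ le_rfl) hsmall)
    exact le_add_right le_self_add
  have h3 := H _ _ (Lp.aestronglyMeasurable _) (Lp.aestronglyMeasurable _) h1 h2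
  rw [← eLpNorm_congr_ae (Lp.coeFn_add _ _)] at h3
  refine lt_irrefl _ (lt_of_eq_of_lt ?_ h3)
  have : T' f - T f = T' (f - g) + -T (f - g) := by
    rw [map_sub, map_sub, hTg]
    abel
  rw [this]
  rfl

end OpNorm

lemma hardy_dense_integrable {p : ℝ≥0∞} (f : hardy p) (ε : ℝ≥0∞) (hε : 0 < ε) : ∃ g : hardy p,
    Integrable (g : Lp ℂ p circleMeasure) circleMeasure ∧
      eLpNorm ((f - g : hardy p) : Lp ℂ p circleMeasure) p circleMeasure ≤ ε := by
  obtain ⟨q, hq⟩ := f.2 ε hε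
  have hmem := (HasBoundary.id.polynomial q).memLp p
  have hcoe := hmem.coeFn_toLp
  refine ⟨⟨hmem.toLp _, mem_hardy_iff.2 ((polyApprox_polynomial q).congr hcoe.symm)⟩,
    (integrable_polynomial q).congr hcoe.symm, le_of_eq_of_le (eLpNorm_congr_ae ?_) hq.le⟩
  refine (Lp.coeFn_sub _ _).trans ?_
  filter_upwards [hcoe] with w hw
  simp only [Pi.sub_apply]
  rw [hw]

lemma top_dense_integrable {p : ℝ≥0∞} (hp : p ≠ ⊤)
    (f : (⊤ : Submodule ℂ (Lp ℂ p circleMeasure))) (ε : ℝ≥0∞) (hε : 0 < ε) :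
    ∃ g : (⊤ : Submodule ℂ (Lp ℂ p circleMeasure)),
      Integrable (g : Lp ℂ p circleMeasure) circleMeasure ∧
      eLpNorm ((f - g : (⊤ : Submodule ℂ (Lp ℂ p circleMeasure))) : Lp ℂ p circleMeasure) p
        circleMeasure ≤ ε := by
  obtain ⟨s, hs, hmem⟩ := (Lp.memLp (f : Lp ℂ p circleMeasure)).exists_simpleFunc_eLpNorm_sub_lt
    hp hε.ne'
  have hcoe := hmem.coeFn_toLp
  refine ⟨⟨hmem.toLp _, Submodule.mem_top⟩,
    (SimpleFunc.integrable_of_isFiniteMeasure s).congr hcoe.symm,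
    le_of_eq_of_le (eLpNorm_congr_ae ?_) hs.le⟩
  refine (Lp.coeFn_sub _ _).trans ?_
  filter_upwards [hcoe] with w hw
  simp only [Pi.sub_apply]
  rw [hw]

/-- The test functions are polynomials, so any `X` containing `H^p` has the same lower bound. -/
lemma IsBoundedCondExp.rpow_le_opNorm {η : ℂ → ℂ} (hη : IsInner η) (hη0 : η 0 = 0)
    {J : Circle → ℝ} (S : Sections (boundaryMap η) J) (hJ : Continuous J) (hJ0 : ∀ w, 0 < J w)
    {w₀ : Circle} (hM : ∀ w, J w ≤ J w₀) {k₀ : Fin S.card} {U : Set Circle} (hU : U ∈ 𝓝 w₀)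
    (hk : ∀ k, k ≠ k₀ → ∀ w, S.sec k w ∉ U) {p : ℝ} (hp0 : 0 < p) (hp1 : p < 1)
    {X : Submodule ℂ (Lp ℂ (ENNReal.ofReal p) circleMeasure)} {T : X →ₗ[ℂ] X}
    (hT : IsBoundedCondExp η X T) (hX : hardy (ENNReal.ofReal p) ≤ X) :
    J w₀ ^ (1 / p - 1) ≤ opNorm T := by
  have hT0 := opNorm_nonneg T
  suffices h : J w₀ ^ (1 - p) ≤ opNorm T ^ p by
    rw [← Real.rpow_le_rpow_iff (Real.rpow_nonneg (hJ0 _).le _) hT0 hp0,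
      ← Real.rpow_mul (hJ0 _).le]
    convert h using 2
    field_simp
  refine S.rpow_le_of_polynomial_bound hJ hJ0 hM hU hk hp0 hp1 (Real.rpow_nonneg hT0 _)
    fun q => ?_
  have hmem := (HasBoundary.id.polynomial q).memLp (ENNReal.ofReal p)
  have hcoe := hmem.coeFn_toLp
  let x : X := ⟨hmem.toLp _, hX (mem_hardy_iff.2 ((polyApprox_polynomial q).congr hcoe.symm))⟩
  have hx : (x : Lp ℂ (ENNReal.ofReal p) circleMeasure) =ᵐ[circleMeasure]
      fun w : Circle => q.eval (w : ℂ) := hcoe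
  have hR := S.represents hη hJ.measurable hJ0 (integrable_polynomial q)
  have hTx := ((hT.2 x ((integrable_polynomial q).congr hx.symm)).trans
    (condExp_congr_ae hx)).trans (hR.condExp_ae_eq hη hη0)
  have hcomp := eLpNorm_comp_measurePreserving (p := ENNReal.ofReal p)
    hR.integrable_right.aestronglyMeasurable (hη.measurePreserving hη0)
  simp only [Function.comp_def] at hcomp
  have h1 := hT.norm_le_opNorm x
  rw [Lp.norm_def, Lp.norm_def, ← ENNReal.toReal_ofReal hT0, ← ENNReal.toReal_mul,
    ENNReal.toReal_le_toReal (Lp.eLpNorm_ne_top _)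
      (ENNReal.mul_ne_top ENNReal.ofReal_ne_top (Lp.eLpNorm_ne_top _)),
    eLpNorm_congr_ae hx, eLpNorm_congr_ae hTx, hcomp] at h1
  have h2 := ENNReal.rpow_le_rpow h1 hp0.le
  rwa [ENNReal.mul_rpow_of_nonneg _ _ hp0.le, eLpNorm_ofReal_rpow hp0, eLpNorm_ofReal_rpow hp0,
    ENNReal.ofReal_rpow_of_nonneg hT0 hp0.le] at h2

/-- A single operator on `L^p` is restricted to each invariant `X`, which treats `H^p` and `L^p`
together. The sections are adapted to a maximum point `w₀` of `J`, where the upper and lower bounds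
meet. -/
theorem IsFiniteBlaschke.exists_condExp {η : ℂ → ℂ} (hB : IsFiniteBlaschke η) (hη : IsInner η)
    (hη0 : η 0 = 0) {p : ℝ} (hp0 : 0 < p) (hp1 : p < 1) :
    ∃ L : Lp ℂ (ENNReal.ofReal p) circleMeasure →ₗ[ℂ] Lp ℂ (ENNReal.ofReal p) circleMeasure,
      (∀ f ∈ hardy (ENNReal.ofReal p), L f ∈ hardy (ENNReal.ofReal p)) ∧
      ∀ (X : Submodule ℂ (Lp ℂ (ENNReal.ofReal p) circleMeasure)) (hX : ∀ f ∈ X, L f ∈ X),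
        IsBoundedCondExp η X (L.restrict hX) ∧ (hardy (ENNReal.ofReal p) ≤ X →
          opNorm (L.restrict hX) = derivSup η ^ (1 / p - 1)) := by
  obtain ⟨J, hJ, hJ0, hJη, hS⟩ := hB.exists_jacobian hη0
  obtain ⟨w₀, -, hmax⟩ := isCompact_univ.exists_isMaxOn Set.univ_nonempty hJ.continuousOn
  have hM : ∀ w, J w ≤ J w₀ := fun w => hmax (Set.mem_univ w)
  obtain ⟨S, k₀, U, hU, hk⟩ := hS w₀
  have hsup : derivSup η = J w₀ := by
    simp only [derivSup, hJη]
    exact le_antisymm (ciSup_le hM) (le_ciSup (f := J) ⟨J w₀, Set.forall_mem_range.2 hM⟩ w₀)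
  refine ⟨condOp S hη hη0 hJ hJ0 hM hp0 hp1, condOp_mem_hardy S hη hη0 hJ hJ0 hM hp0 hp1,
    fun X hX => ?_⟩
  have hbdd := isBoundedCondExp_condOp S hη hη0 hJ hJ0 hM hp0 hp1 hX
  refine ⟨hbdd, fun hle => ?_⟩
  rw [hsup]
  refine le_antisymm (opNorm_le (Real.rpow_nonneg (hJ0 _).le _) fun f => ?_)
    (hbdd.rpow_le_opNorm hη hη0 S hJ hJ0 hM hU hk hp0 hp1 hle)
  exact norm_condOp_le S hη hη0 hJ hJ0 hM hp0 hp1 f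

end HardyCondExp

end

theorem theorem1p2 (p : ℝ) (hp0 : 0 < p) (hp1 : p < 1) (η : ℂ → ℂ) (hη : IsInner η)
    (hη0 : η 0 = 0) :
    ((∃ T : hardy (ENNReal.ofReal p) →ₗ[ℂ] hardy (ENNReal.ofReal p),
        IsBoundedCondExp η (hardy (ENNReal.ofReal p)) T) ↔ IsFiniteBlaschke η) ∧
    (IsFiniteBlaschke η →
      ∃ (T : hardy (ENNReal.ofReal p) →ₗ[ℂ] hardy (ENNReal.ofReal p))
        (S : (⊤ : Submodule ℂ (Lp ℂ (ENNReal.ofReal p) circleMeasure)) →ₗ[ℂ]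
          (⊤ : Submodule ℂ (Lp ℂ (ENNReal.ofReal p) circleMeasure))),
        (IsBoundedCondExp η (hardy (ENNReal.ofReal p)) T ∧
          ∀ T', IsBoundedCondExp η (hardy (ENNReal.ofReal p)) T' → T' = T) ∧
        (IsBoundedCondExp η ⊤ S ∧ ∀ S', IsBoundedCondExp η ⊤ S' → S' = S) ∧
        opNorm T = opNorm S ∧
        opNorm S = derivSup η ^ (1 / p - 1)) := by
  have hP0 : 0 < ENNReal.ofReal p := by simpa using hp0
  refine ⟨⟨fun ⟨T, hT⟩ => hT.isFiniteBlaschke hη hη0 hp0 hp1, fun hB => ?_⟩, fun hB => ?_⟩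
  · obtain ⟨L, hL, h⟩ := hB.exists_condExp hη hη0 hp0 hp1
    exact ⟨_, (h _ hL).1⟩
  · obtain ⟨L, hL, h⟩ := hB.exists_condExp hη hη0 hp0 hp1
    obtain ⟨hT, hTn⟩ := h _ hL
    obtain ⟨hS, hSn⟩ := h ⊤ fun _ _ => Submodule.mem_top
    exact ⟨_, _, ⟨hT, fun T' hT' => hT'.unique hT hP0 hardy_dense_integrable⟩,
      ⟨hS, fun S' hS' => hS'.unique hS hP0 (top_dense_integrable ENNReal.ofReal_ne_top)⟩,
      (hTn le_rfl).trans (hSn le_top).symm, hSn le_top⟩
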